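/- **Model.** Let $k_{rw},k_{rn}\in C^2([0,1])$ be strictly convex with $k_{rw}(0)=0$, $k_{rw}'>0$ on $(0,1]$, $k_{rn}(1)=0$, $k_{rn}'<0$ on $[0,1)$. Let $p_c^{(i)},p_c^{(d)}\in C^1((0,1])$ vanish at $1$ and satisfy $p_c^{(j)\prime}<0$ and $p_c^{(i)}<p_c^{(d)}$ on $(0,1)$. Let $M>0$, $N_g\in\mathbb R$, $f=\frac{k_{rw}}{k_{rw}+Mk_{rn}}$, $h=k_{rn}f$, $F=f+N_gh$. Assume $F'>0$ on $(0,1)$ and that there is $S_o\in(0,1)$ with $F''(S_o)=0$, $F''>0$ on $(0,S_o)$, $F''<0$ on $(S_o,1)$. Write $$c(a,b)=\tfrac{F(b)-F(a)}{b-a},\qquad \ell(S;a,b)=F(a)+c(a,b)(S-a),\qquad \mathcal G(S;a,b)=\tfrac{F(S)-\ell(S;a,b)}{h(S)},$$ and let $\mathcal F(S,p)=p_c^{(d)}(S)-p$ if $p>p_c^{(d)}(S)$, $\mathcal F(S,p)=p_c^{(i)}(S)-p$ if $p<p_c^{(i)}(S)$, and $\mathcal F(S,p)=0$ otherwise. Put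 $E^j_K=(K,p_c^{(j)}(K))$ for $j\in\{i,d\}$. **The region $\mathcal B$.** Fix $S_B\in(0,S_o)$. Let $\bar S\in(S_B,1)$ be the saturation with $F'(\bar S)=c(S_B,\bar S)$ (if there is none, $\bar S:=1$, and then $\mathcal B$ is empty), let $\beta(\alpha)\in[\bar S,1]$ be the abscissa of the third intersection of the graph of $F$ with the chord $\ell(\cdot;S_B,\alpha)$, $\beta(\bar S)=\bar S$, and let $\gamma(\alpha)$ be the first zero in $(S_B,1)$ of $s\mapsto\int_{S_B}^s\mathcal G(S;S_B,\alpha)\,dS$. Assume that for every $\alpha\in(S_B,\bar S]$ the function $\mathcal G(\cdot;S_B,\alpha)$ is not integrable near $S=1$, and let $S_*\in(S_B,\bar S)$ be the point with $\gamma(S_*)=\beta(S_*)$. For $\tau>0$ let $w$ solve $$w'=\frac{c(S_B,\alpha)\,\tau\,\mathcal G(S;S_B,\alpha)}{p_c^{(i)}(S)-w},\qquad w(S_B)=p_c^{(i)}(S_B),\qquad w<p_c^{(i)}\ \text{to the right of } S_B,$$ and let $S_m(\tau,\alpha)$ be the supremum of all $S\in(S_B,1)$ such that $w<p_c^{(i)}$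 on $(S_B,S)$. For $\alpha\in(S_*,\bar S)$ let $\tau_c(\alpha)$ be the $\tau>0$ with $S_m(\tau,\alpha)=\beta(\alpha)$, and let $\bar\tau=\sup\{\tau>0:S_m(\tau,\bar S)=\bar S\}$. For $\tau>\bar\tau$ put $\check S_B(\tau)=\tau_c^{-1}(\tau)$, for $\tau\le\bar\tau$ put $\check S_B(\tau)=\bar S$; put $\hat S_B(\tau)=\beta(\check S_B(\tau))$ and $$\mathcal B=\{(S_T,\tau):\tau>\bar\tau,\ \check S_B(\tau)<S_T<\hat S_B(\tau)\}.$$ **Viscous profiles.** A viscous profile of the shock with right state $a$ and left state $b$ is a solution $(S,p):\mathbb R\to(0,1)\times\mathbb R$ of $$S'=\frac{1}{c(a,b)\,\tau}\mathcal F(S,p),\qquad p'=\mathcal G(S;a,b)$$ with $S(-\infty)=a$, $S(+\infty)=b$ and $p'(\pm\infty)=0$. **Statement.** Let $(S_T,\tau)\in\mathcal B$, $\hat S=\hat S_B(\tau)$, $c_d=c(\hat S,S_T)$ and $c_i=c(S_B,\hat S)$. 1. The system $S'=\frac1{c_d\tau}\mathcal F(S,p)$, $p'=\mathcal G(S;\hat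 S,S_T)$ has an orbit $(S_d,p_d)$ with values in $(0,1)\times\mathbb R$ such that $(S_d,p_d)(\xi)\to E^d_{\hat S}$ as $\xi\to-\infty$, the distance of $(S_d,p_d)(\xi)$ to the segment $\overline{E^i_{S_T}E^d_{S_T}}$ tends to $0$ as $\xi\to+\infty$, and $(S_d,p_d)$ is a viscous profile of the shock with right state $\hat S$ and left state $S_T$. 2. One has $c_d<c_i$, and the two-shock (plateau) function $$S(z,t)=\begin{cases}S_T,& z<c_dt,\\ \hat S,& c_dt<z<c_it,\\ S_B,& z>c_it,\end{cases}$$ is a weak solution of $\partial_tS+\partial_zF(S)=0$, $t>0$, with initial value $S_T$ for $z<0$ and $S_B$ for $z>0$. Its shock at $z=c_dt$ has the drainage wave of part 1 as a viscous profile, and its shock at $z=c_it$ also has a viscous profile. The solution is non-classical: its shock at $z=c_it$ violates the Oleinik condition. -/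

import Mathlib

open Set Filter Topology MeasureTheory
open scoped ContDiff

noncomputable section

/-- `select P d` is a point satisfying `P` if there is one, and `d` otherwise. It is used below for
points that are determined uniquely by the property `P`. -/
def select (P : ℝ → Prop) (d : ℝ) : ℝ :=
  open Classical in if hP : ∃ x, P x then hP.choose else d

/-- The constitutive data of the dimensionless two-phase flow model without hysteresis in the
relative permeabilities: relative permeabilities `krw`, `krn` of the wetting and the non-wetting
phase, capillary pressures `pci` (infiltration) and `pcd` (drainage), the viscosity ratio `M` and
the gravity number `Ng`. Only the values on `[0,1]`, resp. `(0,1]`, matter. -/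
structure TwoPhaseModel where
  krw : ℝ → ℝ
  krn : ℝ → ℝ
  pci : ℝ → ℝ
  pcd : ℝ → ℝ
  M : ℝ
  Ng : ℝ

namespace TwoPhaseModel

variable (D : TwoPhaseModel)

/-- The fractional flow function. -/
def f (S : ℝ) : ℝ := D.krw S / (D.krw S + D.M * D.krn S)

/-- The mobility function `h = krn * f`. -/
def h (S : ℝ) : ℝ := D.krn S * D.f S

/-- The flux function `F = f + Ng * h`. -/
def F (S : ℝ) : ℝ := D.f S + D.Ng * D.h S

/-- The structural assumptions: properties of the capillary pressures, of the relative
permeabilities, and the convex-concave shape of the increasing flux `F` with inflection point `So`.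
(The facts `F ∈ C²([0,1])`, `F 0 = 0`, `F 1 = 1` and `0 ≤ pci, pcd` on `(0,1]` follow from these.) -/
structure ScenarioA (So : ℝ) : Prop where
  M_pos : 0 < D.M
  pci_smooth : ContDiffOn ℝ 1 D.pci (Ioc 0 1)
  pcd_smooth : ContDiffOn ℝ 1 D.pcd (Ioc 0 1)
  pci_one : D.pci 1 = 0
  pcd_one : D.pcd 1 = 0
  pci_deriv_neg : ∀ S ∈ Ioo (0 : ℝ) 1, deriv D.pci S < 0
  pcd_deriv_neg : ∀ S ∈ Ioo (0 : ℝ) 1, deriv D.pcd S < 0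
  pci_lt_pcd : ∀ S ∈ Ioo (0 : ℝ) 1, D.pci S < D.pcd S
  krw_smooth : ContDiffOn ℝ 2 D.krw (Icc 0 1)
  krw_deriv_pos : ∀ S ∈ Ioc (0 : ℝ) 1, 0 < derivWithin D.krw (Icc 0 1) S
  krw_zero : D.krw 0 = 0
  krw_convex : StrictConvexOn ℝ (Icc 0 1) D.krw
  krn_smooth : ContDiffOn ℝ 2 D.krn (Icc 0 1)
  krn_deriv_neg : ∀ S ∈ Ico (0 : ℝ) 1, derivWithin D.krn (Icc 0 1) S < 0
  krn_one : D.krn 1 = 0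
  krn_convex : StrictConvexOn ℝ (Icc 0 1) D.krn
  F_deriv_pos : ∀ S ∈ Ioo (0 : ℝ) 1, 0 < deriv D.F S
  So_mem : So ∈ Ioo (0 : ℝ) 1
  F_inflection : deriv (deriv D.F) So = 0
  F_convex : ∀ S ∈ Ioo (0 : ℝ) So, 0 < deriv (deriv D.F) S
  F_concave : ∀ S ∈ Ioo So (1 : ℝ), deriv (deriv D.F) S < 0

/-- The Rankine-Hugoniot speed of a shock between the saturations `a` and `b`. -/
def speed (a b : ℝ) : ℝ := (D.F b - D.F a) / (b - a)

/-- The chord `ℓ(S; a, b)` of the graph of `F` through the points at `a` and `b`. -/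
def chord (a b S : ℝ) : ℝ := D.F a + D.speed a b * (S - a)

/-- The function `𝒢(S; a, b) = (F(S) - ℓ(S; a, b)) / h(S)`. -/
def G (a b S : ℝ) : ℝ := (D.F S - D.chord a b S) / D.h S

/-- The function `ℱ(S, p)` of play-type capillary hysteresis. -/
def relax (S p : ℝ) : ℝ :=
  if D.pcd S < p then D.pcd S - p else if p < D.pci S then D.pci S - p else 0

/-- The equilibrium point `E^i_K` on the infiltration curve. -/
def Ei (K : ℝ) : ℝ × ℝ := (K, D.pci K)

/-- The equilibrium point `E^d_K` on the drainage curve. -/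
def Ed (K : ℝ) : ℝ × ℝ := (K, D.pcd K)

/-! ### The saturations attached to the initial saturation `SB` -/

/-- The saturation `S̄` in `(SB, 1)` where the line through `(SB, F SB)` is tangent to the graph. -/
def sBar (SB : ℝ) : ℝ := select (fun s => s ∈ Ioo SB 1 ∧ deriv D.F s = D.speed SB s) 1

/-- `β(α)`: the saturation in `[S̄, 1]` of the third intersection point of the graph of `F` with the
chord through `SB` and `α` (`β(S̄) = S̄`). -/
def beta (SB α : ℝ) : ℝ :=
  select (fun b => b ∈ Icc (D.sBar SB) 1 ∧ D.F b = D.chord SB α b) 0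

/-- `γ(α)`: the first non-trivial zero of `s ↦ ∫_{SB}^s 𝒢(S; SB, α) dS`. -/
def gam (SB α : ℝ) : ℝ := sInf {s | s ∈ Ioo SB 1 ∧ ∫ S in SB..s, D.G SB α S = 0}

/-- `S_*`: the value of `α` at which the functions `β` and `γ` intersect. -/
def sStar (SB : ℝ) : ℝ :=
  select (fun α => α ∈ Ioo SB (D.sBar SB) ∧ α < D.beta SB α ∧ D.gam SB α = D.beta SB α) SB

/-- For each `SB < α ≤ S̄` the function `𝒢(·; SB, α)` is not integrable near `S = 1`. -/
def NonintegrableNearOne (SB : ℝ) : Prop :=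
  ∀ α ∈ Ioc SB (D.sBar SB), ∀ a ∈ Ioo SB 1, ¬ IntegrableOn (D.G SB α) (Ioo a 1)

/-- On `[SB, s)` the function `w` represents, in the `(S, p)`-plane, the orbit of the travelling
wave system for `SB` and `ST = α` that leaves `E^i_{SB}` into the region `p < pci S`. -/
structure IsInfiltrationCurve (SB τ α s : ℝ) (w : ℝ → ℝ) : Prop where
  cont : ContinuousOn w (Ico SB s)
  init : w SB = D.pci SB
  below : ∀ r ∈ Ioo SB s, w r < D.pci r
  ode : ∀ r ∈ Ioo SB s,
    HasDerivAt w (D.speed SB α * τ * D.G SB α r / (D.pci r - w r)) r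

/-- `S_m(τ, α)`: the upper limit of the interval on which the orbit leaving `E^i_{SB}` stays in the
region `p < pci S`. -/
def sM (SB τ α : ℝ) : ℝ :=
  sSup {s | s ∈ Ioo SB 1 ∧ ∃ w : ℝ → ℝ, D.IsInfiltrationCurve SB τ α s w}

/-- `τ_m(α) = sup {τ : S_m(τ, α) = α}`. -/
def tauM (SB α : ℝ) : ℝ := sSup {τ | 0 < τ ∧ D.sM SB τ α = α}

/-- `τ̄ = τ_m(S̄)`. -/
def tauBar (SB : ℝ) : ℝ := D.tauM SB (D.sBar SB)

/-- `τ_c(α)`, for `S_* < α < S̄`: the value of `τ` with `S_m(τ, α) = β(α)`. -/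
def tauC (SB α : ℝ) : ℝ :=
  select (fun τ => 0 < τ ∧ α < D.beta SB α ∧ D.sM SB τ α = D.beta SB α) 0

/-- `Š_B(τ)`: the inverse of `τ_c` on `(S_*, S̄)` for `τ > τ̄`, and `S̄` for `τ ≤ τ̄` (where no `α`
in `(S_*, S̄)` has `τ_c(α) = τ`). -/
def sCheck (SB τ : ℝ) : ℝ :=
  select (fun α => α ∈ Ioo (D.sStar SB) (D.sBar SB) ∧ D.tauBar SB < τ ∧ D.tauC SB α = τ)
    (D.sBar SB)

/-- `Ŝ_B(τ) = β(Š_B(τ))`. -/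
def sHat (SB τ : ℝ) : ℝ := D.beta SB (D.sCheck SB τ)

/-- The parameter region `ℬ` of pairs `(ST, τ)`. -/
def regionB (SB : ℝ) : Set (ℝ × ℝ) :=
  {q | D.tauBar SB < q.2 ∧ D.sCheck SB q.2 < q.1 ∧ q.1 < D.sHat SB q.2}

/-! ### Travelling waves and shocks -/

/-- `(S, p)` is an orbit, defined for all `ξ`, in the strip `0 < S < 1`, of the travelling wave
system with speed `c = speed a b`:
`S' = ℱ(S, p) / (c τ)`, `p' = 𝒢(S; a, b)`. -/
structure IsOrbit (τ a b : ℝ) (S p : ℝ → ℝ) : Prop where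
  mem : ∀ ξ, S ξ ∈ Ioo (0 : ℝ) 1
  ode_S : ∀ ξ, HasDerivAt S (D.relax (S ξ) (p ξ) / (D.speed a b * τ)) ξ
  ode_p : ∀ ξ, HasDerivAt p (D.G a b (S ξ)) ξ

/-- `(S, p)` is a viscous profile, in the variable `ξ = c t - z`, of the shock with state `b` on the
left (`z < c t`) and state `a` on the right (`z > c t`). -/
structure IsViscousProfile (τ a b : ℝ) (S p : ℝ → ℝ) : Prop extends D.IsOrbit τ a b S p where
  S_bot : Tendsto S atBot (𝓝 a)
  S_top : Tendsto S atTop (𝓝 b)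
  p_bot : Tendsto (deriv p) atBot (𝓝 0)
  p_top : Tendsto (deriv p) atTop (𝓝 0)

/-- The Oleinik condition for the shock with left state `uL` and right state `uR`. -/
def OleinikShock (uL uR : ℝ) : Prop :=
  ∀ k ∈ Ioo (min uL uR) (max uL uR),
    D.speed uL uR ≤ D.speed uL k ∧ D.speed uR k ≤ D.speed uL uR

/-- `u(z, t)` is a weak solution of `∂ₜ u + ∂_z F(u) = 0` on `ℝ × [0, ∞)` with initial value `uL`
for `z < 0` and `uR` for `z > 0`. -/
def IsWeakRiemannSolution (uL uR : ℝ) (u : ℝ → ℝ → ℝ) : Prop :=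
  Measurable (Function.uncurry u) ∧ (∀ z t, u z t ∈ Icc (0 : ℝ) 1) ∧
  ∀ φ : ℝ → ℝ → ℝ, ContDiff ℝ ∞ (Function.uncurry φ) →
    HasCompactSupport (Function.uncurry φ) →
    (∫ t in Ioi (0 : ℝ), ∫ z : ℝ,
        (u z t * deriv (fun s => φ z s) t + D.F (u z t) * deriv (fun y => φ y t) z))
      + ∫ z : ℝ, (if z < 0 then uL else uR) * φ z 0 = 0

/-- The two-shock function with the plateau `P` between the shock of speed `speed P ST` on the left
and the shock of speed `speed SB P` on the right. -/
def plateau (SB P ST : ℝ) (z t : ℝ) : ℝ :=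
  if z < D.speed P ST * t then ST else if z < D.speed SB P * t then P else SB

end TwoPhaseModel

end

/-! Write `α` for `Š_B(τ)` and `b` for `Ŝ_B(τ)`. Membership in `ℬ` is used only through a few facts:
the graph of `F` meets the chord through `SB` and `α` again at `b`, `SB < α < ST < b`, `τ > 0`, and
the infiltration curve leaving `E^i_{SB}` has `S_m(τ, α) = b`. The convex-concave shape puts `F`
below this chord on `(SB, α)` and above it on `(α, b)` (`sign_of_convex_concave`). Hence `F(ST)`
lies above the chord, which gives `c_d < c_i` and also refutes the Oleinik condition at `k = ST`.

Along an infiltration curve `(pci - w)² / 2 + c_i τ ∫ 𝒢` decreases, so `∫ 𝒢(·; SB, α)` from `SB` is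
nonpositive as long as the curve exists (`integral_G_nonpos`). This has two uses. Near `1` it would
make the positive function `𝒢` integrable, so `b < 1`. At `b` it prepares the drainage wave: the
chord through `b` and `ST` lies strictly above the old one to the left of `b`, so `∫ 𝒢(·; b, ST)`
over `(SB, b)` is strictly negative, and the potential `Γ` of `𝒢(·; b, ST)`, whose minimum is at
`ST`, is smaller at `b` than at `SB` (`drainageData`).

For the infiltration wave, the curve must end on the graph of `pci` at `b`, since otherwise it could
be continued past `S_m`. A curve joining two equilibria below `pci` is then parametrized by an
orbit.

For the drainage wave, shooting backwards in time gives an orbit emanating from `E^d_b`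
(`exists_unstable_orbit`). The energy `κ Γ(S) + ℱ(S, p)² / 2` with `κ = c_d τ` decreases along
orbits and starts at `κ Γ(b)`. Thus the orbit can neither return to `S = b` nor reach `S = SB`, and
it exists and stays bounded for all times (`exists_bounded_orbit`). Barbalat's lemma gives `ℱ → 0`,
so `Γ(S)` converges. A positive limit would keep `𝒢` away from zero and make `p` unbounded.
Therefore `Γ(S) → 0` and `S → ST` (`exists_profile`).

The plateau function is a constant plus two travelling steps. By the Rankine-Hugoniot relation each
step contributes the derivative of the test function along its own shock line, which integrates to
initial data. -/

noncomputable section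

/-! ### Tools from calculus and ordinary differential equations -/

section Flow

variable {E : Type*} [NormedAddCommGroup E] [NormedSpace ℝ E]

/-- A bounded Lipschitz vector field has a global integral curve through each point. -/
theorem exists_global_solution [CompleteSpace E] {V : E → E} {K : NNReal} (hV : LipschitzWith K V)
    {C : ℝ} (hC : ∀ x, ‖V x‖ ≤ C) (x : E) :
    ∃ X : ℝ → E, X 0 = x ∧ ∀ t, HasDerivAt X (V (X t)) t := by
  have hC0 : 0 ≤ C := (norm_nonneg _).trans (hC x)
  have loc : ∀ n : ℕ, ∃ X : ℝ → E, X 0 = x ∧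
      ∀ t ∈ Ioo (-(n + 1 : ℝ)) (n + 1), HasDerivAt X (V (X t)) t := by
    intro n
    have hn : (0 : ℝ) < n + 1 := by positivity
    let t0 : Icc (-(n + 1 : ℝ)) (n + 1) := ⟨0, by constructor <;> linarith⟩
    -- A field bounded by `C` moves a point by at most `C * (n + 1)` in time `n + 1`, so with this
    -- radius the interval length is unrestricted.
    have hPL : IsPicardLindelof (fun _ => V) t0 x (⟨C * (n + 1), by positivity⟩ : NNReal) 0
        ⟨C, hC0⟩ K := by
      refine IsPicardLindelof.of_time_independent (fun y _ => hC y) hV.lipschitzOnWith ?_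
      simp only [t0, sub_zero, zero_sub, neg_neg, max_self, NNReal.coe_zero]
      exact le_refl (C * (n + 1))
    obtain ⟨X, hX0, hX⟩ := hPL.exists_eq_forall_mem_Icc_hasDerivWithinAt₀
    exact ⟨X, hX0, fun t ht => (hX t (Ioo_subset_Icc_self ht)).hasDerivAt (Icc_mem_nhds ht.1 ht.2)⟩
  choose Y hY0 hY using loc
  have agree : ∀ m n : ℕ, m ≤ n → ∀ t ∈ Ioo (-(m + 1 : ℝ)) (m + 1), Y m t = Y n t := by
    intro m n hmn t ht
    have hmn' : (m : ℝ) ≤ n := by exact_mod_cast hmn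
    refine ODE_solution_unique_of_mem_Ioo (v := fun _ => V) (s := fun _ => univ) (K := K) (t₀ := 0)
      (fun _ _ => hV.lipschitzOnWith) ⟨by linarith [ht.1, ht.2], by linarith [ht.1, ht.2]⟩
      (fun s hs => ⟨hY m s hs, trivial⟩) (fun s hs => ⟨hY n s ⟨?_, ?_⟩, trivial⟩) ?_ ht
    · linarith [hs.1]
    · linarith [hs.2]
    · rw [hY0, hY0]
  have mem : ∀ t : ℝ, t ∈ Ioo (-((⌈|t|⌉₊ : ℕ) + 1 : ℝ)) ((⌈|t|⌉₊ : ℕ) + 1) := by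
    intro t
    have := Nat.le_ceil |t|
    constructor
    · linarith [neg_abs_le t]
    · linarith [le_abs_self t]
  -- The index jumps with `t`; near a given time the glued function agrees with the single solution
  -- of index `n + 1`, which can be differentiated.
  refine ⟨fun t => Y ⌈|t|⌉₊ t, hY0 _, fun t => ?_⟩
  set n := ⌈|t|⌉₊ with hn
  have h1 : HasDerivAt (Y (n + 1)) (V (Y (n + 1) t)) t := by
    refine hY (n + 1) t ⟨?_, ?_⟩ <;> push_cast <;> linarith [(mem t).1, (mem t).2]
  have h2 : (fun s => Y ⌈|s|⌉₊ s) =ᶠ[𝓝 t] Y (n + 1) := by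
    filter_upwards [Ioo_mem_nhds (mem t).1 (mem t).2] with s hs
    refine agree _ _ ?_ s (mem s)
    refine Nat.ceil_le.2 (abs_le.2 ⟨?_, ?_⟩) <;> push_cast <;> linarith [hs.1, hs.2]
  refine (h1.congr_of_eventuallyEq h2).congr_deriv ?_
  rw [← agree n (n + 1) (Nat.le_succ n) t (mem t)]

/-- Gronwall's inequality in both directions of time. -/
theorem dist_solutions_le {V : E → E} {K : NNReal} (hV : LipschitzWith K V) {X Y : ℝ → E}
    (hX : ∀ t, HasDerivAt X (V (X t)) t) (hY : ∀ t, HasDerivAt Y (V (Y t)) t) (t : ℝ) :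
    dist (X t) (Y t) ≤ dist (X 0) (Y 0) * Real.exp (K * |t|) := by
  have fwd : ∀ {V : E → E}, LipschitzWith K V → ∀ {X Y : ℝ → E},
      (∀ t, HasDerivAt X (V (X t)) t) → (∀ t, HasDerivAt Y (V (Y t)) t) → ∀ t, 0 ≤ t →
      dist (X t) (Y t) ≤ dist (X 0) (Y 0) * Real.exp (K * t) := by
    intro V hV X Y hX hY t ht
    have := dist_le_of_trajectories_ODE (v := fun _ => V) (f := X) (g := Y) (a := 0) (b := t)
      (fun _ => hV) (fun s _ => (hX s).continuousAt.continuousWithinAt)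
      (fun s _ => (hX s).hasDerivWithinAt) (fun s _ => (hY s).continuousAt.continuousWithinAt)
      (fun s _ => (hY s).hasDerivWithinAt) le_rfl t ⟨ht, le_rfl⟩
    simpa using this
  rcases le_total 0 t with ht | ht
  · rw [abs_of_nonneg ht]; exact fwd hV hX hY t ht
  · have rev : ∀ {X : ℝ → E}, (∀ t, HasDerivAt X (V (X t)) t) →
        ∀ t, HasDerivAt (fun s => X (-s)) (-V (X (-t))) t := by
      intro X hX t
      simpa [Function.comp_def] using (hX (-t)).scomp t (hasDerivAt_neg t)
    have := fwd (V := fun x => -V x) (lipschitzWith_neg_iff.2 hV) (rev hX) (rev hY) (-t) (by linarith)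
    rw [abs_of_nonpos ht]
    simpa using this

/-- An integral curve of a Lipschitz vector field that meets an equilibrium is constant. -/
theorem solution_eq_equilibrium {V : E → E} {K : NNReal} (hV : LipschitzWith K V) {X : ℝ → E}
    (hX : ∀ t, HasDerivAt X (V (X t)) t) {e : E} (he : V e = 0) {t₀ : ℝ} (h0 : X t₀ = e) (t : ℝ) :
    X t = e := by
  have h := ODE_solution_unique_univ (v := fun _ => V) (s := fun _ => univ) (K := K) (f := X)
    (g := fun _ => e) (t₀ := t₀) (fun _ => hV.lipschitzOnWith) (fun t => ⟨hX t, trivial⟩)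
    (fun t => ⟨by simpa [he] using hasDerivAt_const t e, trivial⟩) h0
  exact congrFun h t

end Flow

/-- A vector field that is Lipschitz on a rectangle agrees there with a bounded Lipschitz vector
field on the plane. -/
theorem exists_lipschitz_extension_of_box {W : ℝ × ℝ → ℝ × ℝ} {K : NNReal} {a b c d : ℝ}
    (hab : a ≤ b) (hcd : c ≤ d) (hW : LipschitzOnWith K W (Icc a b ×ˢ Icc c d)) :
    ∃ V : ℝ × ℝ → ℝ × ℝ, LipschitzWith K V ∧ (∃ C, ∀ x, ‖V x‖ ≤ C) ∧
      (∀ x ∈ Icc a b ×ˢ Icc c d, V x = W x) ∧ ∀ x, ∃ y ∈ Icc a b ×ˢ Icc c d, V x = W y := by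
  -- Projection onto the box is 1-Lipschitz, so composing with it preserves the constant `K` and
  -- creates no new values.
  let π : ℝ × ℝ → ℝ × ℝ := fun x => (projIcc a b hab x.1, projIcc c d hcd x.2)
  have hπm : ∀ x, π x ∈ Icc a b ×ˢ Icc c d := fun x =>
    ⟨(projIcc a b hab x.1).2, (projIcc c d hcd x.2).2⟩
  have hπ : LipschitzWith 1 π := by
    have h1 : LipschitzWith 1 (fun x : ℝ × ℝ => ((projIcc a b hab x.1 : Icc a b) : ℝ)) := by
      simpa [Function.comp_def] using LipschitzWith.subtype_val _ |>.comp
        ((LipschitzWith.projIcc hab).comp LipschitzWith.prod_fst)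
    have h2 : LipschitzWith 1 (fun x : ℝ × ℝ => ((projIcc c d hcd x.2 : Icc c d) : ℝ)) := by
      simpa [Function.comp_def] using LipschitzWith.subtype_val _ |>.comp
        ((LipschitzWith.projIcc hcd).comp LipschitzWith.prod_snd)
    simpa using h1.prodMk h2
  have hVl : LipschitzWith K (W ∘ π) := by
    rw [← lipschitzOnWith_univ]
    have := hW.comp (hπ.lipschitzOnWith (s := univ)) (fun x _ => hπm x)
    simpa using this
  refine ⟨W ∘ π, hVl, ?_, fun x hx => ?_, fun x => ⟨π x, hπm x, rfl⟩⟩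
  · obtain ⟨C, hC⟩ := (isCompact_Icc.prod isCompact_Icc).exists_bound_of_continuousOn
      hW.continuousOn
    exact ⟨C, fun x => hC _ (hπm x)⟩
  · simp only [Function.comp, π]
    rw [projIcc_of_mem hab hx.1, projIcc_of_mem hcd hx.2]

/-- Uniqueness for scalar linear equations whose coefficient is bounded above. -/
theorem eq_zero_of_linear_ode {d q : ℝ → ℝ} {a b C : ℝ} (hd : ContinuousOn d (Icc a b))
    (hd' : ∀ t ∈ Ioo a b, HasDerivAt d (q t * d t) t) (hq : ∀ t ∈ Ioo a b, q t ≤ C)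
    (h0 : d a = 0) : ∀ t ∈ Icc a b, d t = 0 := by
  -- The derivative is `-2 (C - q) d² exp (-2Ct)`. No lower bound on `q` enters, so `q` may tend to
  -- `-∞` at `a`.
  have anti : AntitoneOn (fun t => d t ^ 2 * Real.exp (-(2 * C) * t)) (Icc a b) := by
    refine antitoneOn_of_hasDerivWithinAt_nonpos (convex_Icc a b) ?_
      (f' := fun t => 2 * d t * (q t * d t) * Real.exp (-(2 * C) * t)
        + d t ^ 2 * (Real.exp (-(2 * C) * t) * (-(2 * C)))) ?_ ?_
    · exact (hd.pow 2).mul (by fun_prop)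
    · intro t ht
      rw [interior_Icc] at ht
      have h1 := (hd' t ht).pow 2
      have h2 : HasDerivAt (fun t => Real.exp (-(2 * C) * t))
          (Real.exp (-(2 * C) * t) * (-(2 * C))) t := by
        simpa using ((hasDerivAt_id t).const_mul (-(2 * C))).exp
      have h3 := h1.mul h2
      refine (h3.congr_deriv ?_).hasDerivWithinAt
      simp
    · intro t ht
      rw [interior_Icc] at ht
      have h1 := hq t ht
      have h2 := Real.exp_pos (-(2 * C) * t)
      have : 2 * d t * (q t * d t) * Real.exp (-(2 * C) * t)
        + d t ^ 2 * (Real.exp (-(2 * C) * t) * (-(2 * C)))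
        = - (2 * ((C - q t) * (d t ^ 2 * Real.exp (-(2 * C) * t)))) := by ring
      rw [this]
      have : 0 ≤ (C - q t) * (d t ^ 2 * Real.exp (-(2 * C) * t)) :=
        mul_nonneg (by linarith) (by positivity)
      linarith
  intro t ht
  have h := anti ⟨le_rfl, ht.1.trans ht.2⟩ ht ht.1
  simp only [h0, ne_eq, OfNat.ofNat_ne_zero, not_false_eq_true, zero_pow, zero_mul] at h
  have h2 := Real.exp_pos (-(2 * C) * t)
  by_contra hne
  have : 0 < d t ^ 2 * Real.exp (-(2 * C) * t) := by positivity
  linarith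

/-- A solution of a scalar linear equation that vanishes at a point vanishes near that point. -/
theorem eventually_eq_zero_of_linear_ode {d q : ℝ → ℝ} {t₀ : ℝ}
    (hd : ∀ᶠ t in 𝓝 t₀, HasDerivAt d (q t * d t) t) (hq : ContinuousAt q t₀) (h0 : d t₀ = 0) :
    ∀ᶠ t in 𝓝 t₀, d t = 0 := by
  have hb : ∀ᶠ t in 𝓝 t₀, ‖q t‖ < ‖q t₀‖ + 1 :=
    hq.norm.eventually (gt_mem_nhds (lt_add_one _))
  refine ODE_solution_unique_of_eventually (v := fun t x => q t * x) (s := fun _ => univ)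
    (K := ‖q t₀‖₊ + 1) (f := d) (g := fun _ => 0) ?_ (hd.mono fun t ht => ⟨ht, trivial⟩)
    (Eventually.of_forall fun t => ⟨by simpa using hasDerivAt_const t (0 : ℝ), trivial⟩) h0
  filter_upwards [hb] with t ht
  refine LipschitzOnWith.of_dist_le_mul fun x _ y _ => ?_
  rw [dist_eq_norm, dist_eq_norm, ← mul_sub, norm_mul]
  gcongr
  simpa using ht.le

/-- If `f` and `f'` both have limits at infinity, then the limit of `f'` is zero. -/
theorem eq_zero_of_tendsto_of_tendsto_deriv {f f' : ℝ → ℝ} {l m : ℝ}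
    (hf : ∀ᶠ t in atTop, HasDerivAt f (f' t) t) (hl : Tendsto f atTop (𝓝 l))
    (hm : Tendsto f' atTop (𝓝 m)) : m = 0 := by
  obtain ⟨T, hT⟩ := eventually_atTop.1 hf
  -- The mean value theorem on `[t, t + 1]` yields points tending to infinity at which `f'` equals
  -- an increment of `f` that tends to zero.
  have key : ∀ t : ℝ, ∃ s, t ≤ s ∧ (T ≤ t → f' s = f (t + 1) - f t) := by
    intro t
    by_cases h : T ≤ t
    · obtain ⟨s, hs, hs'⟩ := exists_hasDerivAt_eq_slope f f' (show t < t + 1 by linarith)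
        (fun r hr => (hT r (h.trans hr.1)).continuousAt.continuousWithinAt)
        (fun r hr => hT r (h.trans hr.1.le))
      exact ⟨s, hs.1.le, fun _ => by rw [hs']; simp⟩
    · exact ⟨t, le_rfl, fun h' => absurd h' h⟩
  choose s hs1 hs2 using key
  have h1 : Tendsto (fun t => f' (s t)) atTop (𝓝 m) :=
    hm.comp (tendsto_atTop_mono hs1 tendsto_id)
  have h2 : Tendsto (fun t => f (t + 1) - f t) atTop (𝓝 (l - l)) :=
    (hl.comp (tendsto_atTop_add_const_right _ 1 tendsto_id)).sub hl
  rw [sub_self] at h2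
  refine tendsto_nhds_unique h1 (h2.congr' ?_)
  filter_upwards [eventually_ge_atTop T] with t ht using (hs2 t ht).symm

/-- The version of `eq_zero_of_tendsto_of_tendsto_deriv` at `-∞`. -/
theorem eq_zero_of_tendsto_of_tendsto_deriv_atBot {f f' : ℝ → ℝ} {l m : ℝ}
    (hf : ∀ᶠ t in atBot, HasDerivAt f (f' t) t) (hl : Tendsto f atBot (𝓝 l))
    (hm : Tendsto f' atBot (𝓝 m)) : m = 0 := by
  have h := eq_zero_of_tendsto_of_tendsto_deriv (f := fun t => f (-t)) (f' := fun t => -f' (-t))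
    (l := l) (m := -m) ?_ (hl.comp tendsto_neg_atTop_atBot)
    ((hm.comp tendsto_neg_atTop_atBot).neg)
  · linarith
  · filter_upwards [tendsto_neg_atTop_atBot.eventually hf] with t ht
    simpa [Function.comp_def] using ht.scomp t (hasDerivAt_neg t)

/-- The square of the positive part is continuously differentiable. -/
theorem hasDerivAt_max_zero_sq (x : ℝ) :
    HasDerivAt (fun y : ℝ => max y 0 ^ 2) (2 * max x 0) x := by
  rcases lt_trichotomy x 0 with h | h | h
  · have : (fun y : ℝ => max y 0 ^ 2) =ᶠ[𝓝 x] fun _ => 0 := by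
      filter_upwards [Iio_mem_nhds h] with y hy
      rw [max_eq_right (le_of_lt hy)]; simp
    rw [max_eq_right h.le, mul_zero]
    exact (hasDerivAt_const x 0).congr_of_eventuallyEq this
  · subst h
    rw [max_self, mul_zero, hasDerivAt_iff_isLittleO]
    refine Asymptotics.IsBigO.trans_isLittleO (g := fun y : ℝ => y ^ 2) ?_ ?_
    · refine Asymptotics.IsBigO.of_bound 1 (Eventually.of_forall fun y => ?_)
      simp only [max_self, ne_eq, OfNat.ofNat_ne_zero, not_false_eq_true, zero_pow, sub_zero,
        smul_zero, norm_pow, Real.norm_eq_abs, one_mul]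
      have : |max y 0| ≤ |y| := by
        rcases le_total y 0 with h | h
        · rw [max_eq_right h]; simp
        · rw [max_eq_left h]
      gcongr
    · simpa using Asymptotics.isLittleO_pow_id (𝕜 := ℝ) (n := 2) (by norm_num)
  · have : (fun y : ℝ => max y 0 ^ 2) =ᶠ[𝓝 x] fun y => y ^ 2 := by
      filter_upwards [Ioi_mem_nhds h] with y hy
      rw [max_eq_left (le_of_lt hy)]
    rw [max_eq_left h.le]
    simpa using (hasDerivAt_pow 2 x).congr_of_eventuallyEq this

end

noncomputable section

/-! ### Convex-concave functions -/

theorem StrictConvexOn.three_point {s : Set ℝ} {φ : ℝ → ℝ} (h : StrictConvexOn ℝ s φ) {x y z : ℝ}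
    (hx : x ∈ s) (hz : z ∈ s) (hxy : x < y) (hyz : y < z) :
    (z - x) * φ y < (z - y) * φ x + (y - x) * φ z := by
  have hxz : 0 < z - x := by linarith
  have h1 := h.2 hx hz (hxy.trans hyz).ne
    (div_pos (sub_pos.2 hyz) hxz) (div_pos (sub_pos.2 hxy) hxz) (by field_simp; ring)
  simp only [smul_eq_mul] at h1
  have e : (z - y) / (z - x) * x + (y - x) / (z - x) * z = y := by field_simp; ring
  rw [e] at h1
  calc (z - x) * φ y < (z - x) * ((z - y) / (z - x) * φ x + (y - x) / (z - x) * φ z) :=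
        mul_lt_mul_of_pos_left h1 hxz
    _ = _ := by field_simp

theorem StrictConcaveOn.three_point {s : Set ℝ} {φ : ℝ → ℝ} (h : StrictConcaveOn ℝ s φ) {x y z : ℝ}
    (hx : x ∈ s) (hz : z ∈ s) (hxy : x < y) (hyz : y < z) :
    (z - y) * φ x + (y - x) * φ z < (z - x) * φ y := by
  have := (neg_strictConvexOn_iff.2 h).three_point hx hz hxy hyz
  simp only [Pi.neg_apply] at this
  linarith

/-- The signs, between its last two zeros `x < b`, and before, of a function that is strictly
convex on `[0, o]` and strictly concave on `[o, 1]`. -/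
theorem sign_of_convex_concave {φ : ℝ → ℝ} {o a x b : ℝ} (hcv : StrictConvexOn ℝ (Icc 0 o) φ)
    (hcc : StrictConcaveOn ℝ (Icc o 1) φ) (ha0 : 0 ≤ a) (hao : a ≤ o) (hax : a < x) (hxb : x < b)
    (hb1 : b ≤ 1) (ha : φ a ≤ 0) (hx : φ x = 0) (hb : φ b = 0) :
    (∀ s ∈ Ioo a x, φ s < 0) ∧ ∀ s ∈ Ioo x b, 0 < φ s := by
  have cv : ∀ r s t : ℝ, 0 ≤ r → r < s → s < t → t ≤ o →
      (t - r) * φ s < (t - s) * φ r + (s - r) * φ t := fun r s t h0 hrs hst hto =>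
    hcv.three_point ⟨h0, by linarith⟩ ⟨by linarith, hto⟩ hrs hst
  have cc : ∀ r s t : ℝ, o ≤ r → r < s → s < t → t ≤ 1 →
      (t - s) * φ r + (s - r) * φ t < (t - r) * φ s := fun r s t h0 hrs hst hto =>
    hcc.three_point ⟨h0, by linarith⟩ ⟨by linarith, hto⟩ hrs hst
  -- If `b` were in the convex part, then `φ a ≤ 0 = φ b` would force `φ x < 0`.
  have hob : o < b := by
    by_contra! h
    have := cv a x b ha0 hax hxb h
    rw [hx, hb] at this
    nlinarith
  rcases lt_or_ge x o with hxo | hxo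
  -- With `x` in the convex part, `φ` is positive after this zero up to `o`, and concavity between
  -- `φ o > 0` and `φ b = 0` continues the sign to `b`.
  · have pos : ∀ s, x < s → s ≤ o → 0 < φ s := fun s h1 h2 => by
      have := cv a x s ha0 hax h1 h2
      rw [hx] at this
      have h3 : 0 < (x - a) * φ s := by nlinarith
      exact pos_of_mul_pos_right h3 (by linarith)
    refine ⟨fun s hs => ?_, fun s hs => ?_⟩
    · have := cv a s x ha0 hs.1 hs.2 hxo.le
      rw [hx] at this
      have h3 : (x - a) * φ s < 0 := by nlinarith [hs.2]
      exact neg_of_mul_neg_right h3 (by linarith)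
    · rcases le_or_gt s o with h | h
      · exact pos s hs.1 h
      · have := cc o s b le_rfl h hs.2 hb1
        rw [hb] at this
        have h3 : 0 < (b - o) * φ s := by
          nlinarith [mul_pos (sub_pos.2 hs.2) (pos o hxo le_rfl)]
        exact pos_of_mul_pos_right h3 (by linarith)
  -- With `x` in the concave part, the zeros `x` and `b` force `φ < 0` on `[o, x)`; then `φ o ≤ 0`,
  -- and convexity between `a` and `o` continues the sign to the left.
  · have neg : ∀ s, o ≤ s → s < x → φ s < 0 := fun s h1 h2 => by
      have := cc s x b h1 h2 hxb hb1
      rw [hx, hb] at this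
      have h3 : (b - x) * φ s < 0 := by nlinarith
      exact neg_of_mul_neg_right h3 (by linarith)
    refine ⟨fun s hs => ?_, fun s hs => ?_⟩
    · rcases le_or_gt o s with h | h
      · exact neg s h hs.2
      · have h0 : φ o ≤ 0 := by
          rcases hxo.eq_or_lt with h' | h'
          · rw [h', hx]
          · exact (neg o le_rfl h').le
        have := cv a s o ha0 hs.1 h le_rfl
        have h3 : (o - a) * φ s < 0 := by
          nlinarith [mul_nonneg (sub_nonneg.2 h.le) (neg_nonneg.2 ha),
            mul_nonneg (sub_nonneg.2 hs.1.le) (neg_nonneg.2 h0)]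
        exact neg_of_mul_neg_right h3 (by linarith)
    · have := cc x s b hxo hs.1 hs.2 hb1
      rw [hx, hb] at this
      have h3 : 0 < (b - x) * φ s := by nlinarith
      exact pos_of_mul_pos_right h3 (by linarith)

theorem select_spec {P : ℝ → Prop} (d : ℝ) (h : ∃ x, P x) : P (select P d) := by
  rw [select, dif_pos h]; exact h.choose_spec

theorem select_default {P : ℝ → Prop} (d : ℝ) (h : ¬ ∃ x, P x) : select P d = d := by
  rw [select, dif_neg h]

namespace TwoPhaseModel

variable {D : TwoPhaseModel} {So : ℝ}

/-! ### Elementary properties of the model -/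


theorem ScenarioA.krw_pos (hA : D.ScenarioA So) {S : ℝ} (hS : S ∈ Ioc (0 : ℝ) 1) :
    0 < D.krw S := by
  have mono : StrictMonoOn D.krw (Icc 0 1) := by
    refine strictMonoOn_of_deriv_pos (convex_Icc 0 1) hA.krw_smooth.continuousOn fun x hx => ?_
    rw [interior_Icc] at hx
    rw [← derivWithin_of_mem_nhds (Icc_mem_nhds hx.1 hx.2)]
    exact hA.krw_deriv_pos x ⟨hx.1, hx.2.le⟩
  have := mono ⟨le_rfl, zero_le_one⟩ ⟨hS.1.le, hS.2⟩ hS.1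
  rwa [hA.krw_zero] at this

theorem ScenarioA.krn_pos (hA : D.ScenarioA So) {S : ℝ} (hS : S ∈ Ico (0 : ℝ) 1) :
    0 < D.krn S := by
  have anti : StrictAntiOn D.krn (Icc 0 1) := by
    refine strictAntiOn_of_deriv_neg (convex_Icc 0 1) hA.krn_smooth.continuousOn fun x hx => ?_
    rw [interior_Icc] at hx
    rw [← derivWithin_of_mem_nhds (Icc_mem_nhds hx.1 hx.2)]
    exact hA.krn_deriv_neg x ⟨hx.1.le, hx.2⟩
  have := anti ⟨hS.1, hS.2.le⟩ ⟨zero_le_one, le_rfl⟩ hS.2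
  rwa [hA.krn_one] at this

theorem ScenarioA.denominator_pos (hA : D.ScenarioA So) {S : ℝ} (hS : S ∈ Icc (0 : ℝ) 1) :
    0 < D.krw S + D.M * D.krn S := by
  rcases hS.1.eq_or_lt with h | h
  · subst h
    have := mul_pos hA.M_pos (hA.krn_pos ⟨le_rfl, zero_lt_one⟩)
    rw [hA.krw_zero]; linarith
  · have h1 := hA.krw_pos ⟨h, hS.2⟩
    rcases hS.2.eq_or_lt with h' | h'
    · subst h'
      rw [hA.krn_one]; linarith
    · have := mul_pos hA.M_pos (hA.krn_pos ⟨hS.1, h'⟩)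
      linarith

theorem ScenarioA.contDiffOn_f (hA : D.ScenarioA So) : ContDiffOn ℝ 2 D.f (Icc 0 1) :=
  hA.krw_smooth.div (hA.krw_smooth.add (contDiffOn_const.mul hA.krn_smooth))
    fun _ hS => (hA.denominator_pos hS).ne'

theorem ScenarioA.contDiffOn_h (hA : D.ScenarioA So) : ContDiffOn ℝ 2 D.h (Icc 0 1) :=
  hA.krn_smooth.mul hA.contDiffOn_f

theorem ScenarioA.contDiffOn_F (hA : D.ScenarioA So) : ContDiffOn ℝ 2 D.F (Icc 0 1) :=
  hA.contDiffOn_f.add (contDiffOn_const.mul hA.contDiffOn_h)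

theorem ScenarioA.h_pos (hA : D.ScenarioA So) {S : ℝ} (hS : S ∈ Ioo (0 : ℝ) 1) : 0 < D.h S :=
  mul_pos (hA.krn_pos ⟨hS.1.le, hS.2⟩)
    (div_pos (hA.krw_pos ⟨hS.1, hS.2.le⟩) (hA.denominator_pos ⟨hS.1.le, hS.2.le⟩))

theorem ScenarioA.strictMonoOn_F (hA : D.ScenarioA So) : StrictMonoOn D.F (Icc 0 1) := by
  refine strictMonoOn_of_deriv_pos (convex_Icc 0 1) hA.contDiffOn_F.continuousOn fun x hx => ?_
  rw [interior_Icc] at hx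
  exact hA.F_deriv_pos x hx

theorem ScenarioA.strictConvexOn_F (hA : D.ScenarioA So) : StrictConvexOn ℝ (Icc 0 So) D.F := by
  refine strictConvexOn_of_deriv2_pos (convex_Icc 0 So)
    (hA.contDiffOn_F.continuousOn.mono (Icc_subset_Icc_right hA.So_mem.2.le)) fun x hx => ?_
  rw [interior_Icc] at hx
  exact hA.F_convex x hx

theorem ScenarioA.strictConcaveOn_F (hA : D.ScenarioA So) : StrictConcaveOn ℝ (Icc So 1) D.F := by
  refine strictConcaveOn_of_deriv2_neg (convex_Icc So 1)
    (hA.contDiffOn_F.continuousOn.mono (Icc_subset_Icc_left hA.So_mem.1.le)) fun x hx => ?_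
  rw [interior_Icc] at hx
  exact hA.F_concave x hx

theorem ScenarioA.strictConvexOn_sub_chord (hA : D.ScenarioA So) (a b : ℝ) :
    StrictConvexOn ℝ (Icc 0 So) (fun S => D.F S - D.chord a b S) := by
  refine ⟨convex_Icc _ _, fun x hx y hy hxy r t hr ht hrt => ?_⟩
  have := hA.strictConvexOn_F.2 hx hy hxy hr ht hrt
  simp only [smul_eq_mul, chord] at this ⊢
  have e : t = 1 - r := by linarith
  subst e
  linarith

theorem ScenarioA.strictConcaveOn_sub_chord (hA : D.ScenarioA So) (a b : ℝ) :
    StrictConcaveOn ℝ (Icc So 1) (fun S => D.F S - D.chord a b S) := by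
  refine ⟨convex_Icc _ _, fun x hx y hy hxy r t hr ht hrt => ?_⟩
  have := hA.strictConcaveOn_F.2 hx hy hxy hr ht hrt
  simp only [smul_eq_mul, chord] at this ⊢
  have e : t = 1 - r := by linarith
  subst e
  linarith

theorem ScenarioA.speed_pos (hA : D.ScenarioA So) {a b : ℝ} (ha : a ∈ Icc (0 : ℝ) 1)
    (hb : b ∈ Icc (0 : ℝ) 1) (hab : a ≠ b) : 0 < D.speed a b := by
  rcases lt_or_gt_of_ne hab with h | h
  · exact div_pos (sub_pos.2 (hA.strictMonoOn_F ha hb h)) (sub_pos.2 h)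
  · exact div_pos_of_neg_of_neg (sub_neg.2 (hA.strictMonoOn_F hb ha h)) (sub_neg.2 h)

theorem chord_left (a b : ℝ) : D.chord a b a = D.F a := by simp [chord]

theorem chord_right (a b : ℝ) : D.chord a b b = D.F b := by
  rcases eq_or_ne a b with rfl | h
  · simp [chord]
  · have : b - a ≠ 0 := sub_ne_zero.2 h.symm
    rw [chord, speed]; field_simp; ring

theorem speed_eq_of_chord_eq {a b c : ℝ} (hc : a ≠ c) (h : D.F c = D.chord a b c) :
    D.speed a c = D.speed a b := by
  have : c - a ≠ 0 := sub_ne_zero.2 hc.symm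
  rw [speed, h, chord]; field_simp; ring

theorem speed_comm (a b : ℝ) : D.speed a b = D.speed b a := by
  rw [speed, speed, ← neg_sub (D.F a), ← neg_sub a, neg_div_neg_eq]

theorem G_congr {a b c : ℝ} (h : D.speed a c = D.speed a b) : D.G a c = D.G a b := by
  funext S; rw [G, G, chord, chord, h]

theorem ScenarioA.contDiffOn_G (hA : D.ScenarioA So) (a b : ℝ) :
    ContDiffOn ℝ 1 (D.G a b) (Ioo 0 1) := by
  have h2 : (1 : WithTop ℕ∞) ≤ 2 := by norm_num
  refine ContDiffOn.div (((hA.contDiffOn_F.of_le h2).mono Ioo_subset_Icc_self).sub ?_)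
    ((hA.contDiffOn_h.of_le h2).mono Ioo_subset_Icc_self) fun S hS => (hA.h_pos hS).ne'
  unfold chord
  fun_prop

theorem ScenarioA.continuousOn_G (hA : D.ScenarioA So) (a b : ℝ) :
    ContinuousOn (D.G a b) (Ioo 0 1) := (hA.contDiffOn_G a b).continuousOn

theorem ScenarioA.continuousAt_G (hA : D.ScenarioA So) (a b : ℝ) {S : ℝ} (hS : S ∈ Ioo (0 : ℝ) 1) :
    ContinuousAt (D.G a b) S := (hA.continuousOn_G a b).continuousAt (Ioo_mem_nhds hS.1 hS.2)

theorem G_eq_zero {a b S : ℝ} (h : D.F S = D.chord a b S) : D.G a b S = 0 := by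
  rw [G, h, sub_self, zero_div]

theorem ScenarioA.G_pos (hA : D.ScenarioA So) {a b S : ℝ} (hS : S ∈ Ioo (0 : ℝ) 1)
    (h : 0 < D.F S - D.chord a b S) : 0 < D.G a b S := div_pos h (hA.h_pos hS)

theorem ScenarioA.G_neg (hA : D.ScenarioA So) {a b S : ℝ} (hS : S ∈ Ioo (0 : ℝ) 1)
    (h : D.F S - D.chord a b S < 0) : D.G a b S < 0 := div_neg_of_neg_of_pos h (hA.h_pos hS)

theorem ScenarioA.hasDerivAt_pci (hA : D.ScenarioA So) {S : ℝ} (hS : S ∈ Ioo (0 : ℝ) 1) :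
    HasDerivAt D.pci (deriv D.pci S) S :=
  ((hA.pci_smooth.contDiffAt (Ioc_mem_nhds hS.1 hS.2)).differentiableAt (by norm_num)).hasDerivAt

theorem ScenarioA.hasDerivAt_pcd (hA : D.ScenarioA So) {S : ℝ} (hS : S ∈ Ioo (0 : ℝ) 1) :
    HasDerivAt D.pcd (deriv D.pcd S) S :=
  ((hA.pcd_smooth.contDiffAt (Ioc_mem_nhds hS.1 hS.2)).differentiableAt (by norm_num)).hasDerivAt

theorem ScenarioA.continuousOn_deriv_pci (hA : D.ScenarioA So) :
    ContinuousOn (deriv D.pci) (Ioo 0 1) :=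
  (hA.pci_smooth.mono Ioo_subset_Ioc_self).continuousOn_deriv_of_isOpen isOpen_Ioo le_rfl

theorem ScenarioA.continuousOn_deriv_pcd (hA : D.ScenarioA So) :
    ContinuousOn (deriv D.pcd) (Ioo 0 1) :=
  (hA.pcd_smooth.mono Ioo_subset_Ioc_self).continuousOn_deriv_of_isOpen isOpen_Ioo le_rfl

theorem ScenarioA.strictAntiOn_pci (hA : D.ScenarioA So) : StrictAntiOn D.pci (Ioo 0 1) :=
  strictAntiOn_of_deriv_neg (convex_Ioo 0 1)
    (hA.pci_smooth.continuousOn.mono Ioo_subset_Ioc_self)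
    fun x hx => hA.pci_deriv_neg x (interior_subset hx)

theorem ScenarioA.strictAntiOn_pcd (hA : D.ScenarioA So) : StrictAntiOn D.pcd (Ioo 0 1) :=
  strictAntiOn_of_deriv_neg (convex_Ioo 0 1)
    (hA.pcd_smooth.continuousOn.mono Ioo_subset_Ioc_self)
    fun x hx => hA.pcd_deriv_neg x (interior_subset hx)

/-- Because `pci < pcd`, at most one of the two positive parts is nonzero. In this form Lipschitz
continuity and the energy computation are accessible. -/
theorem ScenarioA.relax_eq (hA : D.ScenarioA So) {S : ℝ} (hS : S ∈ Ioo (0 : ℝ) 1) (p : ℝ) :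
    D.relax S p = max (D.pci S - p) 0 - max (p - D.pcd S) 0 := by
  have h := hA.pci_lt_pcd S hS
  unfold relax
  split_ifs with h1 h2
  · rw [max_eq_right (by linarith), max_eq_left (by linarith)]; ring
  · rw [max_eq_left (by linarith), max_eq_right (by linarith)]; ring
  · rw [max_eq_right (by linarith), max_eq_right (by linarith)]; ring

/-! ### The numbers attached to a point of the region `ℬ` -/

/-- In the convex part a chord has smaller slope than the tangent at its right end, so the tangent
from `SB` touches in the concave part, and there the graph lies strictly below its tangent after the
contact point. Without a tangent point `S̄ = 1` and nothing is left to prove. The lemma makes the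
fallback value of `sCheck` incompatible with `ℬ`. -/
theorem ScenarioA.beta_sBar_le (hA : D.ScenarioA So) {SB : ℝ} (hSB : SB ∈ Ioo 0 So)
    (hmem : D.beta SB (D.sBar SB) ∈ Icc (D.sBar SB) 1)
    (hF : D.F (D.beta SB (D.sBar SB)) = D.chord SB (D.sBar SB) (D.beta SB (D.sBar SB))) :
    D.beta SB (D.sBar SB) ≤ D.sBar SB := by
  set b := D.beta SB (D.sBar SB)
  by_contra! hlt
  by_cases hex : ∃ s, s ∈ Ioo SB 1 ∧ deriv D.F s = D.speed SB s
  · have hs : D.sBar SB ∈ Ioo SB 1 ∧ deriv D.F (D.sBar SB) = D.speed SB (D.sBar SB) :=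
      select_spec 1 hex
    set x := D.sBar SB
    have hx0 : x ∈ Ioo (0 : ℝ) 1 := ⟨hSB.1.trans hs.1.1, hs.1.2⟩
    have hd : HasDerivAt D.F (D.speed SB x) x := by
      rw [← hs.2]
      exact ((hA.contDiffOn_F.contDiffAt (Icc_mem_nhds hx0.1 hx0.2)).differentiableAt
        (by norm_num)).hasDerivAt
    rcases le_or_gt x So with h | h
    · have := hA.strictConvexOn_F.slope_lt_of_hasDerivAt ⟨hSB.1.le, hSB.2.le⟩ ⟨hx0.1.le, h⟩
        hs.1.1 hd
      rw [slope_def_field] at this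
      exact lt_irrefl _ this
    · have := hA.strictConcaveOn_F.slope_lt_of_hasDerivAt ⟨h.le, hx0.2.le⟩
        ⟨by linarith, hmem.2⟩ hlt hd
      rw [slope_def_field, div_lt_iff₀ (sub_pos.2 hlt)] at this
      have e1 := chord_right (D := D) SB x
      rw [chord] at e1 hF
      linarith
  · have : D.sBar SB = 1 := select_default 1 hex
    linarith [hmem.2]

theorem tauBar_nonneg (SB : ℝ) : 0 ≤ D.tauBar SB :=
  Real.sSup_nonneg fun _ h => h.1.le

/-- What is needed below of a point of the region `ℬ`. -/
theorem ScenarioA.exists_of_mem_regionB (hA : D.ScenarioA So) {SB ST τ : ℝ} (hSB : SB ∈ Ioo 0 So)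
    (hB : (ST, τ) ∈ D.regionB SB) :
    ∃ α, SB < α ∧ α ≤ D.sBar SB ∧ α < ST ∧ ST < D.sHat SB τ ∧ D.sHat SB τ ≤ 1 ∧ 0 < τ ∧
      D.F (D.sHat SB τ) = D.chord SB α (D.sHat SB τ) ∧ D.sM SB τ α = D.sHat SB τ := by
  obtain ⟨hτ, hlo, hhi⟩ := hB
  simp only at hτ hlo hhi
  -- `τ̄` is a supremum of positive numbers; it is nonnegative even for an empty or unbounded set,
  -- where `sSup` has the value `0`.
  have hτ0 : 0 < τ := (tauBar_nonneg SB).trans_lt hτ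
  have hbar : SB < D.sBar SB := by
    by_cases hex : ∃ s, s ∈ Ioo SB 1 ∧ deriv D.F s = D.speed SB s
    · exact (select_spec (P := fun s => s ∈ Ioo SB 1 ∧ deriv D.F s = D.speed SB s) 1 hex).1.1
    · have : D.sBar SB = 1 := select_default 1 hex
      rw [this]; exact hSB.2.trans hA.So_mem.2
  -- The default value of `beta` is `0`, so positivity guarantees a genuine intersection point.
  have hbeta : ∀ α, 0 < D.beta SB α →
      D.beta SB α ∈ Icc (D.sBar SB) 1 ∧ D.F (D.beta SB α) = D.chord SB α (D.beta SB α) := by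
    intro α hpos
    by_cases hex : ∃ b, b ∈ Icc (D.sBar SB) 1 ∧ D.F b = D.chord SB α b
    · exact select_spec 0 hex
    · have : D.beta SB α = 0 := select_default 0 hex
      exact absurd this hpos.ne'
  by_cases hex : ∃ α, α ∈ Ioo (D.sStar SB) (D.sBar SB) ∧ D.tauBar SB < τ ∧ D.tauC SB α = τ
  · have h1 : D.sCheck SB τ ∈ Ioo (D.sStar SB) (D.sBar SB) ∧ D.tauBar SB < τ ∧
      D.tauC SB (D.sCheck SB τ) = τ := select_spec _ hex
    have hstar : SB ≤ D.sStar SB := by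
      by_cases hex' : ∃ α, α ∈ Ioo SB (D.sBar SB) ∧ α < D.beta SB α ∧ D.gam SB α = D.beta SB α
      · exact (select_spec (P := fun α => α ∈ Ioo SB (D.sBar SB) ∧ α < D.beta SB α ∧
          D.gam SB α = D.beta SB α) SB hex').1.1.le
      · exact (select_default SB hex').ge
    set α := D.sCheck SB τ with hα
    have hSBα : SB < α := hstar.trans_lt h1.1.1
    -- The default value of `tauC` is `0`, whereas here `tauC` equals `τ > 0`.
    have hex2 : ∃ τ, 0 < τ ∧ α < D.beta SB α ∧ D.sM SB τ α = D.beta SB α := by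
      by_contra hno
      have : D.tauC SB α = 0 := select_default 0 hno
      linarith [h1.2.2]
    have h2 : 0 < D.tauC SB α ∧ α < D.beta SB α ∧ D.sM SB (D.tauC SB α) α = D.beta SB α :=
      select_spec 0 hex2
    rw [h1.2.2] at h2
    have h3 := hbeta α (hSB.1.trans (hSBα.trans h2.2.1))
    exact ⟨α, hSBα, h1.1.2.le, hlo, hhi, h3.1.2, hτ0, h3.2, h2.2.2⟩
  -- In the fallback case a point of `ℬ` would satisfy `S̄ < ST < β(S̄)`, against `beta_sBar_le`.
  · have h1 : D.sCheck SB τ = D.sBar SB := select_default _ hex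
    exfalso
    rw [sHat, h1] at hhi
    rw [h1] at hlo
    have h0 : 0 < D.beta SB (D.sBar SB) := (hSB.1.trans hbar).trans (hlo.trans hhi)
    have h2 := hbeta _ h0
    linarith [hA.beta_sBar_le hSB h2.1 h2.2]

end TwoPhaseModel

end

noncomputable section

/-! ### Weak solutions with two shocks -/

section Shear

variable {φ : ℝ → ℝ → ℝ}

theorem hasDerivAt_partial_left (hφ : ContDiff ℝ ∞ (Function.uncurry φ)) (z t : ℝ) :
    HasDerivAt (fun y => φ y t) (fderiv ℝ (Function.uncurry φ) (z, t) (1, 0)) z := by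
  have h1 : HasFDerivAt (Function.uncurry φ) _ (z, t) :=
    (hφ.differentiable (by simp) (z, t)).hasFDerivAt
  exact h1.comp_hasDerivAt z ((hasDerivAt_id z).prodMk (hasDerivAt_const z t))

theorem hasDerivAt_partial_right (hφ : ContDiff ℝ ∞ (Function.uncurry φ)) (z t : ℝ) :
    HasDerivAt (fun s => φ z s) (fderiv ℝ (Function.uncurry φ) (z, t) (0, 1)) t := by
  have h1 : HasFDerivAt (Function.uncurry φ) _ (z, t) :=
    (hφ.differentiable (by simp) (z, t)).hasFDerivAt
  exact h1.comp_hasDerivAt t ((hasDerivAt_const t z).prodMk (hasDerivAt_id t))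

theorem continuous_fderiv_apply (hφ : ContDiff ℝ ∞ (Function.uncurry φ)) (v : ℝ × ℝ) :
    Continuous fun x => fderiv ℝ (Function.uncurry φ) x v :=
  (hφ.continuous_fderiv (by simp)).clm_apply continuous_const

theorem hasCompactSupport_fderiv_apply (hc : HasCompactSupport (Function.uncurry φ)) (v : ℝ × ℝ) :
    HasCompactSupport fun x => fderiv ℝ (Function.uncurry φ) x v :=
  (hc.fderiv ℝ).comp_left (g := fun L : ℝ × ℝ →L[ℝ] ℝ => L v) rfl

theorem hasCompactSupport_section_left {g : ℝ × ℝ → ℝ} (hg : HasCompactSupport g) (t : ℝ) :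
    HasCompactSupport fun z => g (z, t) := by
  refine HasCompactSupport.intro (hg.image continuous_fst) fun z hz => ?_
  by_contra h
  exact hz ⟨(z, t), subset_tsupport _ h, rfl⟩

theorem hasCompactSupport_section_right {g : ℝ × ℝ → ℝ} (hg : HasCompactSupport g) (z : ℝ) :
    HasCompactSupport fun t => g (z, t) := by
  refine HasCompactSupport.intro (hg.image continuous_snd) fun t ht => ?_
  by_contra h
  exact ht ⟨(z, t), subset_tsupport _ h, rfl⟩

/-- The derivative of a test function along the lines `z = c t + y`. -/
def shearDeriv (φ : ℝ → ℝ → ℝ) (c z t : ℝ) : ℝ :=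
  fderiv ℝ (Function.uncurry φ) (z, t) (c, 1)

theorem shearDeriv_eq (hφ : ContDiff ℝ ∞ (Function.uncurry φ)) (c z t : ℝ) :
    shearDeriv φ c z t = deriv (fun s => φ z s) t + c * deriv (fun y => φ y t) z := by
  rw [(hasDerivAt_partial_left hφ z t).deriv, (hasDerivAt_partial_right hφ z t).deriv, shearDeriv]
  have : ((c, 1) : ℝ × ℝ) = (0, 1) + c • (1, 0) := by simp
  rw [this, map_add, map_smul, smul_eq_mul]

/-- The homeomorphism `(y, t) ↦ (y + c t, t)`. -/
def shearHomeo (c : ℝ) : ℝ × ℝ ≃ₜ ℝ × ℝ where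
  toFun x := (x.1 + c * x.2, x.2)
  invFun x := (x.1 - c * x.2, x.2)
  left_inv x := by simp
  right_inv x := by simp
  continuous_toFun := by fun_prop
  continuous_invFun := by fun_prop

theorem integrable_shearDeriv (hφ : ContDiff ℝ ∞ (Function.uncurry φ))
    (hc : HasCompactSupport (Function.uncurry φ)) (c : ℝ) :
    Integrable (fun x : ℝ × ℝ => shearDeriv φ c (x.1 + c * x.2) x.2) := by
  refine Continuous.integrable_of_hasCompactSupport ?_ ?_
  · exact (continuous_fderiv_apply hφ (c, 1)).comp (shearHomeo c).continuous
  · exact (hasCompactSupport_fderiv_apply hc (c, 1)).comp_homeomorph (shearHomeo c)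

theorem integrable_indicator_mul_section {g : ℝ × ℝ → ℝ} (hg : Continuous g)
    (hc : HasCompactSupport g) {A : Set ℝ} (hA : MeasurableSet A) (t : ℝ) :
    Integrable fun z => A.indicator (fun _ => (1 : ℝ)) z * g (z, t) := by
  have h : Integrable fun z => g (z, t) :=
    Continuous.integrable_of_hasCompactSupport (by fun_prop) (hasCompactSupport_section_left hc t)
  refine (h.indicator hA).congr (Eventually.of_forall fun z => ?_)
  by_cases hz : z ∈ A <;> simp [hz]

/-- The contribution of the region to one side of a shock, or of the whole plane. -/
theorem integral_shear (hφ : ContDiff ℝ ∞ (Function.uncurry φ))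
    (hc : HasCompactSupport (Function.uncurry φ)) (c : ℝ) {A : Set ℝ} (hA : MeasurableSet A) :
    IntegrableOn (fun t => ∫ z, A.indicator (fun _ => (1 : ℝ)) (z - c * t) * shearDeriv φ c z t)
      (Ioi 0) ∧
    ∫ t in Ioi (0 : ℝ), ∫ z, A.indicator (fun _ => (1 : ℝ)) (z - c * t) * shearDeriv φ c z t =
      - ∫ y, A.indicator (fun _ => (1 : ℝ)) y * φ y 0 := by
  have e : ∀ t, ∫ z, A.indicator (fun _ => (1 : ℝ)) (z - c * t) * shearDeriv φ c z t =
      ∫ y, A.indicator (fun _ => (1 : ℝ)) y * shearDeriv φ c (y + c * t) t := by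
    intro t
    have := integral_sub_right_eq_self (μ := volume)
      (fun y => A.indicator (fun _ => (1 : ℝ)) y * shearDeriv φ c (y + c * t) t) (c * t)
    simpa using this
  simp_rw [e]
  have hint : Integrable (fun x : ℝ × ℝ =>
      A.indicator (fun _ => (1 : ℝ)) x.1 * shearDeriv φ c (x.1 + c * x.2) x.2)
      (volume.prod volume) := by
    refine ((integrable_shearDeriv hφ hc c).indicator (hA.preimage measurable_fst)).congr
      (Eventually.of_forall fun x => ?_)
    by_cases hx : x.1 ∈ A <;> simp [hx]
  have hint' : Integrable (fun x : ℝ × ℝ =>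
      A.indicator (fun _ => (1 : ℝ)) x.1 * shearDeriv φ c (x.1 + c * x.2) x.2)
      (volume.prod (volume.restrict (Ioi 0))) := by
    refine hint.mono_measure ?_
    exact Measure.prod_mono le_rfl Measure.restrict_le_self
  refine ⟨hint.integral_prod_right.integrableOn, ?_⟩
  -- In the sheared variables Fubini moves the time integral inside; on each line the integrand is
  -- the derivative of `t ↦ φ(y + c t, t)`, which integrates over `t > 0` to `-φ(y, 0)`.
  rw [integral_integral_swap (f := fun t y => A.indicator (fun _ => (1 : ℝ)) y *
    shearDeriv φ c (y + c * t) t) hint'.swap, ← integral_neg]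
  refine integral_congr_ae (Eventually.of_forall fun y => ?_)
  simp only
  rw [integral_const_mul, ← mul_neg]
  congr 1
  let f : ℝ → ℝ := fun t => φ (y + c * t) t
  have hf : ContDiff ℝ 1 f := by
    have : f = Function.uncurry φ ∘ fun t => (y + c * t, t) := rfl
    rw [this]
    exact (hφ.of_le (by exact_mod_cast le_top)).comp (by fun_prop)
  have hfc : HasCompactSupport f :=
    hasCompactSupport_section_right (hc.comp_homeomorph (shearHomeo c)) y
  have hd : ∀ t, deriv f t = shearDeriv φ c (y + c * t) t := by
    intro t
    have h1 : HasFDerivAt (Function.uncurry φ) _ (y + c * t, t) :=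
      (hφ.differentiable (by simp) (y + c * t, t)).hasFDerivAt
    have h2 : HasDerivAt (fun t => (y + c * t, t)) (c, 1) t := by
      refine HasDerivAt.prodMk ?_ (hasDerivAt_id t)
      simpa using ((hasDerivAt_id t).const_mul c).const_add y
    exact (h1.comp_hasDerivAt (f := fun t => (y + c * t, t)) t h2).deriv
  have := hfc.integral_Ioi_deriv_eq hf 0
  simp_rw [hd] at this
  simpa [f] using this

end Shear

namespace TwoPhaseModel

variable {D : TwoPhaseModel}

/-- Since `c_d t < c_i t`, the plateau is a superposition of two steps. The free function `g` makes
the same decomposition available for the state and for its flux. -/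
theorem plateau_eq {SB P ST : ℝ} (hlt : D.speed P ST < D.speed SB P) {t : ℝ} (ht : 0 < t) (z : ℝ)
    (g : ℝ → ℝ) : g (D.plateau SB P ST z t) = g SB +
      (g P - g SB) * (Iio 0).indicator (fun _ => (1 : ℝ)) (z - D.speed SB P * t) +
      (g ST - g P) * (Iio 0).indicator (fun _ => (1 : ℝ)) (z - D.speed P ST * t) := by
  have h := mul_lt_mul_of_pos_right hlt ht
  simp only [plateau, indicator, mem_Iio, sub_neg]
  split_ifs <;> first | ring1 | (exfalso; linarith)

theorem isWeakRiemannSolution_plateau {SB P ST : ℝ} (hSB : SB ∈ Icc (0 : ℝ) 1)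
    (hP : P ∈ Icc (0 : ℝ) 1) (hST : ST ∈ Icc (0 : ℝ) 1) (h1 : SB ≠ P) (h2 : P ≠ ST)
    (hlt : D.speed P ST < D.speed SB P) :
    D.IsWeakRiemannSolution ST SB (D.plateau SB P ST) := by
  refine ⟨?_, fun z t => ?_, fun φ hφ hc => ?_⟩
  · have e : Function.uncurry (D.plateau SB P ST) = fun x : ℝ × ℝ =>
        if x.1 < D.speed P ST * x.2 then ST else if x.1 < D.speed SB P * x.2 then P else SB := rfl
    rw [e]
    refine Measurable.ite (measurableSet_lt (by fun_prop) (by fun_prop)) measurable_const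
      (Measurable.ite (measurableSet_lt (by fun_prop) (by fun_prop)) measurable_const
        measurable_const)
  · unfold plateau; split_ifs <;> assumption
  · set ci := D.speed SB P with hci
    set cd := D.speed P ST with hcd
    have ei : D.F P - D.F SB = (P - SB) * ci := by
      rw [hci, speed, mul_div_cancel₀ _ (sub_ne_zero.2 h1.symm)]
    have ed : D.F ST - D.F P = (ST - P) * cd := by
      rw [hcd, speed, mul_div_cancel₀ _ (sub_ne_zero.2 h2.symm)]
    let χ : Set ℝ → ℝ → ℝ := fun A => A.indicator (fun _ => (1 : ℝ))
    let J : Set ℝ → ℝ → ℝ → ℝ := fun A c t => ∫ z, χ A (z - c * t) * shearDeriv φ c z t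
    have hs : ∀ c : ℝ, ∀ A : Set ℝ, MeasurableSet A → ∀ t : ℝ,
        Integrable fun z => χ A (z - c * t) * shearDeriv φ c z t := by
      intro c A hA t
      refine (integrable_indicator_mul_section (continuous_fderiv_apply hφ (c, 1))
        (hasCompactSupport_fderiv_apply hc (c, 1)) (A := (fun z => z - c * t) ⁻¹' A)
        (hA.preimage (by fun_prop)) t).congr (Eventually.of_forall fun z => ?_)
      rfl
    have hz : ∀ t : ℝ, Integrable (fun z => fderiv ℝ (Function.uncurry φ) (z, t) (1, 0)) :=
      fun t => by
        simpa using integrable_indicator_mul_section (continuous_fderiv_apply hφ (1, 0))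
          (hasCompactSupport_fderiv_apply hc (1, 0)) MeasurableSet.univ t
    have hz0 : ∀ t : ℝ, ∫ z, fderiv ℝ (Function.uncurry φ) (z, t) (1, 0) = 0 := fun t => by
      refine integral_eq_zero_of_hasDerivAt_of_integrable
        (fun z => hasDerivAt_partial_left hφ z t) (hz t) ?_
      simpa using integrable_indicator_mul_section hφ.continuous hc MeasurableSet.univ t
    have hinner : ∀ t ∈ Ioi (0 : ℝ),
        ∫ z, (D.plateau SB P ST z t * deriv (fun s => φ z s) t +
          D.F (D.plateau SB P ST z t) * deriv (fun y => φ y t) z) =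
        SB * J univ 0 t + ((P - SB) * J (Iio 0) ci t + (ST - P) * J (Iio 0) cd t) := by
      intro t ht
      -- By `ei` and `ed` each flux jump is the shock speed times the state jump, so each step
      -- multiplies the derivative of `φ` along its own line. What remains is `F(SB) ∂_z φ`, whose
      -- integral in `z` vanishes.
      have e : ∀ z, D.plateau SB P ST z t * deriv (fun s => φ z s) t +
          D.F (D.plateau SB P ST z t) * deriv (fun y => φ y t) z =
          (SB * (χ univ (z - 0 * t) * shearDeriv φ 0 z t) +
            D.F SB * fderiv ℝ (Function.uncurry φ) (z, t) (1, 0)) +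
          ((P - SB) * (χ (Iio 0) (z - ci * t) * shearDeriv φ ci z t) +
            (ST - P) * (χ (Iio 0) (z - cd * t) * shearDeriv φ cd z t)) := by
        intro z
        have p1 := plateau_eq hlt ht z id
        have p2 := plateau_eq hlt ht z D.F
        simp only [id] at p1
        rw [p2, p1, ei, ed, shearDeriv_eq hφ, shearDeriv_eq hφ, shearDeriv_eq hφ,
          (hasDerivAt_partial_left hφ z t).deriv]
        simp only [χ, indicator_univ]
        ring
      simp_rw [e]
      rw [integral_add, integral_add, integral_add, integral_const_mul, integral_const_mul,
        integral_const_mul, integral_const_mul, hz0, mul_zero, add_zero]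
      · exact (hs ci _ measurableSet_Iio t).const_mul _
      · exact (hs cd _ measurableSet_Iio t).const_mul _
      · exact (hs 0 _ MeasurableSet.univ t).const_mul _
      · exact (hz t).const_mul _
      · exact ((hs 0 _ MeasurableSet.univ t).const_mul _).add ((hz t).const_mul _)
      · exact ((hs ci _ measurableSet_Iio t).const_mul _).add
          ((hs cd _ measurableSet_Iio t).const_mul _)
    rw [setIntegral_congr_fun measurableSet_Ioi hinner]
    obtain ⟨i0, v0⟩ := integral_shear hφ hc 0 MeasurableSet.univ
    obtain ⟨i1, v1⟩ := integral_shear hφ hc ci (measurableSet_Iio (a := (0 : ℝ)))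
    obtain ⟨i2, v2⟩ := integral_shear hφ hc cd (measurableSet_Iio (a := (0 : ℝ)))
    have hinit : ∫ z, (if z < 0 then ST else SB) * φ z 0 =
        SB * (∫ z, χ univ z * φ z 0) + (ST - SB) * ∫ z, χ (Iio 0) z * φ z 0 := by
      rw [← integral_const_mul, ← integral_const_mul, ← integral_add]
      · refine integral_congr_ae (Eventually.of_forall fun z => ?_)
        simp only [χ, indicator, mem_Iio, mem_univ, if_true]
        split_ifs <;> ring
      · exact (integrable_indicator_mul_section hφ.continuous hc MeasurableSet.univ 0).const_mul _
      · exact (integrable_indicator_mul_section hφ.continuous hc measurableSet_Iio 0).const_mul _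
    have j0 : Integrable (fun t => SB * J univ 0 t) (volume.restrict (Ioi 0)) := i0.const_mul SB
    have j1 : Integrable (fun t => (P - SB) * J (Iio 0) ci t) (volume.restrict (Ioi 0)) :=
      i1.const_mul (P - SB)
    have j2 : Integrable (fun t => (ST - P) * J (Iio 0) cd t) (volume.restrict (Ioi 0)) :=
      i2.const_mul (ST - P)
    have j12 : Integrable (fun t => (P - SB) * J (Iio 0) ci t + (ST - P) * J (Iio 0) cd t)
      (volume.restrict (Ioi 0)) := j1.add j2
    rw [hinit, integral_add j0 j12, integral_add j1 j2, integral_const_mul,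
      integral_const_mul, integral_const_mul]
    simp only [J, χ]
    rw [v0, v1, v2]
    ring

end TwoPhaseModel

end

noncomputable section

namespace TwoPhaseModel

variable {D : TwoPhaseModel} {So : ℝ}

/-! ### The vector field of the travelling wave system -/

theorem Icc_subset_Ioo_zero_one {s₁ s₂ : ℝ} (h1 : 0 < s₁) (h2 : s₂ < 1) :
    Icc s₁ s₂ ⊆ Ioo (0 : ℝ) 1 := fun _ hS => ⟨h1.trans_le hS.1, hS.2.trans_lt h2⟩

/-- The positive part is 1-Lipschitz, and the capillary pressures are `C¹` on the compact interval.
The interval avoids `0`, where they may be singular; `p` needs no restriction. -/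
theorem ScenarioA.exists_lipschitzOnWith_relax (hA : D.ScenarioA So) {s₁ s₂ : ℝ} (h1 : 0 < s₁)
    (h2 : s₂ < 1) :
    ∃ K, LipschitzOnWith K (fun x : ℝ × ℝ => D.relax x.1 x.2) (Icc s₁ s₂ ×ˢ univ) := by
  have hsub := Icc_subset_Ioo_zero_one h1 h2
  obtain ⟨Ki, hi⟩ := (hA.pci_smooth.mono (hsub.trans Ioo_subset_Ioc_self)).exists_lipschitzOnWith
    one_ne_zero (convex_Icc s₁ s₂) isCompact_Icc
  obtain ⟨Kd, hd⟩ := (hA.pcd_smooth.mono (hsub.trans Ioo_subset_Ioc_self)).exists_lipschitzOnWith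
    one_ne_zero (convex_Icc s₁ s₂) isCompact_Icc
  have fst : LipschitzOnWith 1 (Prod.fst : ℝ × ℝ → ℝ) (Icc s₁ s₂ ×ˢ univ) :=
    LipschitzWith.prod_fst.lipschitzOnWith
  have snd : LipschitzOnWith 1 (Prod.snd : ℝ × ℝ → ℝ) (Icc s₁ s₂ ×ˢ univ) :=
    LipschitzWith.prod_snd.lipschitzOnWith
  have hi' := (hi.comp fst (fun x hx => hx.1)).sub snd
  have hd' := snd.sub (hd.comp fst (fun x hx => hx.1))
  have hmax : LipschitzWith 1 (fun y : ℝ => max y 0) := by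
    simpa using LipschitzWith.id.max_const (0 : ℝ)
  have h := (hmax.comp_lipschitzOnWith hi').sub (hmax.comp_lipschitzOnWith hd')
  refine ⟨1 * (Ki * 1 + 1) + 1 * (1 + Kd * 1), fun x hx y hy => ?_⟩
  simp only [hA.relax_eq (hsub hx.1) x.2, hA.relax_eq (hsub hy.1) y.2]
  exact h hx hy

theorem ScenarioA.exists_lipschitzOnWith_field (hA : D.ScenarioA So) {s₁ s₂ : ℝ} (h1 : 0 < s₁)
    (h2 : s₂ < 1) (κ a b : ℝ) :
    ∃ K, LipschitzOnWith K (fun x : ℝ × ℝ => (D.relax x.1 x.2 / κ, D.G a b x.1))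
      (Icc s₁ s₂ ×ˢ univ) := by
  obtain ⟨K, hK⟩ := hA.exists_lipschitzOnWith_relax h1 h2
  obtain ⟨L, hL⟩ := ((hA.contDiffOn_G a b).mono
    (Icc_subset_Ioo_zero_one h1 h2)).exists_lipschitzOnWith
    one_ne_zero (convex_Icc s₁ s₂) isCompact_Icc
  have fst : LipschitzOnWith 1 (Prod.fst : ℝ × ℝ → ℝ) (Icc s₁ s₂ ×ˢ univ) :=
    LipschitzWith.prod_fst.lipschitzOnWith
  have e1 : LipschitzWith ‖κ⁻¹‖₊ (fun y : ℝ => y / κ) := by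
    refine LipschitzWith.of_dist_le_mul fun x y => ?_
    rw [dist_eq_norm, dist_eq_norm, ← sub_div, div_eq_inv_mul, norm_mul]
    rfl
  exact ⟨_, (e1.comp_lipschitzOnWith hK).prodMk (hL.comp fst fun x hx => hx.1)⟩

/-- The vector field of the travelling wave system, restricted to a rectangle, extends to a bounded
Lipschitz field on the plane. -/
theorem ScenarioA.exists_field_extension (hA : D.ScenarioA So) {s₁ s₂ p₁ p₂ : ℝ} (h1 : 0 < s₁)
    (h12 : s₁ ≤ s₂) (h2 : s₂ < 1) (hp : p₁ ≤ p₂) (κ a b : ℝ) :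
    ∃ (V : ℝ × ℝ → ℝ × ℝ) (K : NNReal), LipschitzWith K V ∧ (∃ C, ∀ x, ‖V x‖ ≤ C) ∧
      ∀ x ∈ Icc s₁ s₂ ×ˢ Icc p₁ p₂, V x = (D.relax x.1 x.2 / κ, D.G a b x.1) := by
  obtain ⟨K, hK⟩ := hA.exists_lipschitzOnWith_field h1 h2 κ a b
  obtain ⟨V, h1, h2, h3, -⟩ := exists_lipschitz_extension_of_box h12 hp
    (hK.mono (prod_mono_right (subset_univ (Icc p₁ p₂))))
  exact ⟨V, K, h1, h2, h3⟩

theorem ScenarioA.hasDerivAt_integral_G (hA : D.ScenarioA So) (a b : ℝ) {x₀ x : ℝ}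
    (h0 : x₀ ∈ Ioo (0 : ℝ) 1) (hx : x ∈ Ioo (0 : ℝ) 1) :
    HasDerivAt (fun s => ∫ S in x₀..s, D.G a b S) (D.G a b x) x := by
  have hsub : uIcc x₀ x ⊆ Ioo (0 : ℝ) 1 := ordConnected_Ioo.uIcc_subset h0 hx
  refine intervalIntegral.integral_hasDerivAt_right
    ((hA.continuousOn_G a b).mono hsub).intervalIntegrable ?_ (hA.continuousAt_G a b hx)
  exact (hA.continuousOn_G a b).stronglyMeasurableAtFilter isOpen_Ioo x hx

/-! ### Infiltration curves -/

section Curves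

variable {SB τ α s b : ℝ} {w w₁ w₂ : ℝ → ℝ}

theorem IsInfiltrationCurve.mono (hw : D.IsInfiltrationCurve SB τ α s w) {r : ℝ} (h : r ≤ s) :
    D.IsInfiltrationCurve SB τ α r w :=
  ⟨hw.cont.mono (Ico_subset_Ico_right h), hw.init,
    fun x hx => hw.below x ⟨hx.1, hx.2.trans_le h⟩, fun x hx => hw.ode x ⟨hx.1, hx.2.trans_le h⟩⟩

/-- By the equation for `w`, the function `(pci - w)² / 2 + κ ∫ 𝒢` has derivative `(pci - w) pci' ≤
0`. It vanishes at `SB`, and its first term is nonnegative. -/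
theorem IsInfiltrationCurve.integral_G_nonpos (hA : D.ScenarioA So) (hSB : 0 < SB) (hs : s ≤ 1)
    (hκ : 0 < D.speed SB α * τ) (hw : D.IsInfiltrationCurve SB τ α s w) {r : ℝ}
    (hr : r ∈ Ioo SB s) : ∫ S in SB..r, D.G SB α S ≤ 0 := by
  set κ := D.speed SB α * τ with hκdef
  have hmem : ∀ x ∈ Icc SB r, x ∈ Ioo (0 : ℝ) 1 := fun x hx =>
    ⟨hSB.trans_le hx.1, (hx.2.trans_lt hr.2).trans_le hs⟩
  have hSBm := hmem SB ⟨le_rfl, hr.1.le⟩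
  have anti : AntitoneOn
      (fun x => (D.pci x - w x) ^ 2 / 2 + κ * ∫ S in SB..x, D.G SB α S) (Icc SB r) := by
    refine antitoneOn_of_hasDerivWithinAt_nonpos (convex_Icc SB r) ?_
      (f' := fun x => (D.pci x - w x) * deriv D.pci x) ?_ ?_
    · refine ContinuousOn.add ?_ (continuousOn_const.mul ?_)
      · refine ContinuousOn.div_const (ContinuousOn.pow (ContinuousOn.sub ?_ ?_) 2) 2
        · exact hA.pci_smooth.continuousOn.mono fun x hx => Ioo_subset_Ioc_self (hmem x hx)
        · exact hw.cont.mono fun x hx => ⟨hx.1, hx.2.trans_lt hr.2⟩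
      · exact fun x hx =>
          (hA.hasDerivAt_integral_G SB α hSBm (hmem x hx)).continuousAt.continuousWithinAt
    · intro x hx
      rw [interior_Icc] at hx
      have hx' : x ∈ Ioo SB s := ⟨hx.1, hx.2.trans hr.2⟩
      have hxm := hmem x (Ioo_subset_Icc_self hx)
      have hu : D.pci x - w x ≠ 0 := (sub_pos.2 (hw.below x hx')).ne'
      have h1 := ((((hA.hasDerivAt_pci hxm).sub (hw.ode x hx')).pow 2).div_const 2).add
        ((hA.hasDerivAt_integral_G SB α hSBm hxm).const_mul κ)
      refine (h1.congr_deriv ?_).hasDerivWithinAt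
      simp only [Pi.sub_apply]
      field_simp
      ring
    · intro x hx
      rw [interior_Icc] at hx
      exact mul_nonpos_of_nonneg_of_nonpos
        (sub_nonneg.2 (hw.below x ⟨hx.1, hx.2.trans hr.2⟩).le)
        (hA.pci_deriv_neg x (hmem x (Ioo_subset_Icc_self hx))).le
  have h := anti ⟨le_rfl, hr.1.le⟩ ⟨hr.1.le, le_rfl⟩ hr.1.le
  simp only [hw.init, sub_self, intervalIntegral.integral_same] at h
  have h3 : κ * ∫ S in SB..r, D.G SB α S ≤ 0 := by nlinarith [sq_nonneg (D.pci r - w r)]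
  exact nonpos_of_mul_nonpos_right h3 hκ

/-- The right-hand side is singular at `SB`, so the usual uniqueness theorem does not apply. The
difference satisfies `d' = q d` with `q = κ 𝒢 / ((pci - w₁)(pci - w₂))`. Near `SB` the sign of `𝒢`
gives `q ≤ 0`, and from `α` on `q` is bounded by compactness; an upper bound for `q` suffices. -/
theorem IsInfiltrationCurve.unique (hA : D.ScenarioA So) (hSB : 0 < SB)
    (hα : SB < α) (hκ : 0 < D.speed SB α * τ) (hGneg : ∀ S ∈ Ioo SB α, D.G SB α S < 0)
    (h1 : D.IsInfiltrationCurve SB τ α s w₁) (h2 : D.IsInfiltrationCurve SB τ α s w₂)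
    (hs : s ≤ 1) : ∀ r ∈ Ico SB s, w₁ r = w₂ r := by
  intro r hr
  set κ := D.speed SB α * τ with hκdef
  let q : ℝ → ℝ := fun x => κ * D.G SB α x / ((D.pci x - w₁ x) * (D.pci x - w₂ x))
  obtain ⟨C, hC⟩ : ∃ C, ∀ x ∈ Icc α r, ‖q x‖ ≤ C := by
    refine isCompact_Icc.exists_bound_of_continuousOn ?_
    have hmem : ∀ x ∈ Icc α r, x ∈ Ioo SB s := fun x hx =>
      ⟨hα.trans_le hx.1, hx.2.trans_lt hr.2⟩
    have hmem' : ∀ x ∈ Icc α r, x ∈ Ioo (0 : ℝ) 1 := fun x hx =>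
      ⟨hSB.trans (hmem x hx).1, (hmem x hx).2.trans_le hs⟩
    have hp : ContinuousOn D.pci (Icc α r) :=
      hA.pci_smooth.continuousOn.mono fun x hx => Ioo_subset_Ioc_self (hmem' x hx)
    refine ContinuousOn.div (continuousOn_const.mul ((hA.continuousOn_G SB α).mono hmem'))
      ((hp.sub (h1.cont.mono fun x hx => Ioo_subset_Ico_self (hmem x hx))).mul
        (hp.sub (h2.cont.mono fun x hx => Ioo_subset_Ico_self (hmem x hx)))) fun x hx => ?_
    exact (mul_pos (sub_pos.2 (h1.below x (hmem x hx))) (sub_pos.2 (h2.below x (hmem x hx)))).ne'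
  have key := eq_zero_of_linear_ode (d := fun x => w₁ x - w₂ x) (q := q) (a := SB) (b := r)
    (C := max C 0) ?_ ?_ ?_ (by simp [h1.init, h2.init]) r ⟨hr.1, le_rfl⟩
  · simpa [sub_eq_zero] using key
  · exact (h1.cont.sub h2.cont).mono fun x hx => ⟨hx.1, hx.2.trans_lt hr.2⟩
  · intro x hx
    have hx' : x ∈ Ioo SB s := ⟨hx.1, hx.2.trans hr.2⟩
    have u1 : D.pci x - w₁ x ≠ 0 := (sub_pos.2 (h1.below x hx')).ne'
    have u2 : D.pci x - w₂ x ≠ 0 := (sub_pos.2 (h2.below x hx')).ne'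
    refine ((h1.ode x hx').sub (h2.ode x hx')).congr_deriv ?_
    simp only [q, hκdef]
    field_simp
    ring
  · intro x hx
    rcases lt_or_ge x α with h | h
    · have hx' : x ∈ Ioo SB s := ⟨hx.1, hx.2.trans hr.2⟩
      refine le_trans ?_ (le_max_right _ _)
      refine div_nonpos_of_nonpos_of_nonneg
        (mul_nonpos_of_nonneg_of_nonpos hκ.le (hGneg x ⟨hx.1, h⟩).le) ?_
      exact (mul_pos (sub_pos.2 (h1.below x hx')) (sub_pos.2 (h2.below x hx'))).le
    · exact ((le_abs_self _).trans (hC x ⟨h, hx.2.le⟩)).trans (le_max_left _ _)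

theorem exists_curve_of_lt_sM (hb : D.sM SB τ α = b) (hb0 : 0 < b) {r : ℝ} (hr : r < b) :
    ∃ s, r < s ∧ s ∈ Ioo SB 1 ∧ ∃ w, D.IsInfiltrationCurve SB τ α s w := by
  -- Without any curve the supremum would be `sSup ∅ = 0`, against `b > 0`.
  have hne : {s | s ∈ Ioo SB 1 ∧ ∃ w : ℝ → ℝ, D.IsInfiltrationCurve SB τ α s w}.Nonempty := by
    by_contra h
    rw [not_nonempty_iff_eq_empty] at h
    rw [sM, h, Real.sSup_empty] at hb
    exact hb0.ne hb
  rw [← hb] at hr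
  obtain ⟨s, hs, hrs⟩ := exists_lt_of_lt_csSup hne hr
  exact ⟨s, hrs, hs.1, hs.2⟩

theorem le_of_curve (hb : D.sM SB τ α = b) (hs : s ∈ Ioo SB 1)
    (hw : D.IsInfiltrationCurve SB τ α s w) : s ≤ b := by
  rw [← hb]
  exact le_csSup ⟨1, fun x hx => hx.1.2.le⟩ ⟨hs, w, hw⟩

/-- The infiltration curve exists up to the saturation `S_m`. -/
theorem ScenarioA.exists_curve_sM (hA : D.ScenarioA So) (hSB : 0 < SB) (hα : SB < α)
    (hκ : 0 < D.speed SB α * τ) (hGneg : ∀ S ∈ Ioo SB α, D.G SB α S < 0)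
    (hb : D.sM SB τ α = b) (hSBb : SB < b) :
    ∃ w, D.IsInfiltrationCurve SB τ α b w := by
  have hex : ∀ r : ℝ, ∃ s, ∃ w, r < b → r < s ∧ s ∈ Ioo SB 1 ∧
      D.IsInfiltrationCurve SB τ α s w := by
    intro r
    by_cases hr : r < b
    · obtain ⟨s, h1, h2, w, h3⟩ := exists_curve_of_lt_sM hb (hSB.trans hSBb) hr
      exact ⟨s, w, fun _ => ⟨h1, h2, h3⟩⟩
    · exact ⟨0, id, fun h => absurd h hr⟩
  choose σ W hW using hex
  have agree : ∀ r m, r ∈ Ico SB b → m < b → r < m → W r r = W m r := by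
    intro r m hr hm hrm
    obtain ⟨a1, a2, a3⟩ := hW r hr.2
    obtain ⟨b1, b2, b3⟩ := hW m hm
    refine (a3.mono (min_le_left _ (σ m))).unique hA hSB hα hκ hGneg (b3.mono (min_le_right _ _))
      ((min_le_left _ _).trans a2.2.le) r ⟨hr.1, lt_min a1 (hrm.trans b1)⟩
  have near : ∀ r ∈ Ico SB b, ∃ m, r < m ∧ m < b ∧ D.IsInfiltrationCurve SB τ α m (W m) ∧
      ∀ x ∈ Ico SB m, W x x = W m x := by
    intro r hr
    have hm : (r + b) / 2 < b := by linarith [hr.2]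
    refine ⟨(r + b) / 2, by linarith [hr.2], hm, (hW _ hm).2.2.mono (hW _ hm).1.le,
      fun x hx => agree x _ ⟨hx.1, hx.2.trans hm⟩ hm hx.2⟩
  -- `W r` is a curve reaching beyond `r`. By uniqueness all of them agree where they are defined,
  -- so locally the diagonal is a single curve.
  refine ⟨fun r => W r r, ⟨fun r hr => ?_, ?_, fun r hr => ?_, fun r hr => ?_⟩⟩
  · obtain ⟨m, hrm, hmb, hm, heq⟩ := near r hr
    have h1 : ContinuousWithinAt (W m) (Ico SB b) r :=
      (hm.cont r ⟨hr.1, hrm⟩).mono_of_mem_nhdsWithin (by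
        have : Iio m ∈ 𝓝 r := Iio_mem_nhds hrm
        filter_upwards [mem_nhdsWithin_of_mem_nhds this, self_mem_nhdsWithin] with x h1 h2
        exact ⟨h2.1, h1⟩)
    refine h1.congr_of_eventuallyEq ?_ (heq r ⟨hr.1, hrm⟩)
    filter_upwards [mem_nhdsWithin_of_mem_nhds (Iio_mem_nhds hrm), self_mem_nhdsWithin]
      with x h1 h2 using heq x ⟨h2.1, h1⟩
  · exact (hW SB hSBb).2.2.init
  · exact (hW r hr.2).2.2.below r ⟨hr.1, (hW r hr.2).1⟩
  · obtain ⟨m, hrm, hmb, hm, heq⟩ := near r (Ioo_subset_Ico_self hr)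
    have h1 := hm.ode r ⟨hr.1, hrm⟩
    rw [← heq r ⟨hr.1.le, hrm⟩] at h1
    refine h1.congr_of_eventuallyEq ?_
    filter_upwards [Ioo_mem_nhds hr.1 hrm] with x hx using heq x (Ioo_subset_Ico_self hx)

/-- A curve with a limit below the infiltration curve can be continued. -/
theorem IsInfiltrationCurve.exists_extension (hA : D.ScenarioA So) (hSB : 0 < SB)
    (hSBb : SB < b) (hb1 : b < 1) (hw : D.IsInfiltrationCurve SB τ α b w) {l : ℝ}
    (hl : Tendsto w (𝓝[<] b) (𝓝 l)) (hlb : l < D.pci b) :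
    ∃ s ∈ Ioo b 1, ∃ v, D.IsInfiltrationCurve SB τ α s v := by
  set κ := D.speed SB α * τ with hκdef
  have hbm : b ∈ Ioo (0 : ℝ) 1 := ⟨hSB.trans hSBb, hb1⟩
  -- The level `m` and the endpoint `e` are chosen with `m < pci e`; since `pci` decreases, `pci -
  -- w` stays positive on the whole box `[r, e] × [l - 1, m]`.
  obtain ⟨m, hlm, hmb⟩ := exists_between hlb
  obtain ⟨e, he, hem⟩ : ∃ e ∈ Ioo b 1, m < D.pci e := by
    have h1 : ∀ᶠ x in 𝓝[>] b, m < D.pci x :=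
      ((hA.hasDerivAt_pci hbm).continuousAt.eventually (lt_mem_nhds hmb)).filter_mono
        nhdsWithin_le_nhds
    obtain ⟨x, hx1, hx2⟩ := (h1.and (Ioo_mem_nhdsGT hb1)).exists
    exact ⟨x, hx2, hx1⟩
  obtain ⟨r, hr, hrw⟩ : ∃ r ∈ Ioo SB b, ∀ x ∈ Ico r b, w x ∈ Ioo (l - 1) m := by
    have h1 : ∀ᶠ x in 𝓝[<] b, w x ∈ Ioo (l - 1) m := hl (Ioo_mem_nhds (by linarith) hlm)
    obtain ⟨c, hc, hc'⟩ := (mem_nhdsLT_iff_exists_Ioo_subset' hSBb).1 h1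
    have hcb : max c SB < b := max_lt hc hSBb
    refine ⟨(max c SB + b) / 2, ⟨by linarith [le_max_right c SB], by linarith⟩,
      fun x hx => hc' ⟨?_, hx.2⟩⟩
    linarith [le_max_left c SB, hx.1]
  have hpc : ∀ x ∈ Icc r e, m < D.pci x := fun x hx =>
    hem.trans_le (hA.strictAntiOn_pci.antitoneOn
      ⟨(hSB.trans hr.1).trans_le hx.1, hx.2.trans_lt he.2⟩
      ⟨hbm.1.trans he.1, he.2⟩ hx.2)
  have hre : Icc r e ⊆ Ioo (0 : ℝ) 1 := Icc_subset_Ioo_zero_one (hSB.trans hr.1) he.2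
  -- With the saturation as a second unknown moving at unit speed, the scalar non-autonomous
  -- equation becomes an autonomous field in the plane.
  let W : ℝ × ℝ → ℝ × ℝ := fun x => (1, κ * D.G SB α x.1 / (D.pci x.1 - x.2))
  obtain ⟨K, hK⟩ : ∃ K, LipschitzOnWith K W (Icc r e ×ˢ Icc (l - 1) m) := by
    have hW : ContDiffOn ℝ 1 W (Icc r e ×ˢ Icc (l - 1) m) := by
      refine contDiffOn_const.prodMk (ContDiffOn.div (contDiffOn_const.mul ?_) (ContDiffOn.sub ?_
        contDiff_snd.contDiffOn) ?_)
      · exact ((hA.contDiffOn_G SB α).mono hre).comp contDiff_fst.contDiffOn fun x hx => hx.1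
      · exact (hA.pci_smooth.mono (hre.trans Ioo_subset_Ioc_self)).comp contDiff_fst.contDiffOn
          fun x hx => hx.1
      · intro x hx
        have := hpc x.1 hx.1
        have := hx.2.2
        exact (by linarith : 0 < D.pci x.1 - x.2).ne'
    exact hW.exists_lipschitzOnWith one_ne_zero ((convex_Icc _ _).prod (convex_Icc _ _))
      (isCompact_Icc.prod isCompact_Icc)
  obtain ⟨V, hV, ⟨C, hC⟩, hVW, hV1⟩ :=
    exists_lipschitz_extension_of_box (by linarith [hr.2, he.1]) (by linarith) hK
  obtain ⟨X, hX0, hX⟩ := exists_global_solution hV hC (r, w r)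
  have hfst' : ∀ t, HasDerivAt (fun t => (X t).1) (V (X t)).1 t := fun t =>
    (ContinuousLinearMap.fst ℝ ℝ ℝ).hasFDerivAt.comp_hasDerivAt t (hX t)
  have hsnd' : ∀ t, HasDerivAt (fun t => (X t).2) (V (X t)).2 t := fun t =>
    (ContinuousLinearMap.snd ℝ ℝ ℝ).hasFDerivAt.comp_hasDerivAt t (hX t)
  -- Every value of the extended field is a value of `W`, so the first component has unit speed even
  -- outside the box.
  have hfst : ∀ t, (X t).1 = r + t := by
    intro t
    have h1 : ∀ t, HasDerivAt (fun t => (X t).1 - t) 0 t := fun t => by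
      obtain ⟨y, -, hy⟩ := hV1 (X t)
      have := (hfst' t).sub (hasDerivAt_id t)
      rw [hy] at this
      exact this.congr_deriv (sub_self 1)
    have := is_const_of_deriv_eq_zero (fun t => (h1 t).differentiableAt) (fun t => (h1 t).deriv) t 0
    simp only [hX0] at this
    linarith
  have hXw : ∀ x ∈ Ico r b, (X (x - r)).2 = w x := by
    intro x hx
    have hmem : ∀ t ∈ Icc 0 (x - r), r + t ∈ Ico r b := fun t ht =>
      ⟨by linarith [ht.1], by linarith [ht.2, hx.2]⟩
    have hder : ∀ t ∈ Icc 0 (x - r), HasDerivAt (fun t => (r + t, w (r + t)))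
        (V (r + t, w (r + t))) t := by
      intro t ht
      have h1 := hmem t ht
      rw [hVW _ ⟨⟨h1.1, (h1.2.trans he.1).le⟩, Ioo_subset_Icc_self (hrw _ h1)⟩]
      have h2 : HasDerivAt (fun t => r + t) 1 t := by simpa using (hasDerivAt_id t).const_add r
      refine h2.prodMk ?_
      simpa using (hw.ode (r + t) ⟨hr.1.trans_le h1.1, h1.2⟩).comp_const_add r t
    have := ODE_solution_unique_of_mem_Icc_right (v := fun _ => V) (s := fun _ => univ) (K := K)
      (f := X) (g := fun t => (r + t, w (r + t))) (a := 0) (b := x - r)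
      (fun _ _ => hV.lipschitzOnWith) (fun t _ => (hX t).continuousAt.continuousWithinAt)
      (fun t _ => (hX t).hasDerivWithinAt) (fun _ _ => trivial)
      (fun t ht => (hder t ht).continuousAt.continuousWithinAt)
      (fun t ht => (hder t (Ico_subset_Icc_self ht)).hasDerivWithinAt) (fun _ _ => trivial)
      (by simp [hX0]) ⟨sub_nonneg.2 hx.1, le_rfl⟩
    rw [this]; simp
  have hc2 : Continuous fun x => (X (x - r)).2 :=
    (continuous_iff_continuousAt.2 fun t => (hsnd' t).continuousAt).comp (continuous_sub_right r)
  have hXb : (X (b - r)).2 = l := by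
    refine tendsto_nhds_unique (hc2.continuousAt.tendsto.mono_left nhdsWithin_le_nhds)
      (hl.congr' ?_)
    filter_upwards [Ioo_mem_nhdsLT hr.2] with x hx using (hXw x (Ioo_subset_Ico_self hx)).symm
  obtain ⟨η, hη, hbox⟩ : ∃ η > b, ∀ x ∈ Ico b η, (X (x - r)).2 ∈ Ioo (l - 1) m := by
    have h1 : ∀ᶠ x in 𝓝 b, (X (x - r)).2 ∈ Ioo (l - 1) m :=
      hc2.continuousAt.eventually (Ioo_mem_nhds (by simp only [hXb]; linarith)
        (by simpa only [hXb] using hlm))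
    exact exists_Ico_subset_of_mem_nhds h1 ⟨b + 1, by linarith⟩
  have hbox' : ∀ x ∈ Ico r η, (X (x - r)).2 ∈ Ioo (l - 1) m := by
    intro x hx
    rcases lt_or_ge x b with h | h
    · rw [hXw x ⟨hx.1, h⟩]; exact hrw x ⟨hx.1, h⟩
    · exact hbox x ⟨h, hx.2⟩
  let v : ℝ → ℝ := fun x => if x < b then w x else (X (x - r)).2
  have hv1 : ∀ x, x < b → v x = w x := fun x h => if_pos h
  have hv2 : ∀ x, r ≤ x → v x = (X (x - r)).2 := fun x h => by
    by_cases h' : x < b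
    · rw [hv1 x h', hXw x ⟨h, h'⟩]
    · exact if_neg h'
  have hderiv : ∀ x, r < x → x < min η e → HasDerivAt v (κ * D.G SB α x / (D.pci x - v x)) x := by
    intro x h1 h2
    have h3 := hsnd' (x - r)
    have e1 : X (x - r) = (x, (X (x - r)).2) := by
      refine Prod.ext ?_ rfl
      rw [hfst]; ring
    have h4 : X (x - r) ∈ Icc r e ×ˢ Icc (l - 1) m := by
      rw [e1]
      exact ⟨⟨h1.le, (h2.trans_le (min_le_right _ _)).le⟩,
        Ioo_subset_Icc_self (hbox' x ⟨h1.le, h2.trans_le (min_le_left _ _)⟩)⟩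
    rw [hVW _ h4] at h3
    have h5 : HasDerivAt (fun x => (X (x - r)).2) _ x := h3.comp_sub_const x r
    refine (h5.congr_of_eventuallyEq ?_).congr_deriv ?_
    · filter_upwards [Ioi_mem_nhds h1] with y hy using hv2 y (le_of_lt hy)
    · rw [hv2 x h1.le, e1]
  have hmin : b < min η e := lt_min hη he.1
  refine ⟨min η e, ⟨hmin, (min_le_right _ _).trans_lt he.2⟩, v, ?_, ?_, ?_, ?_⟩
  · intro x hx
    rcases lt_or_ge x b with h | h
    · have h1 : ContinuousWithinAt w (Ico SB (min η e)) x := by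
        refine (hw.cont x ⟨hx.1, h⟩).mono_of_mem_nhdsWithin ?_
        filter_upwards [mem_nhdsWithin_of_mem_nhds (Iio_mem_nhds h), self_mem_nhdsWithin]
          with y h1 h2 using ⟨h2.1, h1⟩
      refine h1.congr_of_eventuallyEq ?_ (hv1 x h)
      filter_upwards [mem_nhdsWithin_of_mem_nhds (Iio_mem_nhds h)] with y hy using hv1 y hy
    · exact (hderiv x (hr.2.trans_le h) hx.2).continuousAt.continuousWithinAt
  · rw [hv1 SB hSBb, hw.init]
  · intro x hx
    rcases lt_or_ge x b with h | h
    · rw [hv1 x h]; exact hw.below x ⟨hx.1, h⟩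
    · rw [hv2 x (hr.2.le.trans h)]
      exact (hbox x ⟨h, hx.2.trans_le (min_le_left _ _)⟩).2.trans
        (hpc x ⟨hr.2.le.trans h, (hx.2.trans_le (min_le_right _ _)).le⟩)
  · intro x hx
    rcases lt_or_ge x b with h | h
    · have h1 := hw.ode x ⟨hx.1, h⟩
      rw [← hv1 x h] at h1
      refine h1.congr_of_eventuallyEq ?_
      filter_upwards [Iio_mem_nhds h] with y hy using hv1 y hy
    · exact hderiv x (hr.2.trans_le h) hx.2

/-- If `S_m` is a third intersection point, the infiltration curve ends there on the graph of
`pci`. -/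
theorem ScenarioA.exists_curve_tendsto (hA : D.ScenarioA So) (hSB : 0 < SB) (hα : SB < α)
    (hαb : α < b) (hκ : 0 < D.speed SB α * τ) (hGneg : ∀ S ∈ Ioo SB α, D.G SB α S < 0)
    (hGpos : ∀ S ∈ Ioo α b, 0 < D.G SB α S) (hb : D.sM SB τ α = b) (hb1 : b < 1) :
    ∃ w, D.IsInfiltrationCurve SB τ α b w ∧ Tendsto w (𝓝[<] b) (𝓝 (D.pci b)) := by
  obtain ⟨w, hw⟩ := hA.exists_curve_sM hSB hα hκ hGneg hb (hα.trans hαb)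
  have hmem : ∀ x ∈ Ioo α b, x ∈ Ioo SB b := fun x hx => ⟨hα.trans hx.1, hx.2⟩
  -- Beyond `α` the sign of `𝒢` makes `w` increase below the decreasing `pci`, so `w` has a limit at
  -- `b`.
  have hmono : MonotoneOn w (Ioo α b) := by
    refine monotoneOn_of_deriv_nonneg (convex_Ioo α b)
      (hw.cont.mono fun x hx => Ioo_subset_Ico_self (hmem x hx))
      (fun x hx => ?_) fun x hx => ?_
    · rw [interior_Ioo] at hx
      exact (hw.ode x (hmem x hx)).differentiableAt.differentiableWithinAt
    · rw [interior_Ioo] at hx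
      rw [(hw.ode x (hmem x hx)).deriv]
      exact (div_pos (mul_pos hκ (hGpos x hx)) (sub_pos.2 (hw.below x (hmem x hx)))).le
  have hbdd : BddAbove (w '' Ioo α b) := by
    refine ⟨D.pci α, ?_⟩
    rintro _ ⟨x, hx, rfl⟩
    refine (hw.below x (hmem x hx)).le.trans (hA.strictAntiOn_pci.antitoneOn ?_ ?_ hx.1.le)
    · exact ⟨hSB.trans hα, hαb.trans hb1⟩
    · exact ⟨hSB.trans (hmem x hx).1, hx.2.trans hb1⟩
  have hlim := hmono.tendsto_nhdsWithin_Ioo_left (nonempty_Ioo.2 hαb) hbdd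
  set l := sSup (w '' Ioo α b)
  have hcont : Tendsto D.pci (𝓝[<] b) (𝓝 (D.pci b)) :=
    (hA.hasDerivAt_pci ⟨(hSB.trans hα).trans hαb, hb1⟩).continuousAt.tendsto.mono_left
      nhdsWithin_le_nhds
  have hle : l ≤ D.pci b := by
    refine le_of_tendsto_of_tendsto hlim hcont ?_
    filter_upwards [Ioo_mem_nhdsLT hαb] with x hx using (hw.below x (hmem x hx)).le
  refine ⟨w, hw, ?_⟩
  -- A limit strictly below `pci b` would allow continuation past `b = S_m`.
  rcases hle.eq_or_lt with h | h
  · rwa [h] at hlim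
  · obtain ⟨s, hs, v, hv⟩ := hw.exists_extension hA hSB (hα.trans hαb) hb1 hlim h
    exact absurd (le_of_curve hb ⟨(hα.trans hαb).trans hs.1, hs.2⟩ hv) (not_le.2 hs.1)

/-- If `𝒢` is not integrable near `1`, then the infiltration curve does not reach `1`. -/
theorem ScenarioA.sM_lt_one (hA : D.ScenarioA So) (hSB : 0 < SB) (hα : SB < α) (hα1 : α < 1)
    (hκ : 0 < D.speed SB α * τ) (hGpos : ∀ S ∈ Ioo α 1, 0 < D.G SB α S)
    (hG : ¬ IntegrableOn (D.G SB α) (Ioo α 1)) (hb : D.sM SB τ α = b) (hb1 : b ≤ 1) (hb0 : 0 < b) :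
    b < 1 := by
  by_contra! h
  obtain rfl : b = 1 := le_antisymm hb1 h
  have hαm : α ∈ Ioo (0 : ℝ) 1 := ⟨hSB.trans hα, hα1⟩
  have hint : ∀ r, r < 1 → α ≤ r → IntervalIntegrable (D.G SB α) volume α r := fun r h1 h2 =>
    ((hA.continuousOn_G SB α).mono
      (ordConnected_Ioo.uIcc_subset hαm ⟨hαm.1.trans_le h2, h1⟩)).intervalIntegrable
  have hint0 : IntervalIntegrable (D.G SB α) volume SB α :=
    ((hA.continuousOn_G SB α).mono (ordConnected_Ioo.uIcc_subset
      ⟨hSB, hα.trans hα1⟩ hαm)).intervalIntegrable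
  have hbound : ∀ r, r < 1 → α ≤ r →
      ∫ S in α..r, D.G SB α S ≤ - ∫ S in SB..α, D.G SB α S := by
    intro r h1 h2
    obtain ⟨s, hrs, hs, w, hw⟩ := exists_curve_of_lt_sM hb one_pos h1
    have := hw.integral_G_nonpos hA hSB hs.2.le hκ ⟨hα.trans_le h2, hrs⟩
    rw [← intervalIntegral.integral_add_adjacent_intervals hint0 (hint r h1 h2)] at this
    linarith
  refine hG (IntegrableOn.mono_set ?_ Ioo_subset_Ioc_self)
  -- An exhaustion of `(α, 1)`. As `𝒢` is positive there, `hbound` bounds the integrals of its norm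
  -- uniformly, which gives integrability.
  let β : ℕ → ℝ := fun n => 1 - (1 - α) / (n + 1)
  have hβ1 : ∀ n, β n < 1 := fun n => by
    have : 0 < (1 - α) / (n + 1 : ℝ) := div_pos (by linarith) (by positivity)
    simp only [β]; linarith
  have hβα : ∀ n, α ≤ β n := fun n => by
    have : (1 - α) / (n + 1 : ℝ) ≤ 1 - α := div_le_self (by linarith) (by simp)
    simp only [β]; linarith
  have hlim : Tendsto β atTop (𝓝 1) := by
    have : Tendsto (fun n : ℕ => (1 - α) * (1 / ((n : ℝ) + 1))) atTop (𝓝 ((1 - α) * 0)) :=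
      tendsto_one_div_add_atTop_nhds_zero_nat.const_mul _
    have := (tendsto_const_nhds (x := (1 : ℝ))).sub this
    simpa [β, div_eq_mul_inv] using this
  refine integrableOn_Ioc_of_intervalIntegral_norm_bounded_right (l := atTop) (b := β)
    (I := - ∫ S in SB..α, D.G SB α S)
    (fun n => (intervalIntegrable_iff_integrableOn_Ioc_of_le (hβα n)).1 (hint _ (hβ1 n) (hβα n)))
    hlim (Eventually.of_forall fun n => ?_)
  have e : ∫ x in Ioc α (β n), ‖D.G SB α x‖ = ∫ x in α..β n, D.G SB α x := by
    rw [intervalIntegral.integral_of_le (hβα n)]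
    refine setIntegral_congr_fun measurableSet_Ioc fun x hx => ?_
    exact Real.norm_of_nonneg (hGpos x ⟨hx.1, hx.2.trans_lt (hβ1 n)⟩).le
  rw [e]
  exact hbound _ (hβ1 n) (hβα n)

end Curves

end TwoPhaseModel

end

/-! ### Infiltration profiles from infiltration curves -/

noncomputable section

theorem HasDerivAt.fst_prod {X : ℝ → ℝ × ℝ} {v : ℝ × ℝ} {t : ℝ} (h : HasDerivAt X v t) :
    HasDerivAt (fun t => (X t).1) v.1 t :=
  (ContinuousLinearMap.fst ℝ ℝ ℝ).hasFDerivAt.comp_hasDerivAt t h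

theorem HasDerivAt.snd_prod {X : ℝ → ℝ × ℝ} {v : ℝ × ℝ} {t : ℝ} (h : HasDerivAt X v t) :
    HasDerivAt (fun t => (X t).2) v.2 t :=
  (ContinuousLinearMap.snd ℝ ℝ ℝ).hasFDerivAt.comp_hasDerivAt t h

namespace TwoPhaseModel

variable {D : TwoPhaseModel} {So : ℝ}

theorem relax_of_lt_pci {S p : ℝ} (h : p < D.pci S) (h' : D.pci S < D.pcd S) :
    D.relax S p = D.pci S - p := by
  rw [relax, if_neg (by linarith), if_pos h]

theorem relax_eq_zero {S p : ℝ} (h : D.pci S ≤ p) (h' : p ≤ D.pcd S) : D.relax S p = 0 := by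
  rw [relax, if_neg (not_lt.2 h'), if_neg (not_lt.2 h)]

/-- A curve in the region `p < pci S` joining two equilibria on the graph of `pci` is the orbit of a
viscous profile. -/
theorem ScenarioA.exists_profile_of_curve (hA : D.ScenarioA So) {a b τ : ℝ} {w : ℝ → ℝ}
    (ha : 0 < a) (hab : a < b) (hb : b < 1) (hκ : 0 < D.speed a b * τ) (hw : Continuous w)
    (hwa : w a = D.pci a) (hwb : w b = D.pci b) (hbelow : ∀ r ∈ Ioo a b, w r < D.pci r)
    (hode : ∀ r ∈ Ioo a b,
      HasDerivAt w (D.speed a b * τ * D.G a b r / (D.pci r - w r)) r) :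
    ∃ S p, D.IsViscousProfile τ a b S p := by
  set κ := D.speed a b * τ with hκdef
  have hsub := Icc_subset_Ioo_zero_one ha hb
  obtain ⟨c, hc⟩ := isCompact_Icc.exists_bound_of_continuousOn (hw.continuousOn (s := Icc a b))
  have hc0 : 0 ≤ c := (norm_nonneg _).trans (hc a ⟨le_rfl, hab.le⟩)
  have hwc : ∀ x ∈ Icc a b, w x ∈ Ioo (-(c + 1)) (c + 1) := fun x hx => by
    have := abs_le.1 (hc x hx)
    exact ⟨by linarith, by linarith⟩
  obtain ⟨V, K, hV, ⟨C, hC⟩, hVW⟩ := hA.exists_field_extension (p₁ := -(c + 1)) (p₂ := c + 1) ha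
    hab.le hb (by linarith) κ a b
  obtain ⟨r, hr⟩ := exists_between hab
  obtain ⟨X, hX0, hX⟩ := exists_global_solution hV hC (r, w r)
  have hXc : Continuous X := continuous_iff_continuousAt.2 fun t => (hX t).continuousAt
  -- The endpoints of the curve are equilibria, so the orbit through the interior point at `r` never
  -- meets them.
  have heq : ∀ e, e ∈ Icc a b → w e = D.pci e → D.G a b e = 0 → e ≠ r →
      ∀ t, (X t).1 = e → (X t).2 = w (X t).1 → False := by
    intro e he hwe hGe her t h1 h2
    have hXe : X t = (e, D.pci e) := Prod.ext h1 (by rw [h2, h1, hwe])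
    have hVe : V (e, D.pci e) = 0 := by
      have hbox := hwc e he
      rw [hwe] at hbox
      rw [hVW _ ⟨he, Ioo_subset_Icc_self hbox⟩]
      simp only [hGe, relax_eq_zero le_rfl (hA.pci_lt_pcd e (hsub he)).le, zero_div]
      rfl
    have := solution_eq_equilibrium hV hX hVe hXe 0
    rw [hX0] at this
    exact her (congrArg Prod.fst this).symm
  have hGa : D.G a b a = 0 := G_eq_zero (chord_left a b).symm
  have hGb : D.G a b b = 0 := G_eq_zero (chord_right a b).symm
  -- The times at which the orbit is on the curve form a clopen set: closed because the endpoints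
  -- are never met, open because `p - w(S)` satisfies a homogeneous linear equation.
  let T : Set ℝ := {t | (X t).1 ∈ Ioo a b ∧ (X t).2 = w (X t).1}
  have hTclosed : IsClosed T := by
    have e : T = {t | (X t).1 ∈ Icc a b} ∩ {t | (X t).2 = w (X t).1} := by
      ext t
      constructor
      · exact fun h => ⟨Ioo_subset_Icc_self h.1, h.2⟩
      · rintro ⟨h1, h2⟩
        refine ⟨⟨lt_of_le_of_ne h1.1 fun h => ?_, lt_of_le_of_ne h1.2 fun h => ?_⟩, h2⟩
        · exact heq a ⟨le_rfl, hab.le⟩ hwa hGa hr.1.ne t h.symm h2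
        · exact heq b ⟨hab.le, le_rfl⟩ hwb hGb hr.2.ne' t h h2
    rw [e]
    exact (isClosed_Icc.preimage hXc.fst).inter
      (isClosed_eq hXc.snd (hw.comp hXc.fst))
  have hTopen : IsOpen T := by
    rw [isOpen_iff_mem_nhds]
    rintro t ⟨h1, h2⟩
    have n1 : ∀ᶠ s in 𝓝 t, (X s).1 ∈ Ioo a b :=
      hXc.fst.continuousAt.eventually (isOpen_Ioo.mem_nhds h1)
    have n2 : ∀ᶠ s in 𝓝 t, (X s).2 ∈ Ioo (-(c + 1)) (c + 1) :=
      hXc.snd.continuousAt.eventually (isOpen_Ioo.mem_nhds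
        (by simpa only [h2] using hwc _ (Ioo_subset_Icc_self h1)))
    have hpc : ContinuousAt (fun s => D.pci (X s).1) t :=
      ContinuousAt.comp (f := fun s => (X s).1)
        (hA.hasDerivAt_pci (hsub (Ioo_subset_Icc_self h1))).continuousAt hXc.fst.continuousAt
    have n3 : ∀ᶠ s in 𝓝 t, (X s).2 < D.pci (X s).1 :=
      hXc.snd.continuousAt.eventually_lt hpc (by rw [h2]; exact hbelow _ h1)
    have key := eventually_eq_zero_of_linear_ode (d := fun s => (X s).2 - w (X s).1)
      (q := fun s => D.G a b (X s).1 / (D.pci (X s).1 - w (X s).1)) (t₀ := t) ?_ ?_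
      (sub_eq_zero.2 h2)
    · filter_upwards [n1, key] with s hs1 hs2 using ⟨hs1, sub_eq_zero.1 hs2⟩
    · filter_upwards [n1, n2, n3] with s hs1 hs2 hs3
      have hVX := hVW (X s) ⟨Ioo_subset_Icc_self hs1, Ioo_subset_Icc_self hs2⟩
      rw [relax_of_lt_pci hs3 (hA.pci_lt_pcd _ (hsub (Ioo_subset_Icc_self hs1)))] at hVX
      have d1 := (hX s).fst_prod
      have d2 := (hX s).snd_prod
      rw [hVX] at d1 d2
      have d3 := d2.sub ((hode _ hs1).comp s d1)
      refine d3.congr_deriv ?_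
      have hu : D.pci (X s).1 - w (X s).1 ≠ 0 := (sub_pos.2 (hbelow _ hs1)).ne'
      have hκ' := hκ.ne'
      field_simp
      ring
    · exact (ContinuousAt.comp (f := fun s => (X s).1)
        (hA.continuousAt_G a b (hsub (Ioo_subset_Icc_self h1))) hXc.fst.continuousAt).div
        (hpc.sub (hw.comp hXc.fst).continuousAt) (sub_pos.2 (hbelow _ h1)).ne'
  have hT : ∀ t, (X t).1 ∈ Ioo a b ∧ (X t).2 = w (X t).1 := by
    have : T = univ := IsClopen.eq_univ ⟨hTclosed, hTopen⟩
      ⟨0, by change (X 0).1 ∈ Ioo a b ∧ (X 0).2 = w (X 0).1; rw [hX0]; exact ⟨hr, rfl⟩⟩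
    exact fun t => (this ▸ mem_univ t : t ∈ T)
  have hVX : ∀ t, V (X t) = (D.relax (X t).1 (X t).2 / κ, D.G a b (X t).1) := fun t =>
    hVW _ ⟨Ioo_subset_Icc_self (hT t).1, by
      rw [(hT t).2]; exact Ioo_subset_Icc_self (hwc _ (Ioo_subset_Icc_self (hT t).1))⟩
  have dS : ∀ t, HasDerivAt (fun t => (X t).1) (D.relax (X t).1 (X t).2 / κ) t := fun t => by
    have := (hX t).fst_prod
    rwa [hVX] at this
  have dp : ∀ t, HasDerivAt (fun t => (X t).2) (D.G a b (X t).1) t := fun t => by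
    have := (hX t).snd_prod
    rwa [hVX] at this
  have hrel : ∀ t, D.relax (X t).1 (X t).2 / κ = (D.pci (X t).1 - w (X t).1) / κ := fun t => by
    have h1 := (hT t).1
    rw [(hT t).2, relax_of_lt_pci (hbelow _ h1) (hA.pci_lt_pcd _ (hsub (Ioo_subset_Icc_self h1)))]
  have hmono : Monotone fun t => (X t).1 := by
    refine monotone_of_deriv_nonneg (fun t => (dS t).differentiableAt) fun t => ?_
    rw [(dS t).deriv, hrel]
    exact (div_pos (sub_pos.2 (hbelow _ (hT t).1)) hκ).le
  have hlimder : ∀ (F : Filter ℝ) (l : ℝ), l ∈ Icc a b →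
      Tendsto (fun t => (X t).1) F (𝓝 l) →
      Tendsto (fun t => D.relax (X t).1 (X t).2 / κ) F (𝓝 ((D.pci l - w l) / κ)) := by
    intro F l hl hlim
    simp_rw [hrel]
    exact (((hA.hasDerivAt_pci (hsub hl)).continuousAt.tendsto.comp hlim).sub
      (hw.continuousAt.tendsto.comp hlim)).div_const κ
  -- The monotone `S` converges and so does `S'`, necessarily to zero; `pci - w` vanishes only at
  -- the two ends.
  have hend : ∀ l ∈ Icc a b, (D.pci l - w l) / κ = 0 → l = a ∨ l = b := by
    intro l hl h
    by_contra! hne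
    have := div_pos (sub_pos.2 (hbelow l ⟨lt_of_le_of_ne hl.1 hne.1.symm,
      lt_of_le_of_ne hl.2 hne.2⟩)) hκ
    exact this.ne' h
  have htop : Tendsto (fun t => (X t).1) atTop (𝓝 b) := by
    have hlim := tendsto_atTop_ciSup hmono ⟨b, by rintro _ ⟨t, rfl⟩; exact (hT t).1.2.le⟩
    set l := ⨆ t, (X t).1
    have hl : l ∈ Icc a b := isClosed_Icc.mem_of_tendsto hlim
      (Eventually.of_forall fun t => Ioo_subset_Icc_self (hT t).1)
    have h0 := eq_zero_of_tendsto_of_tendsto_deriv (Eventually.of_forall dS) hlim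
      (hlimder _ l hl hlim)
    rcases hend l hl h0 with h | h
    · exfalso
      have h1 : (X 0).1 ≤ l := ge_of_tendsto hlim
        ((eventually_ge_atTop 0).mono fun t ht => hmono ht)
      rw [h] at h1
      exact absurd (hT 0).1.1 (not_lt.2 h1)
    · rwa [h] at hlim
  have hbot : Tendsto (fun t => (X t).1) atBot (𝓝 a) := by
    have hlim := tendsto_atBot_ciInf hmono ⟨a, by rintro _ ⟨t, rfl⟩; exact (hT t).1.1.le⟩
    set l := ⨅ t, (X t).1
    have hl : l ∈ Icc a b := isClosed_Icc.mem_of_tendsto hlim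
      (Eventually.of_forall fun t => Ioo_subset_Icc_self (hT t).1)
    have h0 := eq_zero_of_tendsto_of_tendsto_deriv_atBot (Eventually.of_forall dS) hlim
      (hlimder _ l hl hlim)
    rcases hend l hl h0 with h | h
    · rwa [h] at hlim
    · exfalso
      have h1 : l ≤ (X 0).1 := le_of_tendsto hlim
        ((eventually_le_atBot 0).mono fun t ht => hmono ht)
      rw [h] at h1
      exact absurd (hT 0).1.2 (not_lt.2 h1)
  have hdp : deriv (fun t => (X t).2) = fun t => D.G a b (X t).1 := funext fun t => (dp t).deriv
  refine ⟨fun t => (X t).1, fun t => (X t).2,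
    { mem := fun t => hsub (Ioo_subset_Icc_self (hT t).1)
      ode_S := dS
      ode_p := dp
      S_bot := hbot
      S_top := htop
      p_bot := ?_
      p_top := ?_ }⟩
  · rw [hdp, ← hGa]
    exact (hA.continuousAt_G a b (hsub ⟨le_rfl, hab.le⟩)).tendsto.comp hbot
  · rw [hdp, ← hGb]
    exact (hA.continuousAt_G a b (hsub ⟨hab.le, le_rfl⟩)).tendsto.comp htop

/-- The infiltration wave between `SB` and `S_m(τ, α)`, if the latter is the third intersection
point of the chord through `SB` and `α`. -/
theorem ScenarioA.exists_infiltration_profile (hA : D.ScenarioA So) {SB α b τ : ℝ} (hSB : 0 < SB)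
    (hα : SB < α) (hαb : α < b) (hκ : 0 < D.speed SB α * τ)
    (hGneg : ∀ S ∈ Ioo SB α, D.G SB α S < 0) (hGpos : ∀ S ∈ Ioo α b, 0 < D.G SB α S)
    (hb : D.sM SB τ α = b) (hb1 : b < 1) (hF : D.F b = D.chord SB α b) :
    ∃ S p, D.IsViscousProfile τ SB b S p := by
  obtain ⟨w, hw, hlim⟩ := hA.exists_curve_tendsto hSB hα hαb hκ hGneg hGpos hb hb1
  have hSBb := hα.trans hαb
  have hc : D.speed SB b = D.speed SB α := speed_eq_of_chord_eq hSBb.ne hF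
  -- The curve is controlled only on `[SB, b)`. Inserting its limit at `b` and extending constantly
  -- outside the interval gives a globally continuous function.
  let v : ℝ → ℝ := Function.update w b (D.pci b)
  have hv : ∀ x, x ≠ b → v x = w x := fun x hx => Function.update_of_ne hx _ _
  have hvb : v b = D.pci b := Function.update_self _ _ _
  have hvc : ContinuousOn v (Icc SB b) := by
    have e : Icc SB b \ {b} = Ico SB b := by
      ext x
      exact ⟨fun h => ⟨h.1.1, lt_of_le_of_ne h.1.2 h.2⟩, fun h => ⟨Ico_subset_Icc_self h, h.2.ne⟩⟩
    rw [continuousOn_update_iff, e]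
    exact ⟨hw.cont, fun _ => hlim.mono_left (nhdsWithin_mono _ fun x hx => hx.2)⟩
  have hext : ∀ x ∈ Icc SB b, IccExtend hSBb.le ((Icc SB b).domRestrict v) x = v x := fun x hx =>
    IccExtend_of_mem _ _ hx
  have hext' : ∀ x ∈ Ioo SB b, IccExtend hSBb.le ((Icc SB b).domRestrict v) x = w x := fun x hx => by
    rw [hext x (Ioo_subset_Icc_self hx), hv x hx.2.ne]
  refine hA.exists_profile_of_curve (w := IccExtend hSBb.le ((Icc SB b).domRestrict v)) hSB hSBb hb1
    (by rwa [hc]) ?_ ?_ ?_ ?_ ?_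
  · exact (continuousOn_iff_continuous_domRestrict.1 hvc).Icc_extend'
  · rw [hext SB ⟨le_rfl, hSBb.le⟩, hv SB hSBb.ne, hw.init]
  · rw [hext b ⟨hSBb.le, le_rfl⟩, hvb]
  · intro r hr
    rw [hext' r hr]
    exact hw.below r hr
  · intro r hr
    rw [hext' r hr, hc, G_congr hc]
    refine (hw.ode r hr).congr_of_eventuallyEq ?_
    filter_upwards [Ioo_mem_nhds hr.1 hr.2] with x hx using hext' x hx

end TwoPhaseModel

end

noncomputable section

/-! ### Shooting, Barbalat's lemma -/

theorem eventually_pos_left_of_hasDerivAt_neg {f : ℝ → ℝ} {f' t : ℝ} (h : HasDerivAt f f' t)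
    (h0 : f t = 0) (hf' : f' < 0) : ∀ᶠ s in 𝓝[<] t, 0 < f s := by
  have h1 := (hasDerivWithinAt_iff_tendsto_slope' (s := Iio t) (lt_irrefl t)).1 h.hasDerivWithinAt
  filter_upwards [h1.eventually (gt_mem_nhds hf'), self_mem_nhdsWithin] with s hs hst
  rw [slope_def_field, h0, sub_zero] at hs
  by_contra! hneg
  exact absurd (div_nonneg_of_nonpos hneg (sub_nonpos.2 (le_of_lt hst))) (not_le.2 hs)

/-- If `u` changes sign at `t`, then it does so before `v` has lost its sign. -/
theorem exists_crossing {u v : ℝ → ℝ} (hv : Continuous v) {t : ℝ} (ht : t ≤ 0)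
    (hu : ∀ᶠ s in 𝓝[<] t, 0 < u s) (hpos : ∀ s ∈ Icc t 0, 0 < v s) :
    ∃ s ≤ 0, 0 < u s ∧ ∀ r ∈ Icc s 0, 0 < v r := by
  have h1 : {s | 0 < v s} ∈ 𝓝 t := hv.continuousAt.eventually (lt_mem_nhds (hpos t ⟨le_rfl, ht⟩))
  obtain ⟨l, hl, hl'⟩ := exists_Ioc_subset_of_mem_nhds h1 ⟨t - 1, by linarith⟩
  obtain ⟨s, hs, hs'⟩ := (hu.and (Ioo_mem_nhdsLT hl)).exists
  refine ⟨s, hs'.2.le.trans ht, hs, fun r hr => ?_⟩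
  rcases le_or_gt r t with h | h
  · exact hl' ⟨hs'.1.trans_le hr.1, h⟩
  · exact hpos r ⟨h.le, hr.2⟩

/-- In a one-parameter family of curves, if one leaves the quadrant `u < 0 < v` backwards in time
through `v = 0` and another one through `u = 0`, then there is one that leaves through neither. -/
theorem exists_not_crossing {u v : ℝ → ℝ → ℝ} (hu : Continuous (Function.uncurry u))
    (hv : Continuous (Function.uncurry v)) {x₁ x₂ : ℝ} (hx : x₁ ≤ x₂)
    (h1 : ∃ t ≤ 0, v x₁ t < 0 ∧ ∀ s ∈ Icc t 0, u x₁ s < 0)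
    (h2 : ∃ t ≤ 0, 0 < u x₂ t ∧ ∀ s ∈ Icc t 0, 0 < v x₂ s) :
    ∃ x ∈ Icc x₁ x₂, (¬ ∃ t ≤ 0, v x t < 0 ∧ ∀ s ∈ Icc t 0, u x s < 0) ∧
      ¬ ∃ t ≤ 0, 0 < u x t ∧ ∀ s ∈ Icc t 0, 0 < v x s := by
  have op : ∀ f g : ℝ → ℝ → ℝ, Continuous (Function.uncurry f) → Continuous (Function.uncurry g) →
      IsOpen {x | ∃ t ≤ 0, 0 < f x t ∧ ∀ s ∈ Icc t 0, 0 < g x s} := by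
    intro f g hf hg
    rw [isOpen_iff_mem_nhds]
    rintro x ⟨t, ht, hft, hgt⟩
    have e1 : ∀ᶠ y in 𝓝 x, 0 < f y t :=
      (hf.comp (Continuous.prodMk_left t)).continuousAt.eventually (lt_mem_nhds hft)
    have e2 : ∀ᶠ y in 𝓝 x, ∀ s ∈ Icc t 0, 0 < g y s := by
      refine isCompact_Icc.eventually_forall_of_forall_eventually fun s hs => ?_
      exact hg.continuousAt.eventually (lt_mem_nhds (hgt s hs))
    filter_upwards [e1, e2] with y h1 h2 using ⟨t, ht, h1, h2⟩
  have hA := op (fun x t => - v x t) (fun x t => - u x t) hv.neg hu.neg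
  have hB := op u v hu hv
  simp only [neg_pos] at hA
  by_contra hcon
  obtain ⟨x, -, ⟨t, ht, hvt, hus⟩, ⟨t', ht', hut, hvs⟩⟩ := isPreconnected_Icc _ _ hA hB
    (fun x hx => by
      by_cases h : ∃ t ≤ 0, v x t < 0 ∧ ∀ s ∈ Icc t 0, u x s < 0
      · exact Or.inl h
      · exact Or.inr (by_contra fun h' => hcon ⟨x, hx, h, h'⟩))
    ⟨x₁, ⟨le_rfl, hx⟩, h1⟩ ⟨x₂, ⟨hx, le_rfl⟩, h2⟩
  -- The two exits exclude each other: the later of the two exit times lies in the interval on which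
  -- the other alternative prescribes the opposite sign.
  rcases le_total t t' with h | h
  · exact lt_asymm hut (hus t' ⟨h, ht'⟩)
  · exact lt_asymm hvt (hvs t ⟨h, ht⟩)

/-- A curve that does not leave the quadrant `u < 0 < v` by a crossing stays in it, if it can only
leave by a crossing; `c > 0` is a further condition that persists. -/
theorem forall_of_not_crossing {u v c : ℝ → ℝ} (hu : Continuous u) (hv : Continuous v)
    (hc : Continuous c) (u0 : u 0 < 0) (v0 : 0 < v 0) (c0 : 0 < c 0)
    (hc' : ∀ t ≤ 0, (∀ s ∈ Icc t 0, u s ≤ 0 ∧ 0 ≤ v s ∧ 0 ≤ c s) → 0 < c t)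
    (hu' : ∀ t ≤ 0, (∀ s ∈ Icc t 0, u s ≤ 0 ∧ 0 ≤ v s ∧ 0 ≤ c s) → u t = 0 → 0 < v t →
      ∀ᶠ s in 𝓝[<] t, 0 < u s)
    (hv' : ∀ t ≤ 0, (∀ s ∈ Icc t 0, u s ≤ 0 ∧ 0 ≤ v s ∧ 0 ≤ c s) → v t = 0 → u t < 0 →
      ∀ᶠ s in 𝓝[<] t, v s < 0)
    (huv : ∀ t ≤ 0, (∀ s ∈ Icc t 0, u s ≤ 0 ∧ 0 ≤ v s ∧ 0 ≤ c s) → ¬ (u t = 0 ∧ v t = 0))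
    (hA : ¬ ∃ t ≤ 0, v t < 0 ∧ ∀ s ∈ Icc t 0, u s < 0)
    (hB : ¬ ∃ t ≤ 0, 0 < u t ∧ ∀ s ∈ Icc t 0, 0 < v s) :
    ∀ t ≤ 0, u t < 0 ∧ 0 < v t ∧ 0 < c t := by
  by_contra! hcon
  let bad : Set ℝ := Iic 0 ∩ ({t | 0 ≤ u t} ∪ ({t | v t ≤ 0} ∪ {t | c t ≤ 0}))
  have hclosed : IsClosed bad := isClosed_Iic.inter ((isClosed_le continuous_const hu).union
    ((isClosed_le hv continuous_const).union (isClosed_le hc continuous_const)))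
  have hne : bad.Nonempty := by
    obtain ⟨t, ht, h⟩ := hcon
    refine ⟨t, ht, ?_⟩
    by_cases h1 : 0 ≤ u t
    · exact Or.inl h1
    · by_cases h2 : v t ≤ 0
      · exact Or.inr (Or.inl h2)
      · exact Or.inr (Or.inr (h (not_le.1 h1) (not_le.1 h2)))
  have hbdd : BddAbove bad := ⟨0, fun t ht => ht.1⟩
  obtain ⟨ht0, hbad⟩ := hclosed.csSup_mem hne hbdd
  -- Backwards in time, `t` is the first violation. The strict inequalities hold on `(t, 0]` and
  -- pass to weak ones at `t`, so `hc'` excludes a failure of `c`, and `huv` excludes the corner.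
  set t := sSup bad
  have hgood : ∀ s, t < s → s ≤ 0 → u s < 0 ∧ 0 < v s ∧ 0 < c s := by
    intro s hs hs0
    have : s ∉ bad := fun h => absurd (le_csSup hbdd h) (not_le.2 hs)
    refine ⟨?_, ?_, ?_⟩ <;> by_contra! h
    · exact this ⟨hs0, Or.inl h⟩
    · exact this ⟨hs0, Or.inr (Or.inl h)⟩
    · exact this ⟨hs0, Or.inr (Or.inr h)⟩
  have htlt : t < 0 := by
    refine lt_of_le_of_ne ht0 fun h => ?_
    rw [h] at hbad
    rcases hbad with h | h | h
    · exact absurd u0 (not_lt.2 h)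
    · exact absurd v0 (not_lt.2 h)
    · exact absurd c0 (not_lt.2 h)
  have hev : ∀ᶠ s in 𝓝[>] t, u s < 0 ∧ 0 < v s ∧ 0 < c s := by
    filter_upwards [Ioo_mem_nhdsGT htlt] with s hs using hgood s hs.1 hs.2.le
  have ut : u t ≤ 0 := le_of_tendsto (hu.continuousAt.tendsto.mono_left nhdsWithin_le_nhds)
    (hev.mono fun s h => h.1.le)
  have vt : 0 ≤ v t := ge_of_tendsto (hv.continuousAt.tendsto.mono_left nhdsWithin_le_nhds)
    (hev.mono fun s h => h.2.1.le)
  have ct : 0 ≤ c t := ge_of_tendsto (hc.continuousAt.tendsto.mono_left nhdsWithin_le_nhds)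
    (hev.mono fun s h => h.2.2.le)
  have hall : ∀ s ∈ Icc t 0, u s ≤ 0 ∧ 0 ≤ v s ∧ 0 ≤ c s := by
    intro s hs
    rcases hs.1.eq_or_lt with h | h
    · rw [← h]; exact ⟨ut, vt, ct⟩
    · have := hgood s h hs.2
      exact ⟨this.1.le, this.2.1.le, this.2.2.le⟩
  have h2 := huv t ht0 hall
  rcases ut.eq_or_lt with h | h
  · have hvpos : 0 < v t := lt_of_le_of_ne vt fun h' => h2 ⟨h, h'.symm⟩
    refine hB (exists_crossing hv ht0 (hu' t ht0 hall h hvpos) fun s hs => ?_)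
    rcases hs.1.eq_or_lt with h' | h'
    · rwa [← h']
    · exact (hgood s h' hs.2).2.1
  · have hvt : v t = 0 := by
      refine le_antisymm ?_ vt
      rcases hbad with h' | h' | h'
      · exact absurd h (not_lt.2 h')
      · exact h'
      · exact absurd (hc' t ht0 hall) (not_lt.2 h')
    have := exists_crossing (u := fun s => - v s) (v := fun s => - u s) hu.neg ht0
      (by simpa using hv' t ht0 hall hvt h) fun s hs => by
        rcases hs.1.eq_or_lt with h' | h'
        · rw [← h']; linarith
        · linarith [(hgood s h' hs.2).1]
    simp only [neg_pos] at this
    exact hA this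

/-- Barbalat's lemma for a decreasing energy whose dissipation is bounded below by a square. -/
theorem tendsto_zero_of_dissipation {E E' R : ℝ → ℝ} {μ Λ l : ℝ} (hμ : 0 < μ) (hΛ : 0 ≤ Λ)
    (hE : ∀ t, HasDerivAt E (E' t) t) (hE' : ∀ t, E' t ≤ -(μ * R t ^ 2))
    (hR : ∀ s t, |R s - R t| ≤ Λ * |s - t|) (hl : Tendsto E atTop (𝓝 l)) :
    Tendsto R atTop (𝓝 0) := by
  rw [Metric.tendsto_atTop']
  intro ε hε
  -- If `|R t| ≥ ε`, then `|R| ≥ ε / 2` on `[t, t + δ]`, and the energy drops there by at least the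
  -- fixed amount `μ (ε / 2)² δ`.
  set δ := ε / (2 * (Λ + 1)) with hδdef
  have hδ : 0 < δ := by positivity
  have hΛδ : Λ * δ ≤ ε / 2 := by
    rw [hδdef, mul_div_assoc', div_le_div_iff₀ (by positivity) (by positivity)]
    nlinarith
  have hdiff : Tendsto (fun t => E t - E (t + δ)) atTop (𝓝 (l - l)) :=
    hl.sub (hl.comp (tendsto_atTop_add_const_right _ δ tendsto_id))
  rw [sub_self] at hdiff
  have hpos : 0 < μ * (ε / 2) ^ 2 * δ := by positivity
  obtain ⟨T, hT⟩ := eventually_atTop.1 (hdiff.eventually (gt_mem_nhds hpos))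
  refine ⟨T, fun t ht => ?_⟩
  rw [Real.dist_eq, sub_zero]
  by_contra! hge
  obtain ⟨s, hs, hs'⟩ := exists_hasDerivAt_eq_slope E E' (show t < t + δ by linarith)
    (fun r _ => (hE r).continuousAt.continuousWithinAt) (fun r _ => hE r)
  have h1 : ε / 2 ≤ |R s| := by
    have h2 := hR t s
    have h3 : |t - s| ≤ δ := abs_le.2 ⟨by linarith [hs.2], by linarith [hs.1]⟩
    have h4 := abs_sub_abs_le_abs_sub (R t) (R s)
    have h5 := mul_le_mul_of_nonneg_left h3 hΛ
    linarith
  have h2 : (ε / 2) ^ 2 ≤ R s ^ 2 := by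
    rw [← sq_abs (R s)]
    exact pow_le_pow_left₀ (by positivity) h1 2
  have h3 := hE' s
  rw [hs', add_sub_cancel_left, div_le_iff₀ hδ] at h3
  have h4 : μ * (ε / 2) ^ 2 * δ ≤ μ * R s ^ 2 * δ := by gcongr
  have h5 := hT t ht.le
  linarith

/-- A function whose derivative is eventually bounded away from zero is unbounded. -/
theorem not_bounded_of_deriv {p g : ℝ → ℝ} {η T C : ℝ} (hη : 0 < η)
    (hp : ∀ t, HasDerivAt p (g t) t) (hg : ∀ t ≥ T, η ≤ |g t|) : ¬ ∀ t, |p t| ≤ C := by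
  intro hC
  have hC0 : 0 ≤ C := (abs_nonneg _).trans (hC 0)
  -- Over this length the mean value theorem forces an increment of at least `2 C + 1`; a constant
  -- sign of `g` is not needed.
  set δ := (2 * C + 1) / η with hδ
  have hδ0 : 0 < δ := by positivity
  obtain ⟨s, hs, hs'⟩ := exists_hasDerivAt_eq_slope p g (show T < T + δ by linarith)
    (fun r _ => (hp r).continuousAt.continuousWithinAt) (fun r _ => hp r)
  have h1 := hg s hs.1.le
  rw [hs', add_sub_cancel_left, abs_div, abs_of_pos hδ0, le_div_iff₀ hδ0, hδ,
    mul_div_cancel₀ _ hη.ne'] at h1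
  have h2 := abs_sub (p (T + (2 * C + 1) / η)) (p T)
  linarith [hC (T + (2 * C + 1) / η), hC T]

/-- The flow of a Lipschitz vector field is jointly continuous. -/
theorem continuous_flow {E : Type*} [NormedAddCommGroup E] [NormedSpace ℝ E] {V : E → E}
    {K : NNReal} (hV : LipschitzWith K V) {Φ : E → ℝ → E} (h0 : ∀ x, Φ x 0 = x)
    (hΦ : ∀ x t, HasDerivAt (Φ x) (V (Φ x t)) t) : Continuous (Function.uncurry Φ) := by
  rw [continuous_iff_continuousAt]
  rintro ⟨x, t⟩
  rw [ContinuousAt, tendsto_iff_dist_tendsto_zero]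
  have h1 : Tendsto (fun z : E × ℝ => dist z.1 x * Real.exp (K * |z.2|) + dist (Φ x z.2) (Φ x t))
      (𝓝 (x, t)) (𝓝 (dist x x * Real.exp (K * |t|) + dist (Φ x t) (Φ x t))) := by
    have hc : ContinuousAt (fun z : E × ℝ => Φ x z.2) (x, t) :=
      ContinuousAt.comp (f := Prod.snd) (hΦ x t).continuousAt continuousAt_snd
    have h2 : ContinuousAt (fun z : E × ℝ => dist z.1 x * Real.exp (K * |z.2|)) (x, t) := by
      fun_prop
    exact h2.tendsto.add (hc.tendsto.dist tendsto_const_nhds)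
  rw [dist_self, dist_self, zero_mul, add_zero] at h1
  refine squeeze_zero (fun _ => dist_nonneg) (fun z => ?_) h1
  have h2 := dist_solutions_le hV (hΦ z.1) (hΦ x) z.2
  rw [h0, h0] at h2
  exact (dist_triangle _ (Φ x z.2) _).trans (add_le_add h2 le_rfl)

end

noncomputable section

namespace TwoPhaseModel

variable {D : TwoPhaseModel} {So : ℝ}

/-! ### The drainage wave -/

theorem ScenarioA.relax_of_pcd_le (hA : D.ScenarioA So) {S p : ℝ} (hS : S ∈ Ioo (0 : ℝ) 1)
    (h : D.pcd S ≤ p) : D.relax S p = D.pcd S - p := by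
  have := hA.pci_lt_pcd S hS
  rw [hA.relax_eq hS, max_eq_right (by linarith), max_eq_left (by linarith)]
  ring

/-- The potential of `𝒢(·; b, m)`, normalized at `m`. -/
def potential (D : TwoPhaseModel) (b m S : ℝ) : ℝ := ∫ x in m..S, D.G b m x

/-- The energy that decreases along the orbits of the travelling wave system. -/
def energy (D : TwoPhaseModel) (κ b m : ℝ) (x : ℝ × ℝ) : ℝ :=
  κ * D.potential b m x.1 +
    (max (x.2 - D.pcd x.1) 0 ^ 2 + max (D.pci x.1 - x.2) 0 ^ 2) / 2

/-- The hypotheses under which the drainage wave from `b` to `m` is constructed; `a` is a lower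
bound for the saturations along the wave. -/
structure DrainageData (D : TwoPhaseModel) (So a m b τ : ℝ) : Prop where
  scenario : D.ScenarioA So
  a_pos : 0 < a
  a_lt_m : a < m
  m_lt_b : m < b
  b_lt_one : b < 1
  speed_mul_pos : 0 < D.speed b m * τ
  G_neg : ∀ S ∈ Ico a m, D.G b m S < 0
  G_pos : ∀ S ∈ Ioo m b, 0 < D.G b m S
  potential_lt : D.potential b m b < D.potential b m a

/-- The contributions of `𝒢` through `Γ(S)` and through `p'` cancel. The mixed terms vanish because
the two positive parts are never nonzero together, leaving the negative slopes of the capillary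
pressures as dissipation. -/
theorem ScenarioA.hasDerivAt_energy (hA : D.ScenarioA So) {κ b m t : ℝ} (hκ : κ ≠ 0)
    (hm : m ∈ Ioo (0 : ℝ) 1) {S p : ℝ → ℝ} (hS : S t ∈ Ioo (0 : ℝ) 1)
    (dS : HasDerivAt S (D.relax (S t) (p t) / κ) t) (dp : HasDerivAt p (D.G b m (S t)) t) :
    HasDerivAt (fun s => D.energy κ b m (S s, p s))
      ((max (p t - D.pcd (S t)) 0 ^ 2 * deriv D.pcd (S t) +
        max (D.pci (S t) - p t) 0 ^ 2 * deriv D.pci (S t)) / κ) t := by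
  have h1 := ((hA.hasDerivAt_integral_G b m hm hS).comp t dS).const_mul κ
  have h2 := (hasDerivAt_max_zero_sq (p t - D.pcd (S t))).comp t
    (dp.sub ((hA.hasDerivAt_pcd hS).comp t dS))
  have h3 := (hasDerivAt_max_zero_sq (D.pci (S t) - p t)).comp t
    (((hA.hasDerivAt_pci hS).comp t dS).sub dp)
  refine (h1.add ((h2.add h3).div_const 2)).congr_deriv ?_
  have hprod : max (D.pci (S t) - p t) 0 * max (p t - D.pcd (S t)) 0 = 0 := by
    have := hA.pci_lt_pcd (S t) hS
    rcases le_total (p t) (D.pcd (S t)) with h | h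
    · rw [max_eq_right (sub_nonpos.2 h), mul_zero]
    · rw [max_eq_right (a := D.pci (S t) - p t) (by linarith), zero_mul]
  rw [hA.relax_eq hS]
  generalize max (D.pci (S t) - p t) 0 = B at *
  generalize max (p t - D.pcd (S t)) 0 = A at *
  field_simp
  linear_combination (deriv D.pcd (S t) + deriv D.pci (S t)) * (-hprod)

/-- This identifies the kinetic part of the energy with `ℱ² / 2` and lets `ℱ²` measure the
dissipation. -/
theorem ScenarioA.relax_sq (hA : D.ScenarioA So) {S : ℝ} (hS : S ∈ Ioo (0 : ℝ) 1) (p : ℝ) :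
    D.relax S p ^ 2 = max (p - D.pcd S) 0 ^ 2 + max (D.pci S - p) 0 ^ 2 := by
  have := hA.pci_lt_pcd S hS
  rw [hA.relax_eq hS]
  rcases le_total p (D.pcd S) with h | h
  · rw [max_eq_right (sub_nonpos.2 h)]; ring
  · rw [max_eq_right (a := D.pci S - p) (by linarith)]; ring

namespace DrainageData

variable {a m b τ : ℝ}

theorem mem (H : DrainageData D So a m b τ) {S : ℝ} (hS : S ∈ Icc a b) : S ∈ Ioo (0 : ℝ) 1 :=
  Icc_subset_Ioo_zero_one H.a_pos H.b_lt_one hS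

theorem m_mem (H : DrainageData D So a m b τ) : m ∈ Icc a b := ⟨H.a_lt_m.le, H.m_lt_b.le⟩

theorem a_lt_b (H : DrainageData D So a m b τ) : a < b := H.a_lt_m.trans H.m_lt_b

theorem hasDerivAt_potential (H : DrainageData D So a m b τ) {S : ℝ} (hS : S ∈ Ioo (0 : ℝ) 1) :
    HasDerivAt (D.potential b m) (D.G b m S) S :=
  H.scenario.hasDerivAt_integral_G b m (H.mem H.m_mem) hS

theorem continuousOn_potential (H : DrainageData D So a m b τ) :
    ContinuousOn (D.potential b m) (Icc a b) := fun _ hS =>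
  (H.hasDerivAt_potential (H.mem hS)).continuousAt.continuousWithinAt

theorem potential_m : D.potential b m m = 0 := intervalIntegral.integral_same

/-- The sign change of `𝒢` at `m` makes `m` the strict minimum of the potential. -/
theorem potential_pos (H : DrainageData D So a m b τ) {S : ℝ} (hS : S ∈ Icc a b) (hne : S ≠ m) :
    0 < D.potential b m S := by
  have hint : IntervalIntegrable (D.G b m) volume m S :=
    ((H.scenario.continuousOn_G b m).mono (ordConnected_Ioo.uIcc_subset (H.mem H.m_mem)
      (H.mem hS))).intervalIntegrable
  rcases lt_or_gt_of_ne hne with h | h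
  · have := intervalIntegral.intervalIntegral_pos_of_pos_on (f := fun x => - D.G b m x)
      hint.symm.neg (fun x hx => neg_pos.2 (H.G_neg x ⟨hS.1.trans hx.1.le, hx.2⟩)) h
    rwa [intervalIntegral.integral_neg, ← intervalIntegral.integral_symm] at this
  · exact intervalIntegral.intervalIntegral_pos_of_pos_on hint
      (fun x hx => H.G_pos x ⟨hx.1, hx.2.trans_le hS.2⟩) h

theorem potential_nonneg (H : DrainageData D So a m b τ) {S : ℝ} (hS : S ∈ Icc a b) :
    0 ≤ D.potential b m S := by
  rcases eq_or_ne S m with rfl | h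
  · exact potential_m.ge
  · exact (H.potential_pos hS h).le

theorem continuousOn_energy (H : DrainageData D So a m b τ) (κ : ℝ) (P : Set ℝ) :
    ContinuousOn (D.energy κ b m) (Icc a b ×ˢ P) := by
  have fst : ∀ {f : ℝ → ℝ}, ContinuousOn f (Icc a b) →
      ContinuousOn (fun x : ℝ × ℝ => f x.1) (Icc a b ×ˢ P) := fun h =>
    h.comp continuousOn_fst fun x hx => hx.1
  have hpd := fst (H.scenario.pcd_smooth.continuousOn.mono fun x hx => Ioo_subset_Ioc_self (H.mem hx))
  have hpi := fst (H.scenario.pci_smooth.continuousOn.mono fun x hx => Ioo_subset_Ioc_self (H.mem hx))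
  have h1 := fst H.continuousOn_potential
  have zero : ContinuousOn (fun _ : ℝ × ℝ => (0 : ℝ)) (Icc a b ×ˢ P) := continuousOn_const
  exact (continuousOn_const.mul h1).add (((((continuousOn_snd.sub hpd).sup zero).pow 2).add
    (((hpi.sub continuousOn_snd).sup zero).pow 2)).div_const 2)

/-- The unstable orbit of the equilibrium `E^d_b`, for negative times. -/
theorem exists_unstable_orbit (H : DrainageData D So a m b τ) {e p₁ p₂ : ℝ} (hbe : b < e)
    (he : e < 1) (hp₁ : p₁ < D.pci b) (hp₂ : D.pcd a < p₂) {V : ℝ × ℝ → ℝ × ℝ} {K : NNReal}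
    (hV : LipschitzWith K V) {C : ℝ} (hC : ∀ x, ‖V x‖ ≤ C)
    (hVW : ∀ x ∈ Icc a e ×ˢ Icc p₁ p₂,
      V x = (D.relax x.1 x.2 / (D.speed b m * τ), D.G b m x.1)) :
    ∃ X : ℝ → ℝ × ℝ, (∀ t, HasDerivAt X (V (X t)) t) ∧
      (∀ t ≤ 0, (X t).1 ∈ Ioo a b ∧ D.pcd (X t).1 < (X t).2 ∧ (X t).2 < p₂) ∧
      Tendsto X atBot (𝓝 (D.Ed b)) := by
  have hA := H.scenario
  set κ := D.speed b m * τ with hκdef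
  have hκ : 0 < κ := H.speed_mul_pos
  have hae : a < e := H.a_lt_b.trans hbe
  have hsub : Icc a e ⊆ Ioo (0 : ℝ) 1 := Icc_subset_Ioo_zero_one H.a_pos he
  obtain ⟨s₀, hs₀⟩ := exists_between H.m_lt_b
  have hs₀a : a < s₀ := H.a_lt_m.trans hs₀.1
  have anti : ∀ {x y : ℝ}, x ∈ Icc a e → y ∈ Icc a e → x < y → D.pcd y < D.pcd x :=
    fun hx hy h => hA.strictAntiOn_pcd (hsub hx) (hsub hy) h
  -- The shooting segment is `p = p₀`, `s₀ ≤ S ≤ b`, running from the drainage curve to the vertical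
  -- line through the equilibrium `E^d_b`.
  set p₀ := D.pcd s₀ with hp₀def
  have hp₀ : p₀ < p₂ := (anti ⟨le_rfl, hae.le⟩ ⟨hs₀a.le, (hs₀.2.trans hbe).le⟩ hs₀a).trans hp₂
  choose Φ hΦ0 hΦ using fun x => exists_global_solution hV hC x
  have hΦc : Continuous (Function.uncurry Φ) := continuous_flow hV hΦ0 hΦ
  -- A globally continuous version of `pcd`, so that `v` is continuous along orbits of the extended
  -- field that leave the box.
  let pd : ℝ → ℝ := IccExtend hae.le ((Icc a e).domRestrict D.pcd)
  have hpdc : Continuous pd := by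
    refine (continuousOn_iff_continuous_domRestrict.1 ?_).Icc_extend'
    exact hA.pcd_smooth.continuousOn.mono (hsub.trans Ioo_subset_Ioc_self)
  have hpd : ∀ x ∈ Icc a e, pd x = D.pcd x := fun x hx => IccExtend_of_mem _ _ hx
  let X : ℝ → ℝ → ℝ × ℝ := fun x t => Φ (x, p₀) t
  have hX : ∀ x t, HasDerivAt (X x) (V (X x t)) t := fun x => hΦ (x, p₀)
  have hX0 : ∀ x, X x 0 = (x, p₀) := fun x => hΦ0 (x, p₀)
  have hXc : Continuous (Function.uncurry X) :=
    hΦc.comp (by fun_prop : Continuous fun z : ℝ × ℝ => ((z.1, p₀), z.2))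
  have hXct : ∀ x, Continuous (X x) := fun x =>
    continuous_iff_continuousAt.2 fun t => (hX x t).continuousAt
  let u : ℝ → ℝ → ℝ := fun x t => (X x t).1 - b
  let v : ℝ → ℝ → ℝ := fun x t => (X x t).2 - pd (X x t).1
  have huc : Continuous (Function.uncurry u) := hXc.fst.sub continuous_const
  have hvc : Continuous (Function.uncurry v) := hXc.snd.sub (hpdc.comp hXc.fst)
  have du : ∀ x t, X x t ∈ Icc a e ×ˢ Icc p₁ p₂ →
      HasDerivAt (u x) (D.relax (X x t).1 (X x t).2 / κ) t := by
    intro x t hmem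
    have := (hX x t).fst_prod
    rw [hVW _ hmem] at this
    exact this.sub_const b
  have dv : ∀ x t, X x t ∈ Ioo a e ×ˢ Icc p₁ p₂ → (X x t).2 = D.pcd (X x t).1 →
      HasDerivAt (v x) (D.G b m (X x t).1) t := by
    intro x t hmem heq
    have hmem' : X x t ∈ Icc a e ×ˢ Icc p₁ p₂ := ⟨Ioo_subset_Icc_self hmem.1, hmem.2⟩
    have hin := hsub hmem'.1
    have h1 := (hX x t).fst_prod
    have h2 := (hX x t).snd_prod
    rw [hVW _ hmem'] at h1 h2
    have h3 : HasDerivAt pd (deriv D.pcd (X x t).1) (X x t).1 := by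
      refine (hA.hasDerivAt_pcd hin).congr_of_eventuallyEq ?_
      filter_upwards [Ioo_mem_nhds hmem.1.1 hmem.1.2] with y hy using
        hpd y (Ioo_subset_Icc_self hy)
    refine (h2.sub (h3.comp t h1)).congr_deriv ?_
    rw [heq, relax_eq_zero (hA.pci_lt_pcd _ hin).le le_rfl]
    simp
  have hb_mem : b ∈ Icc a e := ⟨H.a_lt_b.le, hbe.le⟩
  have hs₀_mem : s₀ ∈ Icc a e := ⟨hs₀a.le, (hs₀.2.trans hbe).le⟩
  have hp₁b : p₁ < D.pcd b := hp₁.trans (hA.pci_lt_pcd b (hsub hb_mem))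
  have hbpos : D.pcd b < p₀ := anti hs₀_mem hb_mem hs₀.2
  have ineqs : ∀ x ∈ Icc s₀ b, x ∈ Ioo a e ∧ p₀ ∈ Icc p₁ p₂ := fun x hx =>
    ⟨⟨hs₀a.trans_le hx.1, hx.2.trans_lt hbe⟩, (hp₁b.trans hbpos).le, hp₀.le⟩
  -- At `S = s₀` the start is on the drainage curve with `v' = 𝒢 > 0`, so backwards in time the
  -- orbit drops below the curve at once.
  have cross₁ : ∃ t ≤ 0, v s₀ t < 0 ∧ ∀ s ∈ Icc t 0, u s₀ s < 0 := by
    have h0 := ineqs s₀ ⟨le_rfl, hs₀.2.le⟩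
    have h1 := dv s₀ 0 (by rw [hX0]; exact h0) (by rw [hX0])
    rw [hX0] at h1
    have h2 := exists_crossing (u := fun s => - v s₀ s) (v := fun s => - u s₀ s) (t := 0)
      (huc.comp (Continuous.prodMk_right s₀)).neg le_rfl
      (eventually_pos_left_of_hasDerivAt_neg h1.neg
        (by simp [v, hX0, hpd s₀ hs₀_mem, hp₀def]) (neg_neg_of_pos (H.G_pos s₀ hs₀)))
      (fun s hs => by
        obtain rfl : s = 0 := le_antisymm hs.2 hs.1
        simp only [u, hX0]; linarith [hs₀.2])
    simpa only [neg_pos] using h2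
  -- At `S = b` the start is above the drainage curve, where `S' < 0`, so backwards in time the
  -- orbit passes to `S > b` at once.
  have cross₂ : ∃ t ≤ 0, 0 < u b t ∧ ∀ s ∈ Icc t 0, 0 < v b s := by
    have h0 := ineqs b ⟨hs₀.2.le, le_rfl⟩
    have h1 := du b 0 (by rw [hX0]; exact ⟨Ioo_subset_Icc_self h0.1, h0.2⟩)
    rw [hX0, hA.relax_of_pcd_le (hsub hb_mem) hbpos.le] at h1
    exact exists_crossing (hvc.comp (Continuous.prodMk_right b)) le_rfl
      (eventually_pos_left_of_hasDerivAt_neg h1 (by simp [u, hX0])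
        (div_neg_of_neg_of_pos (by linarith) hκ))
      (fun s hs => by
        obtain rfl : s = 0 := le_antisymm hs.2 hs.1
        simp only [v, hX0, hpd b hb_mem]; linarith)
  obtain ⟨x, hx, hnA, hnB⟩ := exists_not_crossing huc hvc hs₀.2.le cross₁ cross₂
  have hxs : s₀ < x := lt_of_le_of_ne hx.1 fun h => hnA (h ▸ cross₁)
  have hxb : x < b := lt_of_le_of_ne hx.2 fun h => hnB (h.symm ▸ cross₂)
  have hx_mem : x ∈ Icc a e := Ioo_subset_Icc_self (ineqs x hx).1
  -- Positivity of `c` keeps the orbit inside the remaining sides of the box, where the extended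
  -- field is the true one.
  let c : ℝ → ℝ := fun t => min ((X x t).1 - a) (p₂ - (X x t).2)
  have hcc : Continuous c :=
    ((hXct x).fst.sub continuous_const).min (continuous_const.sub (hXct x).snd)
  -- In the wedge `S` decreases and `p` increases in time. Hence backwards `S` stays between `x` and
  -- `b` and `p` below `p₀`, which closes the bootstrap for `c`.
  have wedge : ∀ t ≤ 0, (∀ s ∈ Icc t 0, u x s ≤ 0 ∧ 0 ≤ v x s ∧ 0 ≤ c s) →
      ∀ s ∈ Icc t 0, (X x s).1 ∈ Icc x b ∧ (X x s).2 ∈ Icc (D.pcd b) p₀ ∧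
        D.pcd (X x s).1 ≤ (X x s).2 ∧ X x s ∈ Icc a e ×ˢ Icc p₁ p₂ := by
    intro t ht hall
    have hSab : ∀ s ∈ Icc t 0, (X x s).1 ∈ Icc a b := fun s hs => by
      have h1 := hall s hs
      have h2 := h1.2.2.trans (min_le_left _ _)
      exact ⟨by linarith, by linarith [h1.1]⟩
    have hSae : ∀ s ∈ Icc t 0, (X x s).1 ∈ Icc a e := fun s hs =>
      Icc_subset_Icc_right hbe.le (hSab s hs)
    have hpp : ∀ s ∈ Icc t 0, D.pcd (X x s).1 ≤ (X x s).2 := fun s hs => by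
      have h1 := (hall s hs).2.1
      simp only [v, hpd _ (hSae s hs)] at h1
      linarith
    have hpb : ∀ s ∈ Icc t 0, D.pcd b ≤ (X x s).2 := fun s hs =>
      (hA.strictAntiOn_pcd.antitoneOn (hsub (hSae s hs)) (hsub hb_mem) (hSab s hs).2).trans
        (hpp s hs)
    have hbox : ∀ s ∈ Icc t 0, X x s ∈ Icc a e ×ˢ Icc p₁ p₂ := fun s hs => by
      have h2 := (hall s hs).2.2.trans (min_le_right _ _)
      exact ⟨hSae s hs, hp₁b.le.trans (hpb s hs), by linarith⟩
    have hSanti : AntitoneOn (fun s => (X x s).1) (Icc t 0) := by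
      refine antitoneOn_of_hasDerivWithinAt_nonpos (convex_Icc t 0)
        (f' := fun s => (V (X x s)).1) (hXct x).fst.continuousOn
        (fun s _ => (hX x s).fst_prod.hasDerivWithinAt) fun s hs => ?_
      have hs' := interior_subset hs
      rw [hVW _ (hbox s hs')]
      simp only [hA.relax_of_pcd_le (hsub (hSae s hs')) (hpp s hs')]
      exact div_nonpos_of_nonpos_of_nonneg (sub_nonpos.2 (hpp s hs')) hκ.le
    have hSx : ∀ s ∈ Icc t 0, x ≤ (X x s).1 := fun s hs => by
      have := hSanti hs ⟨ht, le_rfl⟩ hs.2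
      simpa only [hX0] using this
    have hpmono : MonotoneOn (fun s => (X x s).2) (Icc t 0) := by
      refine monotoneOn_of_hasDerivWithinAt_nonneg (convex_Icc t 0)
        (f' := fun s => (V (X x s)).2) (hXct x).snd.continuousOn
        (fun s _ => (hX x s).snd_prod.hasDerivWithinAt) fun s hs => ?_
      have hs' := interior_subset hs
      rw [hVW _ (hbox s hs')]
      rcases (hSab s hs').2.eq_or_lt with h | h
      · simp only [h, G_eq_zero (chord_left b m).symm, le_refl]
      · exact (H.G_pos _ ⟨(hs₀.1.trans hxs).trans_le (hSx s hs'), h⟩).le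
    refine fun s hs => ⟨⟨hSx s hs, (hSab s hs).2⟩, ⟨hpb s hs, ?_⟩, hpp s hs, hbox s hs⟩
    have := hpmono hs ⟨ht, le_rfl⟩ hs.2
    simpa only [hX0] using this
  have stay := forall_of_not_crossing (u := u x) (v := v x) (c := c)
    (huc.comp (Continuous.prodMk_right x)) (hvc.comp (Continuous.prodMk_right x)) hcc
    (by simp only [u, hX0]; linarith)
    (by simp only [v, hX0, hpd x hx_mem]; linarith [anti hs₀_mem hx_mem hxs])
    (by
      simp only [c, hX0]
      exact lt_min (by linarith) (by linarith))
    (fun t ht hall => by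
      obtain ⟨h1, h2, -⟩ := wedge t ht hall t ⟨le_rfl, ht⟩
      exact lt_min (by linarith [h1.1]) (by linarith [h2.2]))
    (fun t ht hall hut hvt => by
      obtain ⟨h1, h2, h3, h4⟩ := wedge t ht hall t ⟨le_rfl, ht⟩
      refine eventually_pos_left_of_hasDerivAt_neg (du x t h4) hut ?_
      rw [hA.relax_of_pcd_le (hsub h4.1) h3]
      simp only [v, hpd _ h4.1] at hvt
      exact div_neg_of_neg_of_pos (by linarith) hκ)
    (fun t ht hall hvt hut => by
      obtain ⟨h1, h2, h3, h4⟩ := wedge t ht hall t ⟨le_rfl, ht⟩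
      simp only [v, hpd _ h4.1] at hvt
      simp only [u] at hut
      have hd := dv x t ⟨⟨by linarith [h1.1], by linarith⟩, h4.2⟩ (by linarith)
      have hv0 : v x t = 0 := by simp only [v, hpd _ h4.1]; exact hvt
      simpa only [Pi.neg_apply, neg_pos] using eventually_pos_left_of_hasDerivAt_neg hd.neg
        (by rw [Pi.neg_apply, hv0, neg_zero])
        (neg_neg_of_pos (H.G_pos _ ⟨by linarith [h1.1, hs₀.1], by linarith⟩)))
    (fun t ht hall hcon => by
      obtain ⟨h1, h2, h3, h4⟩ := wedge t ht hall t ⟨le_rfl, ht⟩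
      obtain ⟨hut, hvt⟩ := hcon
      simp only [v, hpd _ h4.1] at hvt
      simp only [u] at hut
      have hSb : (X x t).1 = b := by linarith
      have hXt : X x t = (b, D.pcd b) := Prod.ext hSb (by rw [hSb] at hvt; simp only; linarith)
      have hVe : V (b, D.pcd b) = 0 := by
        rw [← hXt, hVW _ h4, hXt]
        simp only [G_eq_zero (chord_left b m).symm,
          relax_eq_zero (hA.pci_lt_pcd b (hsub hb_mem)).le le_rfl, zero_div]
        rfl
      have := solution_eq_equilibrium hV (hX x) hVe hXt 0
      rw [hX0] at this
      exact hxb.ne (congrArg Prod.fst this))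
    hnA hnB
  have good : ∀ t ≤ 0, (X x t).1 ∈ Ico x b ∧ (X x t).2 ∈ Icc (D.pcd b) p₀ ∧
      D.pcd (X x t).1 < (X x t).2 ∧ X x t ∈ Icc a e ×ˢ Icc p₁ p₂ := by
    intro t ht
    obtain ⟨h1, h2, h3, h4⟩ := wedge t ht (fun s hs =>
      ⟨(stay s hs.2).1.le, (stay s hs.2).2.1.le, (stay s hs.2).2.2.le⟩) t ⟨le_rfl, ht⟩
    obtain ⟨k1, k2, -⟩ := stay t ht
    simp only [u] at k1
    simp only [v, hpd _ h4.1] at k2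
    exact ⟨⟨h1.1, by linarith⟩, h2, by linarith, h4⟩
  refine ⟨X x, hX x, fun t ht => ?_, ?_⟩
  · obtain ⟨h1, h2, h3, h4⟩ := good t ht
    exact ⟨⟨(ineqs x hx).1.1.trans_le h1.1, h1.2⟩, h3, h2.2.trans_lt hp₀⟩
  have dS : ∀ t ≤ 0, HasDerivAt (fun t => (X x t).1)
      ((D.pcd (X x t).1 - (X x t).2) / κ) t := by
    intro t ht
    obtain ⟨h1, h2, h3, h4⟩ := good t ht
    have := (hX x t).fst_prod
    rwa [hVW _ h4, hA.relax_of_pcd_le (hsub h4.1) h3.le] at this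
  have dp : ∀ t ≤ 0, HasDerivAt (fun t => (X x t).2) (D.G b m (X x t).1) t := by
    intro t ht
    have := (hX x t).snd_prod
    rwa [hVW _ (good t ht).2.2.2] at this
  have hSanti : AntitoneOn (fun t => (X x t).1) (Iic 0) := by
    refine antitoneOn_of_hasDerivWithinAt_nonpos (convex_Iic 0) (hXct x).fst.continuousOn
      (fun t ht => (dS t (interior_subset ht : t ∈ Iic (0 : ℝ))).hasDerivWithinAt) fun t ht => ?_
    have := (good t (interior_subset ht : t ∈ Iic (0 : ℝ))).2.2.1
    exact div_nonpos_of_nonpos_of_nonneg (by linarith) hκ.le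
  have hpmono : MonotoneOn (fun t => (X x t).2) (Iic 0) := by
    refine monotoneOn_of_hasDerivWithinAt_nonneg (convex_Iic 0) (hXct x).snd.continuousOn
      (fun t ht => (dp t (interior_subset ht : t ∈ Iic (0 : ℝ))).hasDerivWithinAt) fun t ht => ?_
    have := (good t (interior_subset ht : t ∈ Iic (0 : ℝ))).1
    exact (H.G_pos _ ⟨(hs₀.1.trans hxs).trans_le this.1, this.2⟩).le
  have hmin : ∀ᶠ t : ℝ in atBot, min t 0 = t :=
    (eventually_le_atBot 0).mono fun t ht => min_eq_left ht
  have hmin0 : ∀ t : ℝ, min t 0 ≤ 0 := fun t => min_le_right _ _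
  obtain ⟨lS, hlS⟩ : ∃ l, Tendsto (fun t => (X x t).1) atBot (𝓝 l) := by
    have h : Antitone fun t => (X x (min t 0)).1 := fun s t hst =>
      hSanti (hmin0 s) (hmin0 t) (min_le_min_right 0 hst)
    refine ⟨_, (tendsto_atBot_ciSup h ⟨b, ?_⟩).congr' (hmin.mono fun t ht => by rw [ht])⟩
    rintro _ ⟨t, rfl⟩
    exact (good _ (hmin0 t)).1.2.le
  obtain ⟨lp, hlp⟩ : ∃ l, Tendsto (fun t => (X x t).2) atBot (𝓝 l) := by
    have h : Monotone fun t => (X x (min t 0)).2 := fun s t hst =>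
      hpmono (hmin0 s) (hmin0 t) (min_le_min_right 0 hst)
    refine ⟨_, (tendsto_atBot_ciInf h ⟨D.pcd b, ?_⟩).congr' (hmin.mono fun t ht => by rw [ht])⟩
    rintro _ ⟨t, rfl⟩
    exact (good _ (hmin0 t)).2.1.1
  have hlS_mem : lS ∈ Icc x b := isClosed_Icc.mem_of_tendsto hlS
    ((eventually_le_atBot 0).mono fun t ht => Ico_subset_Icc_self (good t ht).1)
  have hlS_in : lS ∈ Ioo (0 : ℝ) 1 :=
    hsub ⟨hx_mem.1.trans hlS_mem.1, hlS_mem.2.trans hbe.le⟩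
  -- Both components are monotone and bounded, so the limits of their derivatives vanish: `𝒢(lS) =
  -- 0` forces `lS = b`, and then `S' → 0` forces `lp = pcd b`.
  have hlSb : lS = b := by
    have h0 := eq_zero_of_tendsto_of_tendsto_deriv_atBot
      ((eventually_le_atBot 0).mono dp) hlp ((hA.continuousAt_G b m hlS_in).tendsto.comp hlS)
    by_contra hne
    exact (H.G_pos lS ⟨(hs₀.1.trans hxs).trans_le hlS_mem.1,
      lt_of_le_of_ne hlS_mem.2 hne⟩).ne' h0
  have hlpb : lp = D.pcd b := by
    have h0 := eq_zero_of_tendsto_of_tendsto_deriv_atBot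
      ((eventually_le_atBot 0).mono dS) hlS
      ((((hA.hasDerivAt_pcd hlS_in).continuousAt.tendsto.comp hlS).sub hlp).div_const κ)
    rw [hlSb] at h0
    rcases div_eq_zero_iff.1 h0 with h | h
    · linarith
    · exact absurd h hκ.ne'
  rw [hlSb] at hlS
  rw [hlpb] at hlp
  exact hlS.prodMk_nhds hlp

end DrainageData

end TwoPhaseModel

end

/-! ### Energy confinement and convergence of the drainage orbit -/

noncomputable section

namespace TwoPhaseModel

variable {D : TwoPhaseModel} {So : ℝ}

theorem ScenarioA.sub_pcd_le_abs_relax (hA : D.ScenarioA So) {S : ℝ} (hS : S ∈ Ioo (0 : ℝ) 1)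
    (p : ℝ) : p - D.pcd S ≤ |D.relax S p| := by
  refine (le_max_left _ 0).trans ((le_abs_self _).trans (sq_le_sq.1 ?_))
  rw [hA.relax_sq hS]
  linarith [sq_nonneg (max (p - D.pcd S) 0), sq_nonneg (max (D.pci S - p) 0)]

theorem ScenarioA.pci_sub_le_abs_relax (hA : D.ScenarioA So) {S : ℝ} (hS : S ∈ Ioo (0 : ℝ) 1)
    (p : ℝ) : D.pci S - p ≤ |D.relax S p| := by
  refine (le_max_left _ 0).trans ((le_abs_self _).trans (sq_le_sq.1 ?_))
  rw [hA.relax_sq hS]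
  linarith [sq_nonneg (max (p - D.pcd S) 0), sq_nonneg (max (D.pci S - p) 0)]

/-- The distance of a point to the segment of equilibria at the saturation `m`. -/
theorem ScenarioA.infDist_segment_le (hA : D.ScenarioA So) {m S : ℝ} (hm : m ∈ Ioo (0 : ℝ) 1)
    (hS : S ∈ Ioo (0 : ℝ) 1) (p : ℝ) :
    Metric.infDist (S, p) (segment ℝ (D.Ei m) (D.Ed m)) ≤
      |S - m| + (|D.relax S p| + (|D.pcd S - D.pcd m| + |D.pci S - D.pci m|)) := by
  have hlt := hA.pci_lt_pcd m hm
  -- The pressure clamped to the segment; the clamping error is at most `|ℱ|` plus the variation of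
  -- the capillary pressures between `m` and `S`.
  set q := max (D.pci m) (min p (D.pcd m)) with hq
  have hmem : (m, q) ∈ segment ℝ (D.Ei m) (D.Ed m) := by
    rw [Ei, Ed, ← Prod.image_mk_segment_right, segment_eq_Icc hlt.le]
    exact ⟨q, ⟨le_max_left _ _, max_le hlt.le (min_le_right _ _)⟩, rfl⟩
  refine (Metric.infDist_le_dist_of_mem hmem).trans ?_
  have h1 := hA.sub_pcd_le_abs_relax hS p
  have h2 := hA.pci_sub_le_abs_relax hS p
  have h3 := abs_nonneg (D.relax S p)
  have h4 := abs_nonneg (D.pcd S - D.pcd m)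
  have h5 := abs_nonneg (D.pci S - D.pci m)
  have h6 := le_abs_self (D.pcd S - D.pcd m)
  have h7 := neg_abs_le (D.pci S - D.pci m)
  have hpq : |p - q| ≤ |D.relax S p| + (|D.pcd S - D.pcd m| + |D.pci S - D.pci m|) := by
    rcases lt_or_ge p (D.pci m) with h | h
    · rw [hq, min_eq_left (h.le.trans hlt.le), max_eq_left h.le, abs_of_neg (by linarith)]
      linarith
    · rcases le_or_gt p (D.pcd m) with h' | h'
      · rw [hq, min_eq_left h', max_eq_right h, sub_self, abs_zero]
        linarith
      · rw [hq, min_eq_right h'.le, max_eq_right hlt.le, abs_of_pos (by linarith)]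
        linarith
  rw [Prod.dist_eq]
  refine max_le ?_ ?_
  · rw [Real.dist_eq]; simp only; linarith
  · rw [Real.dist_eq]; have := abs_nonneg (S - m); simp only; linarith

namespace DrainageData

variable {a m b τ : ℝ}

theorem energy_Ed (H : DrainageData D So a m b τ) (κ : ℝ) :
    D.energy κ b m (D.Ed b) = κ * D.potential b m b := by
  have := H.scenario.pci_lt_pcd b (H.mem ⟨H.a_lt_b.le, le_rfl⟩)
  simp only [energy, Ed, sub_self, max_self]
  rw [max_eq_right (by linarith)]
  ring

theorem energy_eq (H : DrainageData D So a m b τ) (κ : ℝ) {x : ℝ × ℝ} (hx : x.1 ∈ Icc a b) :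
    D.energy κ b m x = κ * D.potential b m x.1 + D.relax x.1 x.2 ^ 2 / 2 := by
  rw [energy, H.scenario.relax_sq (H.mem hx)]

/-- The drainage orbit stays in the strip `a < S < b`. -/
theorem exists_bounded_orbit (H : DrainageData D So a m b τ) :
    ∃ (X : ℝ → ℝ × ℝ) (C P l : ℝ), 0 ≤ C ∧ Tendsto X atBot (𝓝 (D.Ed b)) ∧
      (∀ t, (X t).1 ∈ Ioo a b ∧ |(X t).2| ≤ P ∧
        HasDerivAt (fun t => (X t).1) (D.relax (X t).1 (X t).2 / (D.speed b m * τ)) t ∧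
        HasDerivAt (fun t => (X t).2) (D.G b m (X t).1) t) ∧
      (∀ s t, dist (X s) (X t) ≤ C * |s - t|) ∧ l < D.speed b m * τ * D.potential b m b ∧
      ∀ t ≥ 0, D.energy (D.speed b m * τ) b m (X t) ≤ l := by
  have hA := H.scenario
  set κ := D.speed b m * τ with hκdef
  have hκ : 0 < κ := H.speed_mul_pos
  set Γb := D.potential b m b with hΓb
  have ha_mem : a ∈ Icc a b := ⟨le_rfl, H.a_lt_b.le⟩
  have hb_mem : b ∈ Icc a b := ⟨H.a_lt_b.le, le_rfl⟩
  have hΓb0 : 0 ≤ Γb := H.potential_nonneg hb_mem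
  -- Below the energy level `κ Γb` one has `ℱ² < 2 κ Γb`, hence `|ℱ| < C₀`. The additional `1` in
  -- `p₁` and `p₂` leaves a margin inside the box.
  set C₀ := 2 * κ * Γb + 1 with hC₀
  have hC₀1 : 1 ≤ C₀ := by have := mul_nonneg hκ.le hΓb0; linarith
  obtain ⟨e, hbe, he⟩ := exists_between H.b_lt_one
  have hci_b := hA.pci_lt_pcd b (H.mem hb_mem)
  have hpcd_ba := hA.strictAntiOn_pcd (H.mem ha_mem) (H.mem hb_mem) H.a_lt_b
  set p₁ := D.pci b - C₀ - 1 with hp₁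
  set p₂ := D.pcd a + C₀ + 1 with hp₂
  obtain ⟨V, K, hV, ⟨C, hC⟩, hVW⟩ := hA.exists_field_extension (p₁ := p₁) (p₂ := p₂) H.a_pos
    (H.a_lt_b.trans hbe).le he (by linarith) κ b m
  obtain ⟨X, hX, hneg, hlim⟩ := H.exists_unstable_orbit hbe he (by linarith : p₁ < D.pci b)
    (by linarith : D.pcd a < p₂) hV hC hVW
  have hXc : Continuous X := continuous_iff_continuousAt.2 fun t => (hX t).continuousAt
  have anti_pcd : ∀ S ∈ Icc a b, D.pcd S ∈ Icc (D.pcd b) (D.pcd a) := fun S hS =>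
    ⟨hA.strictAntiOn_pcd.antitoneOn (H.mem hS) (H.mem hb_mem) hS.2,
      hA.strictAntiOn_pcd.antitoneOn (H.mem ha_mem) (H.mem hS) hS.1⟩
  have anti_pci : ∀ S ∈ Icc a b, D.pci b ≤ D.pci S := fun S hS =>
    hA.strictAntiOn_pci.antitoneOn (H.mem hS) (H.mem hb_mem) hS.2
  let E : ℝ → ℝ := fun t => D.energy κ b m (X t)
  let Q : Set (ℝ × ℝ) := Icc a b ×ˢ Icc p₁ p₂
  let U : Set (ℝ × ℝ) := Ioo a b ×ˢ Ioo p₁ p₂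
  have hUQ : U ⊆ Q := prod_mono Ioo_subset_Icc_self Ioo_subset_Icc_self
  have dX : ∀ t, X t ∈ Q →
      HasDerivAt (fun t => (X t).1) (D.relax (X t).1 (X t).2 / κ) t ∧
      HasDerivAt (fun t => (X t).2) (D.G b m (X t).1) t := by
    intro t ht
    have h := hVW (X t) ⟨Icc_subset_Icc_right hbe.le ht.1, ht.2⟩
    have h1 := (hX t).fst_prod
    have h2 := (hX t).snd_prod
    rw [h] at h1 h2
    exact ⟨h1, h2⟩
  have dE : ∀ t, X t ∈ Q → HasDerivAt E
      ((max ((X t).2 - D.pcd (X t).1) 0 ^ 2 * deriv D.pcd (X t).1 +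
        max (D.pci (X t).1 - (X t).2) 0 ^ 2 * deriv D.pci (X t).1) / κ) t := fun t ht =>
    hA.hasDerivAt_energy hκ.ne' (H.mem H.m_mem) (H.mem ht.1) (dX t ht).1 (dX t ht).2
  have dE_nonpos : ∀ t, X t ∈ Q →
      (max ((X t).2 - D.pcd (X t).1) 0 ^ 2 * deriv D.pcd (X t).1 +
        max (D.pci (X t).1 - (X t).2) 0 ^ 2 * deriv D.pci (X t).1) / κ ≤ 0 := fun t ht => by
    refine div_nonpos_of_nonpos_of_nonneg (add_nonpos ?_ ?_) hκ.le
    · exact mul_nonpos_of_nonneg_of_nonpos (sq_nonneg _) (hA.pcd_deriv_neg _ (H.mem ht.1)).le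
    · exact mul_nonpos_of_nonneg_of_nonpos (sq_nonneg _) (hA.pci_deriv_neg _ (H.mem ht.1)).le
  have hnegU : ∀ t ≤ 0, X t ∈ U := fun t ht => by
    obtain ⟨h1, h2, h3⟩ := hneg t ht
    refine ⟨h1, ?_, h3⟩
    linarith [(anti_pcd _ (Ioo_subset_Icc_self h1)).1]
  -- The energy tends to `κ Γb` at `-∞`. It decreases strictly for `t ≤ 0`, because the orbit is
  -- strictly above the drainage curve there.
  have hE0 : E 0 < κ * Γb := by
    have hlimE : Tendsto E atBot (𝓝 (κ * Γb)) := by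
      rw [hΓb, ← H.energy_Ed κ]
      refine ((H.continuousOn_energy κ univ) (D.Ed b) ⟨hb_mem, trivial⟩).tendsto.comp
        (tendsto_nhdsWithin_iff.2 ⟨hlim, (eventually_le_atBot 0).mono fun t ht => ?_⟩)
      exact ⟨Ioo_subset_Icc_self (hneg t ht).1, trivial⟩
    have hanti : StrictAntiOn E (Iic 0) := by
      refine strictAntiOn_of_deriv_neg (convex_Iic 0) (fun t ht =>
        (dE t (hUQ (hnegU t ht))).continuousAt.continuousWithinAt) fun t ht => ?_
      have ht' : t ∈ Iic (0 : ℝ) := interior_subset ht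
      have hQ := hUQ (hnegU t ht')
      rw [(dE t hQ).deriv]
      refine div_neg_of_neg_of_pos (add_neg_of_neg_of_nonpos ?_ ?_) hκ
      · refine mul_neg_of_pos_of_neg (pow_pos (lt_max_of_lt_left ?_) 2)
          (hA.pcd_deriv_neg _ (H.mem hQ.1))
        exact sub_pos.2 (hneg t ht').2.1
      · exact mul_nonpos_of_nonneg_of_nonpos (sq_nonneg _) (hA.pci_deriv_neg _ (H.mem hQ.1)).le
    have h1 : E 0 < E (-1) := hanti (by simp) (by simp) (by norm_num)
    have h2 : E (-1) ≤ κ * Γb := by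
      refine ge_of_tendsto hlimE ((eventually_le_atBot (-1)).mono fun t ht => ?_)
      exact hanti.antitoneOn (show t ∈ Iic (0 : ℝ) by simp only [mem_Iic]; linarith) (by simp) ht
    linarith
  -- Within the closed box the sublevel set avoids the boundary: the sides `S = a` and `S = b` have
  -- potential at least `Γb`, and the other two are excluded by the bound on `ℱ`.
  have hsublevel : ∀ x ∈ Q, D.energy κ b m x ≤ E 0 → x ∈ U := by
    intro x hx hle
    have hS := H.mem hx.1
    have h1 := hle.trans_lt hE0
    rw [H.energy_eq κ hx.1] at h1
    have h2 : D.potential b m x.1 < Γb := by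
      have := sq_nonneg (D.relax x.1 x.2)
      exact lt_of_mul_lt_mul_left (by linarith) hκ.le
    have h3 : |D.relax x.1 x.2| < C₀ := by
      have h4 := mul_nonneg hκ.le (H.potential_nonneg hx.1)
      refine abs_lt_of_sq_lt_sq ?_ (by linarith)
      nlinarith
    have h4 := hA.sub_pcd_le_abs_relax hS x.2
    have h5 := hA.pci_sub_le_abs_relax hS x.2
    refine ⟨⟨lt_of_le_of_ne hx.1.1 fun h => ?_, lt_of_le_of_ne hx.1.2 fun h => ?_⟩, ?_, ?_⟩
    · rw [← h] at h2; exact lt_asymm h2 H.potential_lt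
    · rw [h] at h2; exact lt_irrefl _ h2
    · linarith [anti_pci _ hx.1]
    · linarith [(anti_pcd _ hx.1).2]
  -- Continuous induction: the admissible times form a closed set, and at each of them the orbit is
  -- in the open box, where the energy keeps decreasing a little longer.
  have hforward : ∀ T : ℝ, 0 ≤ T → X T ∈ U ∧ E T ≤ E 0 := by
    intro T hT
    let s : Set ℝ := X ⁻¹' (Q ∩ D.energy κ b m ⁻¹' Iic (E 0))
    have hsU : ∀ t ∈ s, X t ∈ U := fun t ht => hsublevel _ ht.1 ht.2
    have hclosed : IsClosed s := ((H.continuousOn_energy κ (Icc p₁ p₂)).preimage_isClosed_of_isClosed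
      (isClosed_Icc.prod isClosed_Icc) isClosed_Iic).preimage hXc
    have hsub : Icc 0 T ⊆ s := by
      refine (hclosed.inter isClosed_Icc).Icc_subset_of_forall_mem_nhdsWithin
        ⟨hUQ (hnegU 0 le_rfl), le_refl (E 0)⟩ ?_
      rintro t ⟨hts, -⟩
      have hopen : IsOpen (X ⁻¹' U) := (isOpen_Ioo.prod isOpen_Ioo).preimage hXc
      obtain ⟨r, hr, hrU⟩ := exists_Ico_subset_of_mem_nhds (hopen.mem_nhds (hsU t hts))
        ⟨t + 1, by linarith⟩
      filter_upwards [Ioo_mem_nhdsGT hr] with y hy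
      have hanti : AntitoneOn E (Icc t y) := by
        have hQ : ∀ z ∈ Icc t y, X z ∈ Q := fun z hz => hUQ (hrU ⟨hz.1, hz.2.trans_lt hy.2⟩)
        exact antitoneOn_of_hasDerivWithinAt_nonpos (convex_Icc t y)
          (fun z hz => (dE z (hQ z hz)).continuousAt.continuousWithinAt)
          (fun z hz => (dE z (hQ z (interior_subset hz))).hasDerivWithinAt)
          (fun z hz => dE_nonpos z (hQ z (interior_subset hz)))
      exact ⟨hUQ (hrU ⟨hy.1.le, hy.2⟩),
        (hanti ⟨le_rfl, hy.1.le⟩ ⟨hy.1.le, le_rfl⟩ hy.1.le).trans hts.2⟩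
    have hTs := hsub ⟨hT, le_rfl⟩
    exact ⟨hsU T hTs, hTs.2⟩
  have hall : ∀ t, X t ∈ U := fun t => by
    rcases le_total t 0 with h | h
    · exact hnegU t h
    · exact (hforward t h).1
  refine ⟨X, C, max |p₁| |p₂|, E 0, (norm_nonneg _).trans (hC 0), hlim, fun t => ?_, fun s t => ?_,
    hE0, fun t ht => (hforward t ht).2⟩
  · have h1 := hall t
    refine ⟨h1.1, ?_, dX t (hUQ h1)⟩
    refine abs_le_max_abs_abs h1.2.1.le h1.2.2.le
  · have h := Convex.norm_image_sub_le_of_norm_hasDerivWithin_le (f := X) (f' := fun t => V (X t))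
      (s := univ) (C := C) (x := t) (y := s) (fun z _ => (hX z).hasDerivWithinAt)
      (fun z _ => hC _) convex_univ trivial trivial
    rwa [dist_eq_norm, ← Real.norm_eq_abs]

/-- The drainage wave. -/
theorem exists_profile (H : DrainageData D So a m b τ) :
    ∃ S p : ℝ → ℝ, D.IsViscousProfile τ b m S p ∧
      Tendsto (fun ξ => (S ξ, p ξ)) atBot (𝓝 (D.Ed b)) ∧
      Tendsto (fun ξ => Metric.infDist (S ξ, p ξ) (segment ℝ (D.Ei m) (D.Ed m))) atTop (𝓝 0) := by
  have hA := H.scenario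
  obtain ⟨X, C, P, c₀, hC, hlim, hall, hlip, hc₀, hE⟩ := H.exists_bounded_orbit
  set κ := D.speed b m * τ with hκdef
  have hκ : 0 < κ := H.speed_mul_pos
  have hab : ∀ t, (X t).1 ∈ Icc a b := fun t => Ioo_subset_Icc_self (hall t).1
  have hin : ∀ t, (X t).1 ∈ Ioo (0 : ℝ) 1 := fun t => H.mem (hab t)
  let E : ℝ → ℝ := fun t => D.energy κ b m (X t)
  let R : ℝ → ℝ := fun t => D.relax (X t).1 (X t).2
  let E' : ℝ → ℝ := fun t => (max ((X t).2 - D.pcd (X t).1) 0 ^ 2 * deriv D.pcd (X t).1 +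
        max (D.pci (X t).1 - (X t).2) 0 ^ 2 * deriv D.pci (X t).1) / κ
  have dE : ∀ t, HasDerivAt E (E' t) t := fun t =>
    hA.hasDerivAt_energy hκ.ne' (H.mem H.m_mem) (hin t) (hall t).2.2.1 (hall t).2.2.2
  obtain ⟨μ, hμ, hμd⟩ : ∃ μ > 0, ∀ S ∈ Icc a b, deriv D.pcd S ≤ -μ ∧ deriv D.pci S ≤ -μ := by
    have hsub : Icc a b ⊆ Ioo (0 : ℝ) 1 := fun S hS => H.mem hS
    obtain ⟨x, hx, hx'⟩ := isCompact_Icc.exists_isMaxOn ⟨m, H.m_mem⟩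
      (hA.continuousOn_deriv_pcd.mono hsub)
    obtain ⟨y, hy, hy'⟩ := isCompact_Icc.exists_isMaxOn ⟨m, H.m_mem⟩
      (hA.continuousOn_deriv_pci.mono hsub)
    have h1 := hA.pcd_deriv_neg x (hsub hx)
    have h2 := hA.pci_deriv_neg y (hsub hy)
    refine ⟨min (-deriv D.pcd x) (-deriv D.pci y), lt_min (by linarith) (by linarith),
      fun S hS => ⟨?_, ?_⟩⟩
    · have h3 : deriv D.pcd S ≤ deriv D.pcd x := hx' hS
      linarith [min_le_left (-deriv D.pcd x) (-deriv D.pci y)]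
    · have h3 : deriv D.pci S ≤ deriv D.pci y := hy' hS
      linarith [min_le_right (-deriv D.pcd x) (-deriv D.pci y)]
  have hdiss : ∀ t, E' t ≤ -(μ / κ * R t ^ 2) := by
    intro t
    obtain ⟨h1, h2⟩ := hμd _ (hab t)
    have h3 : R t ^ 2 = _ := hA.relax_sq (hin t) (X t).2
    have h4 := mul_le_mul_of_nonneg_left h1 (sq_nonneg (max ((X t).2 - D.pcd (X t).1) 0))
    have h5 := mul_le_mul_of_nonneg_left h2 (sq_nonneg (max (D.pci (X t).1 - (X t).2) 0))
    have h6 : -(μ / κ * R t ^ 2) = (-(μ * R t ^ 2)) / κ := by ring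
    rw [h6, div_le_div_iff_of_pos_right hκ, h3]
    linarith
  have hEanti : Antitone E := antitone_of_hasDerivAt_nonpos dE fun t =>
    (hdiss t).trans (neg_nonpos.2 (mul_nonneg (div_pos hμ hκ).le (sq_nonneg _)))
  have hEeq : ∀ t, E t = κ * D.potential b m (X t).1 + R t ^ 2 / 2 := fun t =>
    H.energy_eq κ (hab t)
  have hE0 : ∀ t, 0 ≤ E t := fun t => by
    rw [hEeq]
    have := mul_nonneg hκ.le (H.potential_nonneg (hab t))
    positivity
  obtain ⟨l, hl⟩ : ∃ l, Tendsto E atTop (𝓝 l) :=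
    ⟨_, tendsto_atTop_ciInf hEanti ⟨0, by rintro _ ⟨t, rfl⟩; exact hE0 t⟩⟩
  have hR : Tendsto R atTop (𝓝 0) := by
    obtain ⟨K, hK⟩ := hA.exists_lipschitzOnWith_relax H.a_pos H.b_lt_one
    refine tendsto_zero_of_dissipation (Λ := K * C) (div_pos hμ hκ) (by positivity) dE hdiss
      (fun s t => ?_) hl
    have h1 := hK.dist_le_mul (X s) ⟨hab s, trivial⟩ (X t) ⟨hab t, trivial⟩
    rw [Real.dist_eq] at h1
    calc |R s - R t| ≤ K * dist (X s) (X t) := h1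
      _ ≤ K * (C * |s - t|) := by gcongr; exact hlip s t
      _ = K * C * |s - t| := by ring
  have hΓ : Tendsto (fun t => D.potential b m (X t).1) atTop (𝓝 (l / κ)) := by
    have h1 : Tendsto (fun t => (E t - R t ^ 2 / 2) / κ) atTop (𝓝 ((l - 0 ^ 2 / 2) / κ)) :=
      (hl.sub ((hR.pow 2).div_const 2)).div_const κ
    have h2 : (l - 0 ^ 2 / 2) / κ = l / κ := by ring
    rw [h2] at h1
    refine h1.congr fun t => ?_
    rw [hEeq]; field_simp; ring
  have hg : l / κ = 0 := by
    have hg0 : 0 ≤ l / κ := ge_of_tendsto' hΓ fun t => H.potential_nonneg (hab t)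
    by_contra hne
    have hgpos : 0 < l / κ := lt_of_le_of_ne hg0 (Ne.symm hne)
    -- If the limit of the potential were positive, the orbit would eventually stay where the
    -- potential is bounded away from its values at `m` and `b`. On this compact set `|𝒢|` has a
    -- positive minimum, so `p` would be unbounded.
    let k : Set ℝ := Icc a b ∩ D.potential b m ⁻¹' Icc (l / κ / 2) (c₀ / κ)
    have hk : IsCompact k := isCompact_Icc.of_isClosed_subset
      (H.continuousOn_potential.preimage_isClosed_of_isClosed isClosed_Icc isClosed_Icc)
      inter_subset_left
    have hev : ∀ᶠ t in atTop, (X t).1 ∈ k := by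
      filter_upwards [hΓ.eventually (lt_mem_nhds (half_lt_self hgpos)), eventually_ge_atTop 0]
        with t h1 h2
      refine ⟨hab t, h1.le, ?_⟩
      rw [le_div_iff₀ hκ]
      have h3 := hE t h2
      have h4 : E t = _ := hEeq t
      have h5 := sq_nonneg (R t)
      simp only [E] at h4
      linarith
    obtain ⟨T, hT⟩ := eventually_atTop.1 hev
    obtain ⟨x, hx, hx'⟩ := hk.exists_isMinOn ⟨_, hT T le_rfl⟩
      (((hA.continuousOn_G b m).mono fun S hS => H.mem hS.1).abs)
    have hGx : D.G b m x ≠ 0 := by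
      have h1 : x ≠ m := fun h => by
        have h2 := hx.2.1
        rw [h, potential_m] at h2
        linarith
      have h2 : x ≠ b := fun h => by
        have h3 := hx.2.2
        rw [h, le_div_iff₀ hκ] at h3
        linarith
      rcases lt_or_gt_of_ne h1 with h | h
      · exact (H.G_neg x ⟨hx.1.1, h⟩).ne
      · exact (H.G_pos x ⟨h, lt_of_le_of_ne hx.1.2 h2⟩).ne'
    exact not_bounded_of_deriv (abs_pos.2 hGx) (fun t => (hall t).2.2.2)
      (fun t ht => hx' (hT t ht)) fun t => (hall t).2.1
  rw [hg] at hΓ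
  have hS : Tendsto (fun t => (X t).1) atTop (𝓝 m) := by
    rw [Metric.tendsto_atTop']
    intro ε hε
    let k : Set ℝ := Icc a b ∩ {S | ε ≤ dist S m}
    have hk : IsCompact k := isCompact_Icc.inter_right
      (isClosed_le continuous_const (continuous_id.dist continuous_const))
    have hev : ∀ᶠ t in atTop, (X t).1 ∉ k := by
      rcases k.eq_empty_or_nonempty with h | h
      · simp [h]
      · obtain ⟨x, hx, hx'⟩ := hk.exists_isMinOn h
          (H.continuousOn_potential.mono inter_subset_left)
        have hpos : 0 < D.potential b m x := H.potential_pos hx.1 fun h => by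
          have h2 : ε ≤ dist x m := hx.2
          rw [h, dist_self] at h2
          linarith
        filter_upwards [hΓ.eventually (gt_mem_nhds hpos)] with t ht htk
        exact absurd ht (not_lt.2 (hx' htk))
    obtain ⟨T, hT⟩ := eventually_atTop.1 hev
    exact ⟨T, fun t ht => not_le.1 fun h => hT t ht.le ⟨hab t, h⟩⟩
  have hbot : Tendsto (fun t => (X t).1) atBot (𝓝 b) := (continuous_fst.tendsto _).comp hlim
  have hdp : deriv (fun t => (X t).2) = fun t => D.G b m (X t).1 :=
    funext fun t => (hall t).2.2.2.deriv
  refine ⟨fun t => (X t).1, fun t => (X t).2,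
    { mem := hin
      ode_S := fun t => (hall t).2.2.1
      ode_p := fun t => (hall t).2.2.2
      S_bot := hbot
      S_top := hS
      p_bot := ?_
      p_top := ?_ }, hlim, ?_⟩
  · rw [hdp, ← G_eq_zero (D := D) (a := b) (b := m) (chord_left b m).symm]
    exact (hA.continuousAt_G b m (H.mem ⟨H.a_lt_b.le, le_rfl⟩)).tendsto.comp hbot
  · rw [hdp, ← G_eq_zero (D := D) (a := b) (b := m) (chord_right b m).symm]
    exact (hA.continuousAt_G b m (H.mem H.m_mem)).tendsto.comp hS
  · have hm := H.mem H.m_mem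
    have hd : Tendsto (fun t => |(X t).1 - m| + (|R t| + (|D.pcd (X t).1 - D.pcd m| +
        |D.pci (X t).1 - D.pci m|))) atTop (𝓝 (|m - m| + (|0| + (|D.pcd m - D.pcd m| +
        |D.pci m - D.pci m|)))) :=
      (hS.sub_const m).abs.add (hR.abs.add
        ((((hA.hasDerivAt_pcd hm).continuousAt.tendsto.comp hS).sub_const _).abs.add
        (((hA.hasDerivAt_pci hm).continuousAt.tendsto.comp hS).sub_const _).abs))
    simp only [sub_self, abs_zero, add_zero] at hd
    exact squeeze_zero (fun _ => Metric.infDist_nonneg)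
      (fun t => hA.infDist_segment_le hm (hin t) (X t).2) hd

end DrainageData

end TwoPhaseModel

end

noncomputable section

namespace TwoPhaseModel

variable {D : TwoPhaseModel} {So : ℝ}

/-! ### The non-classical plateau solution -/

theorem speed_lt_of_chord_lt {b x c : ℝ} (hxb : x < b)
    (h : D.F b + c * (x - b) < D.F x) : D.speed b x < c := by
  rw [speed_comm, speed, div_lt_iff₀ (sub_pos.2 hxb)]
  linarith

/-- For a point of the region `ℬ` the data for the drainage wave are available. -/
theorem ScenarioA.drainageData (hA : D.ScenarioA So) {SB α b ST τ : ℝ} (hSB : 0 < SB)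
    (hSBo : SB ≤ So) (hα : SB < α) (hαST : α < ST) (hSTb : ST < b) (hb1 : b < 1) (hτ : 0 < τ)
    (hF : D.F b = D.chord SB α b) (hφneg : ∀ S ∈ Ioo SB α, D.F S - D.chord SB α S < 0)
    (hlt : D.speed b ST < D.speed SB α) (hsM : D.sM SB τ α = b) :
    D.DrainageData So SB ST b τ := by
  have hSBb : SB < b := hα.trans (hαST.trans hSTb)
  have hmem : ∀ S ∈ Icc SB b, S ∈ Ioo (0 : ℝ) 1 := fun S hS =>
    Icc_subset_Ioo_zero_one hSB hb1 hS
  have hmem' : ∀ S ∈ Icc SB b, S ∈ Icc (0 : ℝ) 1 := fun S hS => Ioo_subset_Icc_self (hmem S hS)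
  have hb_mem : b ∈ Icc SB b := ⟨hSBb.le, le_rfl⟩
  have hSB_mem : SB ∈ Icc SB b := ⟨le_rfl, hSBb.le⟩
  have hST_mem : ST ∈ Icc SB b := ⟨(hα.trans hαST).le, hSTb.le⟩
  -- Both chords pass through `(b, F(b))`, and the one through `ST` has the smaller slope, so it
  -- lies above the other to the left of `b`.
  have hchord : ∀ S, S < b → D.chord SB α S < D.chord b ST S := by
    intro S hS
    have h1 : D.chord SB α S = D.F b + D.speed SB α * (S - b) := by
      rw [hF, chord, chord]; ring
    rw [h1, chord]
    nlinarith [mul_pos (sub_pos.2 hlt) (sub_pos.2 hS)]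
  have hψSB : D.F SB - D.chord b ST SB < 0 := by
    have := hchord SB hSBb
    rw [chord_left] at this
    linarith
  obtain ⟨hneg, hpos⟩ := sign_of_convex_concave (hA.strictConvexOn_sub_chord b ST)
    (hA.strictConcaveOn_sub_chord b ST) hSB.le hSBo (hα.trans hαST) hSTb hb1.le hψSB.le
    (sub_eq_zero.2 (chord_right b ST).symm) (sub_eq_zero.2 (chord_left b ST).symm)
  have hint : ∀ c d : ℝ, ∀ x ∈ Icc SB b, ∀ y ∈ Icc SB b,
      IntervalIntegrable (D.G c d) volume x y := fun c d x hx y hy =>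
    ((hA.continuousOn_G c d).mono
      (ordConnected_Ioo.uIcc_subset (hmem x hx) (hmem y hy))).intervalIntegrable
  have hαin : α ∈ Icc SB b := ⟨hα.le, (hαST.trans hSTb).le⟩
  have hκ : 0 < D.speed SB α * τ :=
    mul_pos (hA.speed_pos (hmem' SB hSB_mem) (hmem' α hαin) hα.ne) hτ
  refine
    { scenario := hA
      a_pos := hSB
      a_lt_m := hα.trans hαST
      m_lt_b := hSTb
      b_lt_one := hb1
      speed_mul_pos := mul_pos (hA.speed_pos (hmem' b hb_mem) (hmem' ST hST_mem) hSTb.ne') hτ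
      G_neg := fun S hS => ?_
      G_pos := fun S hS => hA.G_pos
        (hmem S ⟨hST_mem.1.trans hS.1.le, hS.2.le⟩) (hpos S hS)
      potential_lt := ?_ }
  · refine hA.G_neg (hmem S ⟨hS.1, (hS.2.trans hSTb).le⟩) ?_
    rcases hS.1.eq_or_lt with h | h
    · rwa [← h]
    · exact hneg S ⟨h, hS.2⟩
  · obtain ⟨w, hw⟩ := hA.exists_curve_sM hSB hα hκ
      (fun S hS => hA.G_neg (hmem S ⟨hS.1.le, (hS.2.trans (hαST.trans hSTb)).le⟩) (hφneg S hS))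
      hsM hSBb
    -- The energy inequality for the infiltration curve is available for `r < b` and passes to the
    -- limit `r → b`.
    have h1 : ∫ S in SB..b, D.G SB α S ≤ 0 := by
      refine le_of_tendsto (((hA.hasDerivAt_integral_G SB α (hmem SB hSB_mem)
        (hmem b hb_mem)).continuousAt.tendsto).mono_left (nhdsWithin_le_nhds (s := Iio b))) ?_
      filter_upwards [Ioo_mem_nhdsLT hSBb] with r hr using
        hw.integral_G_nonpos hA hSB hb1.le hκ hr
    have hGlt : ∀ S ∈ Ico SB b, D.G b ST S < D.G SB α S := fun S hS => by
      have := hchord S hS.2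
      exact div_lt_div_of_pos_right (by linarith) (hA.h_pos (hmem S (Ico_subset_Icc_self hS)))
    have h2 : ∫ S in SB..b, D.G b ST S < ∫ S in SB..b, D.G SB α S := by
      refine intervalIntegral.integral_lt_integral_of_continuousOn_of_le_of_exists_lt hSBb
        ((hA.continuousOn_G b ST).mono hmem) ((hA.continuousOn_G SB α).mono hmem) (fun S hS => ?_)
        ⟨SB, hSB_mem, hGlt SB ⟨le_rfl, hSBb⟩⟩
      rcases hS.2.eq_or_lt with h | h
      · rw [h, G_eq_zero (chord_left b ST).symm, G_eq_zero hF]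
      · exact (hGlt S ⟨hS.1.le, h⟩).le
    have h3 := intervalIntegral.integral_add_adjacent_intervals
      (hint b ST ST hST_mem SB hSB_mem) (hint b ST SB hSB_mem b hb_mem)
    rw [potential, potential]
    linarith

end TwoPhaseModel

end

theorem mainTheorem4 (D : TwoPhaseModel) (So SB ST τ : ℝ)
    (hA : D.ScenarioA So) (hSB : SB ∈ Set.Ioo 0 So)
    (hG : D.NonintegrableNearOne SB)
    (hB : (ST, τ) ∈ D.regionB SB) :
    -- the drainage wave
    (∃ S p : ℝ → ℝ,
      D.IsViscousProfile τ (D.sHat SB τ) ST S p ∧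
      Filter.Tendsto (fun ξ => (S ξ, p ξ)) Filter.atBot (nhds (D.Ed (D.sHat SB τ))) ∧
      Filter.Tendsto (fun ξ => Metric.infDist (S ξ, p ξ) (segment ℝ (D.Ei ST) (D.Ed ST)))
        Filter.atTop (nhds 0)) ∧
    -- the plateau solution, whose slower shock has the drainage wave as its viscous profile
    D.speed (D.sHat SB τ) ST < D.speed SB (D.sHat SB τ) ∧
    D.IsWeakRiemannSolution ST SB (D.plateau SB (D.sHat SB τ) ST) ∧
    (∃ S p : ℝ → ℝ, D.IsViscousProfile τ SB (D.sHat SB τ) S p) ∧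
    ¬ D.OleinikShock (D.sHat SB τ) SB := by
  obtain ⟨α, hα, hαbar, hαST, hSTb, hb1, hτ, hF, hsM⟩ := hA.exists_of_mem_regionB hSB hB
  set b := D.sHat SB τ
  have hSB0 : 0 < SB := hSB.1
  have hαb : α < b := hαST.trans hSTb
  have hSBb : SB < b := hα.trans hαb
  have hmem : ∀ S ∈ Set.Ico SB b, S ∈ Set.Ioo (0 : ℝ) 1 := fun S hS =>
    ⟨hSB0.trans_le hS.1, hS.2.trans_le hb1⟩
  have hmem' : ∀ S ∈ Set.Icc SB b, S ∈ Set.Icc (0 : ℝ) 1 := fun S hS =>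
    ⟨hSB0.le.trans hS.1, hS.2.trans hb1⟩
  obtain ⟨hneg, hpos⟩ := sign_of_convex_concave (hA.strictConvexOn_sub_chord SB α)
    (hA.strictConcaveOn_sub_chord SB α) hSB0.le hSB.2.le hα hαb hb1
    (sub_eq_zero.2 (TwoPhaseModel.chord_left SB α).symm).le
    (sub_eq_zero.2 (TwoPhaseModel.chord_right SB α).symm) (sub_eq_zero.2 hF)
  have hGneg : ∀ S ∈ Set.Ioo SB α, D.G SB α S < 0 := fun S hS =>
    hA.G_neg (hmem S ⟨hS.1.le, hS.2.trans hαb⟩) (hneg S hS)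
  have hGpos : ∀ S ∈ Set.Ioo α b, 0 < D.G SB α S := fun S hS =>
    hA.G_pos (hmem S ⟨(hα.trans hS.1).le, hS.2⟩) (hpos S hS)
  have hκ : 0 < D.speed SB α * τ :=
    mul_pos (hA.speed_pos (hmem' SB ⟨le_rfl, hSBb.le⟩) (hmem' α ⟨hα.le, hαb.le⟩) hα.ne) hτ
  have hb1' : b < 1 := by
    -- If `b = 1`, the infiltration curves would come arbitrarily close to `1`, which the
    -- non-integrability of `𝒢` forbids.
    refine lt_of_le_of_ne hb1 fun h => ?_
    have hα1 : α < 1 := h ▸ hαb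
    refine (hA.sM_lt_one hSB0 hα hα1 hκ (by rwa [h] at hGpos)
      (hG α ⟨hα, hαbar⟩ α ⟨hα, hα1⟩) hsM hb1 (hSB0.trans hSBb)).ne h
  have hc : D.speed SB b = D.speed SB α := TwoPhaseModel.speed_eq_of_chord_eq hSBb.ne hF
  have hST := hpos ST ⟨hαST, hSTb⟩
  have hlt : D.speed b ST < D.speed SB α := by
    refine TwoPhaseModel.speed_lt_of_chord_lt hSTb ?_
    rw [hF]
    simp only [TwoPhaseModel.chord] at hST ⊢
    linarith
  have hdata := hA.drainageData hSB0 hSB.2.le hα hαST hSTb hb1' hτ hF hneg hlt hsM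
  refine ⟨hdata.exists_profile, by rwa [hc], ?_,
    hA.exists_infiltration_profile hSB0 hα hαb hκ hGneg hGpos hsM hb1' hF, fun hO => ?_⟩
  · exact TwoPhaseModel.isWeakRiemannSolution_plateau (hmem' SB ⟨le_rfl, hSBb.le⟩)
      (hmem' b ⟨hSBb.le, le_rfl⟩) (hmem' ST ⟨(hα.trans hαST).le, hSTb.le⟩) hSBb.ne hSTb.ne'
      (by rwa [hc])
  -- At `k = ST` the graph is above the chord from `SB` to `b`, so the slope from `SB` to `ST`
  -- exceeds the shock speed.
  · have h1 := (hO ST ⟨(min_le_right _ _).trans_lt (hα.trans hαST),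
      hSTb.trans_le (le_max_left _ _)⟩).2
    rw [TwoPhaseModel.speed_comm b SB, hc, TwoPhaseModel.speed,
      div_le_iff₀ (sub_pos.2 (hα.trans hαST))] at h1
    simp only [TwoPhaseModel.chord] at hST
    linarith
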